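/- Let $d\ge 1$, let $\Xi=\{(x,n)\in\mathbb Z^d\times\mathbb Z_+ : |x|_1+n\equiv 0 \pmod 2\}$, and let $E$ be the set of directed edges from $(x,n)\in\Xi$ to $(x\pm e_i,n+1)$, $1\le i\le d$, where $e_1,\dots,e_d$ is the standard basis of $\mathbb Z^d$. Let $\{X_e:e\in E\}$ be i.i.d. real random variables on a probability space $(\Omega,\mathcal F,P)$ with $E[X_e]=0$, such that for some $c_0>0$ one has $E[e^{cX_e}]<\infty$ for all $|c|<c_0$ (Cramér condition). Let $$Z_n=\sup_{\gamma}\sum_{e\in\gamma}X_e ,$$ where the supremum is over the directed paths $\gamma$ in $(\Xi,E)$ with $n$ edges that start at $(0,0)$. Assume that there are $0<M_0<\infty$ and a function $f:(0,\infty)\to(0,\infty)$, nondecreasing on $(M_0,\infty)$, such that $$\log P(X_e<x)=-(-x)^{d+1}f(-x)\qquad\text{for all } x<-M_0 .$$ Then there is a nonrandom constant $\mu\in\mathbb R$ with $\lim_{n\to\infty}Z_n/n=\mu$ $P$-almost surely, and there is $\varepsilon_0>0$ such that for every $\varepsilon\in(0,\varepsilon_0)$, $$\limsup_{n\to\infty}\frac1{n^{d+1}}\log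 P\bigl(Z_n\le(\mu-\varepsilon)n\bigr)<0 \quad\text{if and only if}\quad \sum_{n=1}^\infty\frac1{f(2^n)^{1/d}}<\infty .$$ -/

import Mathlib

open MeasureTheory ProbabilityTheory Filter Topology

namespace LPP

/-- The vertex set `Ξ = {(x, n) ∈ ℤ^d × ℤ₊ : |x|₁ + n ≡ 0 (mod 2)}`. -/
def Xi (d : ℕ) : Set ((Fin d → ℤ) × ℕ) :=
  {p | (∑ i, |p.1 i|) + (p.2 : ℤ) ≡ 0 [ZMOD 2]}

/-- The origin `(0, 0)`, as an element of `Ξ`. -/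
def origin (d : ℕ) : Xi d := ⟨(0, 0), by simp [Xi]⟩

/-- There is a directed edge from `u = (x, n)` to `v` iff `v = (x ± e_i, n + 1)` for some `i`. -/
def IsEdge {d : ℕ} (u v : Xi d) : Prop :=
  v.1.2 = u.1.2 + 1 ∧
    ∃ i : Fin d, v.1.1 = u.1.1 + Pi.single i 1 ∨ v.1.1 = u.1.1 - Pi.single i 1

/-- The set `E` of directed nearest neighbour edges of `Ξ`. -/
def Edge (d : ℕ) : Type := {e : Xi d × Xi d // IsEdge e.1 e.2}

/-- Directed nearest neighbour paths of length `n` in `Ξ` that start at the origin. -/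
@[ext]
structure Path (d n : ℕ) where
  /-- the vertex visited at each time -/
  vertex : Fin (n + 1) → Xi d
  start : vertex 0 = origin d
  step : ∀ i : Fin n, IsEdge (vertex i.castSucc) (vertex i.succ)

/-- The edge that the path traverses in its `i`-th step. -/
def Path.edge {d n : ℕ} (γ : Path d n) (i : Fin n) : Edge d :=
  ⟨(γ.vertex i.castSucc, γ.vertex i.succ), γ.step i⟩

/-- The value `∑_{e ∈ γ} X_e` of a path in the environment `w`. -/
noncomputable def Path.value {d n : ℕ} (γ : Path d n) (w : Edge d → ℝ) : ℝ :=
  ∑ i : Fin n, w (γ.edge i)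

/-- The last-passage functional `Z_n`: the supremum of the values of the paths of length `n` from
the origin. For `d ≥ 1` this set of paths is finite and nonempty, see below. -/
noncomputable def Z {d : ℕ} {Ω : Type*} (X : Edge d → Ω → ℝ) (n : ℕ) (ω : Ω) : ℝ :=
  ⨆ γ : Path d n, γ.value (fun e => X e ω)

instance Path.finite (d n : ℕ) : Finite (Path d n) := by
  classical
  have h : ∀ (γ : Path d n) (i : Fin n), ∃ p : Fin d × Bool,
      (γ.vertex i.succ).1.1 =
        (γ.vertex i.castSucc).1.1 + Pi.single p.1 (if p.2 then (1 : ℤ) else -1) := by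
    intro γ i
    obtain ⟨-, j, hj | hj⟩ := γ.step i
    · exact ⟨(j, true), by simpa using hj⟩
    · exact ⟨(j, false), by simp [hj, sub_eq_add_neg, Pi.single_neg]⟩
  choose F hF using h
  refine Finite.of_injective F fun γ γ' hγ => ?_
  ext1
  funext k
  induction k using Fin.induction with
  | zero => rw [γ.start, γ'.start]
  | succ i ih =>
    apply Subtype.ext
    apply Prod.ext
    · rw [hF γ i, hF γ' i, hγ, ih]
    · rw [(γ.step i).1, (γ'.step i).1, ih]

theorem Path.nonempty {d : ℕ} (hd : 1 ≤ d) (n : ℕ) : Nonempty (Path d n) := by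
  classical
  let i₀ : Fin d := ⟨0, hd⟩
  refine ⟨⟨fun k => ⟨(Pi.single i₀ (k.1 : ℤ), k.1), ?_⟩, ?_, ?_⟩⟩
  · have : ∑ i, |(Pi.single i₀ (k.1 : ℤ) : Fin d → ℤ) i| = k.1 := by
      rw [Finset.sum_eq_single i₀] <;> simp +contextual
    simp only [Xi, Set.mem_ofPred_eq, this, Int.ModEq]
    omega
  · apply Subtype.ext
    simp [origin]
  · intro i
    exact ⟨by simp, i₀, Or.inl (by simp [Pi.single_add])⟩

end LPP

/-!
A directed path may be coded by its list of steps, and the field on the edges of `Ξ` may be extended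
to an i.i.d. field on all triples (site, time, direction). This turns translations and the reflection
`x ↦ -x` into measure preserving maps of one product space.

**Law of large numbers.** A maximum over paths changes by at most `2 b` when the field on one level is
changed arbitrarily within `[-b, b]`. After truncation at `b = n ^ (1 / 4)` the bounded differences
inequality shows that passage values over `n` levels deviate from their means by `ε n` with a
probability smaller than every power of `n` (`concentration`). The means are superadditive and at most
linear, whence the constant `μ` and almost sure convergence. A union over the polynomially many
endpoints yields a length `N` and a displacement `y` for which the mean passage value to `y` in `N`
steps is at least `(μ - η) N` (`exists_endpoint`). Blocks with displacements `y, -y, y, …` form tubes of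
bounded width, and such a tube is slow with a probability exponentially small in its length.

**Upper bound when `∑ f (2 ^ i) ^ (-1 / d)` converges.** For `m` equal to a small multiple of `n`, the
tubes from `m ^ d` sites at time `m` on are all slow with probability at most `exp (-c n ^ (d + 1))`,
even after a union over the sets of at least half of these sites (`tubes_fail_le`). It remains to reach
half of these sites cheaply. A random path whose steps are the draws of a Pólya urn with `d + 1` colours
is uniformly distributed over order `k ^ d` sites at each time `k`. The average over these sites of
the negative parts of the field along the path is a sum of independent terms with weights of order
`k ^ (-d)`, and a Chernoff bound with parameter `n ^ d`, which uses the tail hypothesis at the scales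
`n / k`, shows that it exceeds `η n` with probability at most `exp (-c n ^ (d + 1))` provided a tail of
the series is small (`measure_urnCost_le_exp`).

**Lower bound when the series diverges.** With `i = log₂ (n / (k + 1))`, let all edges of level `k` that
the origin can reach be below `-A 2 ^ i f (2 ^ i) ^ (-1 / d)`, for finitely many scales `i`. Each scale
contributes `A n f (2 ^ i) ^ (-1 / d)` to the loss of every path and
`A ^ (d + 1) n ^ (d + 1) f (2 ^ i) ^ (-1 / d)` to the cost, up to constants. By divergence, the total
loss can be kept at a fixed multiple of `n` while `A`, and with it the coefficient of `n ^ (d + 1)` in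
the total cost, tends to `0` (`exp_le_measure_low`). Afterwards the field may behave typically.
-/

namespace LPP

/-! ### Independence and resampling on product spaces -/

/-- The law on `ι → ℝ` of an i.i.d. field with one-site law `ν`. -/
noncomputable abbrev iidLaw (ι : Type*) (ν : Measure ℝ) [IsProbabilityMeasure ν] :
    Measure (ι → ℝ) :=
  Measure.infinitePi (fun _ : ι => ν)

open Classical in
/-- The field that equals `w'` on `S` and `w` off `S`. -/
noncomputable def splice {ι : Type*} (S : Set ι) (w w' : ι → ℝ) : ι → ℝ :=
  fun e => if e ∈ S then w' e else w e

section Product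

variable {ι : Type*} {ν : Measure ℝ} [IsProbabilityMeasure ν]

theorem splice_of_mem {S : Set ι} {e : ι} (h : e ∈ S) (w w' : ι → ℝ) :
    splice S w w' e = w' e := by simp [splice, h]

theorem splice_of_notMem {S : Set ι} {e : ι} (h : e ∉ S) (w w' : ι → ℝ) :
    splice S w w' e = w e := by simp [splice, h]

theorem measurable_splice (S : Set ι) :
    Measurable (fun p : (ι → ℝ) × (ι → ℝ) => splice S p.1 p.2) := by
  classical
  refine measurable_pi_lambda _ fun e => ?_
  by_cases h : e ∈ S
  · simp only [splice, h, if_true]; fun_prop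
  · simp only [splice, h, if_false]; fun_prop

/-- Resampling the coordinates in `S` does not change the law of an i.i.d. field. -/
theorem measurePreserving_splice (S : Set ι) :
    MeasurePreserving (fun p : (ι → ℝ) × (ι → ℝ) => splice S p.1 p.2)
      ((iidLaw ι ν).prod (iidLaw ι ν)) (iidLaw ι ν) := by
  classical
  refine ⟨measurable_splice S, ?_⟩
  refine Measure.eq_infinitePi _ fun s t ht => ?_
  rw [Measure.map_apply (measurable_splice S)
    (MeasurableSet.pi s.countable_toSet fun i _ => ht i)]
  have : (fun p : (ι → ℝ) × (ι → ℝ) => splice S p.1 p.2) ⁻¹' (Set.pi s t) =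
      (Set.pi (s.filter (· ∉ S) : Finset ι) t) ×ˢ (Set.pi (s.filter (· ∈ S) : Finset ι) t) := by
    ext ⟨w, w'⟩
    simp only [Set.mem_preimage, Set.mem_pi, Finset.mem_coe, Set.mem_prod, Finset.mem_filter]
    constructor
    · intro h
      refine ⟨fun i hi => ?_, fun i hi => ?_⟩
      · simpa [splice_of_notMem hi.2] using h i hi.1
      · simpa [splice_of_mem hi.2] using h i hi.1
    · rintro ⟨h1, h2⟩ i hi
      by_cases hS : i ∈ S
      · simpa [splice_of_mem hS] using h2 i ⟨hi, hS⟩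
      · simpa [splice_of_notMem hS] using h1 i ⟨hi, hS⟩
  rw [this, Measure.prod_prod, Measure.infinitePi_pi _ (fun i _ => ht i),
    Measure.infinitePi_pi _ (fun i _ => ht i), mul_comm]
  exact Finset.prod_filter_mul_prod_filter_not s (· ∈ S) (fun i => ν (t i))

theorem lintegral_splice (S : Set ι) {F : (ι → ℝ) → ENNReal} (hF : Measurable F) :
    ∫⁻ w, F w ∂(iidLaw ι ν) =
      ∫⁻ w, ∫⁻ w', F (splice S w w') ∂(iidLaw ι ν) ∂(iidLaw ι ν) := by
  rw [← (measurePreserving_splice (ν := ν) S).lintegral_comp hF, lintegral_prod]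
  exact (hF.comp (measurable_splice S)).aemeasurable

theorem integrable_splice (S : Set ι) {F : (ι → ℝ) → ℝ} (hF : Integrable F (iidLaw ι ν)) :
    Integrable (fun p : (ι → ℝ) × (ι → ℝ) => F (splice S p.1 p.2))
      ((iidLaw ι ν).prod (iidLaw ι ν)) :=
  (measurePreserving_splice (ν := ν) S).integrable_comp_of_integrable hF

theorem integral_splice (S : Set ι) {F : (ι → ℝ) → ℝ} (hF : Integrable F (iidLaw ι ν)) :
    ∫ w, F w ∂(iidLaw ι ν) =
      ∫ w, ∫ w', F (splice S w w') ∂(iidLaw ι ν) ∂(iidLaw ι ν) := by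
  rw [← integral_prod _ (integrable_splice S hF)]
  conv_lhs => rw [← (measurePreserving_splice (ν := ν) S).map_eq]
  rw [integral_map (measurable_splice S).aemeasurable]
  rw [(measurePreserving_splice (ν := ν) S).map_eq]
  exact hF.1

theorem lintegral_mul_of_dependsOn {S T : Set ι} (hST : Disjoint S T)
    {F G : (ι → ℝ) → ENNReal} (hF : Measurable F) (hG : Measurable G)
    (hFS : DependsOn F S) (hGT : DependsOn G T) :
    ∫⁻ w, F w * G w ∂(iidLaw ι ν) = (∫⁻ w, F w ∂(iidLaw ι ν)) * ∫⁻ w, G w ∂(iidLaw ι ν) := by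
  rw [lintegral_splice T (F := fun w => F w * G w) (hF.mul hG)]
  have : ∀ w w' : ι → ℝ, F (splice T w w') * G (splice T w w') = F w * G w' := by
    intro w w'
    congr 1
    · exact hFS fun e he => splice_of_notMem (Set.disjoint_left.1 hST he) w w'
    · exact hGT fun e he => splice_of_mem he w w'
  simp only [this]
  simp_rw [lintegral_const_mul _ hG]
  rw [lintegral_mul_const _ hF]

theorem lintegral_prod_of_dependsOn {κ : Type*} (s : Finset κ) (S : κ → Set ι)
    (hS : (s : Set κ).PairwiseDisjoint S) (F : κ → (ι → ℝ) → ENNReal)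
    (hF : ∀ i ∈ s, Measurable (F i)) (hFS : ∀ i ∈ s, DependsOn (F i) (S i)) :
    ∫⁻ w, ∏ i ∈ s, F i w ∂(iidLaw ι ν) = ∏ i ∈ s, ∫⁻ w, F i w ∂(iidLaw ι ν) := by
  classical
  induction s using Finset.induction_on with
  | empty => simp
  | insert a s ha ih =>
    simp only [Finset.prod_insert ha]
    rw [lintegral_mul_of_dependsOn (S := S a) (T := ⋃ i ∈ s, S i) ?_ (hF a (by simp)) ?_
      (hFS a (by simp)) ?_, ih]
    · exact hS.subset (by simp)
    · exact fun i hi => hF i (by simp [hi])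
    · exact fun i hi => hFS i (by simp [hi])
    · rw [Set.disjoint_iUnion₂_right]
      intro i hi
      exact hS (by simp) (by simp [hi]) (fun h => ha (h ▸ hi))
    · exact Finset.measurable_prod _ fun i hi => hF i (by simp [hi])
    · intro w w' h
      refine Finset.prod_congr rfl fun i hi => hFS i (by simp [hi]) fun e he => h e ?_
      exact Set.mem_biUnion hi he

theorem measure_inter_of_dependsOn {S T : Set ι} (hST : Disjoint S T)
    {A B : Set (ι → ℝ)} (hA : MeasurableSet A) (hB : MeasurableSet B)
    (hAS : DependsOn (fun w => w ∈ A) S) (hBT : DependsOn (fun w => w ∈ B) T) :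
    iidLaw ι ν (A ∩ B) = iidLaw ι ν A * iidLaw ι ν B := by
  classical
  have h := lintegral_mul_of_dependsOn (ν := ν) hST (F := A.indicator 1) (G := B.indicator 1)
    (measurable_one.indicator hA) (measurable_one.indicator hB) ?_ ?_
  · rw [lintegral_indicator_one hA, lintegral_indicator_one hB, ← lintegral_indicator_one
      (hA.inter hB)] at *
    rw [← h]
    refine lintegral_congr fun w => ?_
    by_cases h1 : w ∈ A <;> by_cases h2 : w ∈ B <;> simp [h1, h2]
  · intro w w' h
    have := hAS h
    simp only [Set.indicator, this, Pi.one_apply]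
  · intro w w' h
    have := hBT h
    simp only [Set.indicator, this, Pi.one_apply]

/-- The law of an i.i.d. field is invariant under injective relabelling of the index set. -/
theorem measurePreserving_relabel {κ : Type*} {τ : κ → ι} (hτ : Function.Injective τ) :
    MeasurePreserving (fun (w : ι → ℝ) (i : κ) => w (τ i)) (iidLaw ι ν) (iidLaw κ ν) :=
  ⟨by fun_prop, Measure.map_infinitePi_infinitePi_of_inj hτ⟩

theorem measurePreserving_apply (e : ι) :
    MeasurePreserving (fun w : ι → ℝ => w e) (iidLaw ι ν) ν :=
  measurePreserving_eval_infinitePi (μ := fun _ : ι => ν) e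

theorem integral_comp_measurePreserving {α β : Type*} [MeasurableSpace α] [MeasurableSpace β]
    {μ : Measure α} {ρ : Measure β} {g : α → β} (hg : MeasurePreserving g μ ρ) {F : β → ℝ}
    (hF : Measurable F) : ∫ x, F (g x) ∂μ = ∫ y, F y ∂ρ := by
  rw [← hg.map_eq, integral_map hg.measurable.aemeasurable hF.aestronglyMeasurable]

/-! ### Bounded differences -/

/-- A bounded differences inequality in which all the coordinates of one level are changed at once.
Averaging over the last level costs a factor given by Hoeffding's lemma. -/
theorem integral_exp_le_of_level_differences (lvl : ι → ℕ) (T : Finset ℕ) {c : ℝ} (lam : ℝ) :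
    ∀ (F : (ι → ℝ) → ℝ) (_ : Measurable F) (B : ℝ) (_ : ∀ w, |F w| ≤ B)
      (_ : DependsOn F {e | lvl e ∈ T})
      (_ : ∀ j w w', (∀ e, lvl e ≠ j → w e = w' e) → |F w - F w'| ≤ c),
      ∫ w, Real.exp (lam * F w) ∂(iidLaw ι ν) ≤
        Real.exp (T.card * (c ^ 2 * lam ^ 2 / 2)) *
          Real.exp (lam * ∫ w, F w ∂(iidLaw ι ν)) := by
  classical
  induction T using Finset.induction_on with
  | empty =>
    intro F hF B hB hdep hc
    have : F = fun _ => F 0 := by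
      funext w
      exact hdep fun e he => by simp at he
    rw [this]
    simp
  | insert j T hj ih =>
    intro F hF B hB hdep hc
    have hc0 : 0 ≤ c := by simpa using hc 0 0 0 (fun _ _ => rfl)
    set S : Set ι := {e | lvl e = j} with hS
    set G : (ι → ℝ) → ℝ := fun w => ∫ w', F (splice S w w') ∂(iidLaw ι ν) with hG
    have hint : Integrable F (iidLaw ι ν) :=
      Integrable.of_bound hF.aestronglyMeasurable B (ae_of_all _ hB)
    have hmeas2 : Measurable (fun p : (ι → ℝ) × (ι → ℝ) => F (splice S p.1 p.2)) :=
      hF.comp (measurable_splice S)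
    have hmeas1 : ∀ w, Measurable (fun w' => F (splice S w w')) := fun w =>
      hmeas2.comp (measurable_const.prodMk measurable_id)
    have hint1 : ∀ w, Integrable (fun w' => F (splice S w w')) (iidLaw ι ν) := fun w =>
      Integrable.of_bound (hmeas1 w).aestronglyMeasurable B (ae_of_all _ fun _ => hB _)
    have hGm : Measurable G := (hmeas2.stronglyMeasurable.integral_prod_right).measurable
    have hGB : ∀ w, |G w| ≤ B := fun w => by
      have := norm_integral_le_of_norm_le_const (μ := iidLaw ι ν)
        (f := fun w' => F (splice S w w')) (C := B) (ae_of_all _ fun w' => hB _)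
      simpa using this
    have hGdep : DependsOn G {e | lvl e ∈ T} := by
      intro w w' h
      simp only [hG]
      refine integral_congr_ae (ae_of_all _ fun v => ?_)
      refine hdep fun e he => ?_
      by_cases heS : e ∈ S
      · simp [splice_of_mem heS]
      · simp only [splice_of_notMem heS]
        refine h e ?_
        simp only [Set.mem_ofPred_eq, Finset.mem_insert] at he
        exact he.resolve_left heS
    have hGc : ∀ j w w', (∀ e, lvl e ≠ j → w e = w' e) → |G w - G w'| ≤ c := by
      intro i w w' h
      simp only [hG]
      rw [← integral_sub (hint1 w) (hint1 w')]
      have := norm_integral_le_of_norm_le_const (μ := iidLaw ι ν)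
        (f := fun v => F (splice S w v) - F (splice S w' v)) (C := c) (ae_of_all _ fun v => ?_)
      · simpa using this
      · refine hc i _ _ fun e he => ?_
        by_cases heS : e ∈ S
        · simp [splice_of_mem heS]
        · simp only [splice_of_notMem heS]
          exact h e he
    have hexpB : ∀ H : (ι → ℝ) → ℝ, Measurable H → (∀ w, |H w| ≤ B) →
        Integrable (fun w => Real.exp (lam * H w)) (iidLaw ι ν) := by
      intro H hH hHB
      refine Integrable.of_bound (by fun_prop) (Real.exp (|lam| * B)) (ae_of_all _ fun w => ?_)
      rw [Real.norm_eq_abs, Real.abs_exp]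
      refine Real.exp_le_exp.2 ((le_abs_self _).trans ?_)
      rw [abs_mul]
      exact mul_le_mul_of_nonneg_left (hHB w) (abs_nonneg _)
    have hstep : ∀ w, ∫ w', Real.exp (lam * F (splice S w w')) ∂(iidLaw ι ν) ≤
        Real.exp (c ^ 2 * lam ^ 2 / 2) * Real.exp (lam * G w) := by
      intro w
      have hsub := hasSubgaussianMGF_of_mem_Icc (μ := iidLaw ι ν)
        (X := fun w' => F (splice S w w')) (a := F w - c) (b := F w + c)
        (hmeas1 w).aemeasurable (ae_of_all _ fun w' => ?_)
      · have h1 := hsub.mgf_le lam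
        have h2 : ((((‖(F w + c) - (F w - c)‖₊ / 2) ^ 2 : NNReal)) : ℝ) = c ^ 2 := by
          have : (F w + c) - (F w - c) = 2 * c := by ring
          rw [this]
          push_cast
          rw [Real.norm_eq_abs, abs_of_nonneg (by positivity)]
          ring
        rw [h2] at h1
        have h3 : mgf (fun w' => F (splice S w w') - G w) (iidLaw ι ν) lam =
            Real.exp (-(lam * G w)) *
              ∫ w', Real.exp (lam * F (splice S w w')) ∂(iidLaw ι ν) := by
          rw [mgf, ← integral_const_mul]
          refine integral_congr_ae (ae_of_all _ fun v => ?_)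
          simp only []
          rw [← Real.exp_add]
          ring_nf
        change mgf (fun w' => F (splice S w w') - G w) (iidLaw ι ν) lam ≤ _ at h1
        rw [h3] at h1
        have h4 := mul_le_mul_of_nonneg_right h1 (Real.exp_pos (lam * G w)).le
        calc _ = Real.exp (-(lam * G w)) *
              (∫ w', Real.exp (lam * F (splice S w w')) ∂(iidLaw ι ν)) *
              Real.exp (lam * G w) := by
              rw [mul_right_comm, ← Real.exp_add]; simp
          _ ≤ _ := h4
      · have := hc j (splice S w w') w (fun e he => splice_of_notMem (S := S) he w w')
        rw [abs_le] at this
        exact ⟨by linarith, by linarith⟩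
    have hGint : ∫ w, G w ∂(iidLaw ι ν) = ∫ w, F w ∂(iidLaw ι ν) := (integral_splice S hint).symm
    rw [integral_splice S (hexpB F hF hB)]
    calc _ ≤ ∫ w, Real.exp (c ^ 2 * lam ^ 2 / 2) * Real.exp (lam * G w) ∂(iidLaw ι ν) := by
          refine integral_mono ?_ ((hexpB G hGm hGB).const_mul _) hstep
          exact (integrable_splice S (hexpB F hF hB)).integral_prod_left
      _ = Real.exp (c ^ 2 * lam ^ 2 / 2) * ∫ w, Real.exp (lam * G w) ∂(iidLaw ι ν) :=
          integral_const_mul _ _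
      _ ≤ Real.exp (c ^ 2 * lam ^ 2 / 2) * (Real.exp (T.card * (c ^ 2 * lam ^ 2 / 2)) *
          Real.exp (lam * ∫ w, G w ∂(iidLaw ι ν))) :=
          mul_le_mul_of_nonneg_left (ih G hGm B hGB hGdep hGc) (Real.exp_pos _).le
      _ = _ := by
          rw [hGint, Finset.card_insert_of_notMem hj, ← mul_assoc, ← Real.exp_add]
          push_cast
          ring_nf

/-- The Chernoff bound that follows from `integral_exp_le_of_level_differences`. -/
theorem measure_ge_le_of_level_differences (lvl : ι → ℕ) (T : Finset ℕ) {c : ℝ}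
    (F : (ι → ℝ) → ℝ) (hF : Measurable F) (B : ℝ) (hB : ∀ w, |F w| ≤ B)
    (hdep : DependsOn F {e | lvl e ∈ T})
    (hc : ∀ j w w', (∀ e, lvl e ≠ j → w e = w' e) → |F w - F w'| ≤ c) {t lam : ℝ}
    (hlam : 0 ≤ lam) :
    (iidLaw ι ν).real {w | t ≤ F w - ∫ w, F w ∂(iidLaw ι ν)} ≤
      Real.exp (T.card * (c ^ 2 * lam ^ 2 / 2) - lam * t) := by
  set m := ∫ w, F w ∂(iidLaw ι ν)
  have hexpB : Integrable (fun w => Real.exp (lam * (F w - m))) (iidLaw ι ν) := by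
    refine Integrable.of_bound (by fun_prop) (Real.exp (|lam| * (B + |m|)))
      (ae_of_all _ fun w => ?_)
    rw [Real.norm_eq_abs, Real.abs_exp]
    refine Real.exp_le_exp.2 ((le_abs_self _).trans ?_)
    rw [abs_mul]
    exact mul_le_mul_of_nonneg_left ((abs_sub _ _).trans (by linarith [hB w])) (abs_nonneg _)
  refine (measure_ge_le_exp_mul_mgf t hlam hexpB).trans ?_
  have h1 := integral_exp_le_of_level_differences (ν := ν) lvl T lam F hF B hB hdep hc
  have h3 : mgf (fun w => F w - m) (iidLaw ι ν) lam =
      Real.exp (-(lam * m)) * ∫ w, Real.exp (lam * F w) ∂(iidLaw ι ν) := by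
    rw [mgf, ← integral_const_mul]
    refine integral_congr_ae (ae_of_all _ fun v => ?_)
    simp only []
    rw [← Real.exp_add]
    ring_nf
  rw [h3]
  calc _ ≤ Real.exp (-lam * t) * (Real.exp (-(lam * m)) *
        (Real.exp (T.card * (c ^ 2 * lam ^ 2 / 2)) * Real.exp (lam * m))) := by gcongr
    _ = _ := by
      rw [← Real.exp_add, ← Real.exp_add, ← Real.exp_add]
      ring_nf

/-- `F` is Lipschitz for the distance that sums over the levels in `T` the largest change of the
field on the part of `R` in that level. -/
def LevelLip (lvl : ι → ℕ) (R : Finset ι) (T : Finset ℕ) (F : (ι → ℝ) → ℝ) : Prop :=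
  ∀ β : ℕ → ℝ, (∀ j, 0 ≤ β j) → ∀ w w' : ι → ℝ,
    (∀ e ∈ R, |w e - w' e| ≤ β (lvl e)) → |F w - F w'| ≤ ∑ j ∈ T, β j

namespace LevelLip

variable {lvl : ι → ℕ} {R : Finset ι} {T : Finset ℕ} {F : (ι → ℝ) → ℝ}

theorem dependsOn (h : LevelLip lvl R T F) :
    DependsOn F {e | e ∈ R ∧ lvl e ∈ T} := by
  classical
  intro w w' hw
  have := h (fun j => if j ∈ T then 0 else ∑ e ∈ R, |w e - w' e|)
    (fun j => by split_ifs <;> positivity) w w' (fun e he => ?_)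
  · rw [Finset.sum_congr rfl (fun j hj => if_pos hj), Finset.sum_const_zero] at this
    exact sub_eq_zero.1 (abs_nonpos_iff.1 this)
  · split_ifs with hT
    · simp [hw e ⟨he, hT⟩]
    · exact Finset.single_le_sum (f := fun e => |w e - w' e|) (fun _ _ => abs_nonneg _) he

theorem abs_sub_le_card_mul (h : LevelLip lvl R T F) (w w' : ι → ℝ) :
    |F w - F w'| ≤ T.card * ∑ e ∈ R, |w e - w' e| := by
  have := h (fun _ => ∑ e ∈ R, |w e - w' e|) (fun _ => by positivity) w w' (fun e he =>
    Finset.single_le_sum (f := fun e => |w e - w' e|) (fun _ _ => abs_nonneg _) he)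
  simpa using this

theorem neg (h : LevelLip lvl R T F) : LevelLip lvl R T (fun w => -F w) := by
  intro β hβ w w' hw
  have := h β hβ w w' hw
  rw [← abs_neg] at this
  convert this using 2
  ring

end LevelLip

end Product

end LPP

namespace LPP

/-! ### Truncation and concentration -/

section Concentration

variable {ι : Type*} {ν : Measure ℝ} [IsProbabilityMeasure ν]

/-- Truncation of a real number to the interval `[-b, b]`. -/
noncomputable def clamp (b x : ℝ) : ℝ := max (-b) (min b x)

theorem abs_clamp_le {b : ℝ} (hb : 0 ≤ b) (x : ℝ) : |clamp b x| ≤ b := by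
  rw [clamp, abs_le]
  exact ⟨le_max_left _ _, max_le (by linarith) (min_le_left _ _)⟩

theorem clamp_of_abs_le {b x : ℝ} (h : |x| ≤ b) : clamp b x = x := by
  rw [abs_le] at h
  rw [clamp, min_eq_right h.2, max_eq_right h.1]

theorem abs_sub_clamp_le_abs {b : ℝ} (hb : 0 ≤ b) (x : ℝ) : |x - clamp b x| ≤ |x| := by
  unfold clamp
  rcases le_total x b with h1 | h1
  · rw [min_eq_right h1]
    rcases le_total (-b) x with h2 | h2
    · rw [max_eq_right h2]; simp
    · rw [max_eq_left h2, abs_of_nonpos (by linarith), abs_of_nonpos (by linarith)]; linarith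
  · rw [min_eq_left h1, max_eq_right (by linarith), abs_of_nonneg (by linarith),
      abs_of_nonneg (by linarith)]
    linarith

theorem abs_le_exp {c : ℝ} (hc : 0 < c) (x : ℝ) : |x| ≤ 1 / c * Real.exp (c * |x|) := by
  rw [one_div, ← div_eq_inv_mul, le_div_iff₀ hc]
  nlinarith [Real.add_one_le_exp (c * |x|)]

theorem abs_sub_clamp_le {b c : ℝ} (hb : 0 ≤ b) (hc : 0 < c) (x : ℝ) :
    |x - clamp b x| ≤ 2 / c * Real.exp (-(c * b / 2)) * Real.exp (c * |x|) := by
  rcases le_or_gt |x| b with h | h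
  · rw [clamp_of_abs_le h]; simp; positivity
  · refine (abs_sub_clamp_le_abs hb x).trans ((abs_le_exp (half_pos hc) x).trans ?_)
    rw [mul_assoc, ← Real.exp_add]
    have : 1 / (c / 2) = 2 / c := by field_simp
    rw [this]
    have h2 : c / 2 * |x| ≤ -(c * b / 2) + c * |x| := by nlinarith
    gcongr

theorem integrable_id_of_exp {ρ : Measure ℝ} {c : ℝ} (hc : 0 < c)
    (hρ : Integrable (fun x => Real.exp (c * |x|)) ρ) : Integrable (fun x : ℝ => x) ρ := by
  refine (hρ.const_mul (1 / c)).mono' (by fun_prop) (ae_of_all _ fun x => ?_)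
  exact abs_le_exp hc x

theorem measure_abs_gt_le {c : ℝ} (hc : 0 < c)
    (hν : Integrable (fun x => Real.exp (c * |x|)) ν) (b : ℝ) :
    ν.real {x | b < |x|} ≤ (∫ x, Real.exp (c * |x|) ∂ν) * Real.exp (-(c * b)) := by
  have h := mul_meas_ge_le_integral_of_nonneg (μ := ν) (f := fun x => Real.exp (c * |x|))
    (ae_of_all _ fun x => (Real.exp_pos _).le) hν (Real.exp (c * b))
  rw [Real.exp_neg, ← div_eq_mul_inv, le_div_iff₀ (Real.exp_pos _), mul_comm]
  refine le_trans ?_ h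
  refine mul_le_mul_of_nonneg_left ?_ (Real.exp_pos _).le
  refine measureReal_mono fun x hx => ?_
  exact Real.exp_le_exp.2 (mul_le_mul_of_nonneg_left (le_of_lt hx) hc.le)

theorem LevelLip.integrable {lvl : ι → ℕ} {R : Finset ι} {T : Finset ℕ} {F : (ι → ℝ) → ℝ}
    (h : LevelLip lvl R T F) (hF : Measurable F) (hν : Integrable (fun x : ℝ => x) ν) :
    Integrable F (iidLaw ι ν) := by
  have h1 : ∀ e, Integrable (fun w : ι → ℝ => w e) (iidLaw ι ν) := fun e =>
    (measurePreserving_apply (ν := ν) e).integrable_comp_of_integrable hν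
  have h2 : Integrable (fun w : ι → ℝ => T.card * ∑ e ∈ R, |w e| + |F 0|) (iidLaw ι ν) :=
    ((integrable_finsetSum _ fun e _ => (h1 e).abs).const_mul _).add (integrable_const _)
  refine h2.mono' hF.aestronglyMeasurable (ae_of_all _ fun w => ?_)
  have := h.abs_sub_le_card_mul w 0
  simp only [Pi.zero_apply, sub_zero] at this
  have h3 := abs_sub_abs_le_abs_sub (F w) (F 0)
  rw [Real.norm_eq_abs]
  linarith

/-- The truncated functional `w ↦ F (clamp b ∘ w)` has bounded differences in every level. -/
theorem LevelLip.measure_clamp_le {lvl : ι → ℕ} {R : Finset ι} {T : Finset ℕ}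
    {F : (ι → ℝ) → ℝ} (h : LevelLip lvl R T F) (hF : Measurable F) {b : ℝ} (hb : 0 < b)
    {lam t : ℝ} (hlam : 0 ≤ lam) :
    (iidLaw ι ν).real {w | t ≤ F (fun e => clamp b (w e)) -
        ∫ w, F (fun e => clamp b (w e)) ∂(iidLaw ι ν)} ≤
      Real.exp (T.card * ((2 * b) ^ 2 * lam ^ 2 / 2) - lam * t) := by
  have hcl : Measurable (clamp b) := by unfold clamp; fun_prop
  refine measure_ge_le_of_level_differences lvl T (c := 2 * b)
    (fun w => F (fun e => clamp b (w e))) (hF.comp (by fun_prop)) (|F 0| + T.card * b) ?_ ?_ ?_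
    hlam
  · intro w
    have := h (fun _ => b) (fun _ => hb.le) (fun e => clamp b (w e)) 0
      (fun e _ => by simpa using abs_clamp_le hb.le (w e))
    have h3 := abs_sub_abs_le_abs_sub (F (fun e => clamp b (w e))) (F 0)
    simp only [Finset.sum_const, nsmul_eq_mul] at this
    linarith
  · intro w w' hw
    refine h.dependsOn fun e he => ?_
    simp only [hw e he.2]
  · intro j w w' hw
    have := h (fun i => if i = j then 2 * b else 0) (fun i => by split_ifs <;> positivity)
      (fun e => clamp b (w e)) (fun e => clamp b (w' e)) (fun e _ => ?_)
    · refine this.trans ?_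
      rw [Finset.sum_ite_eq']
      split_ifs <;> linarith
    · by_cases he : lvl e = j
      · rw [if_pos he]
        have h1 := abs_clamp_le hb.le (w e)
        have h2 := abs_clamp_le hb.le (w' e)
        exact (abs_sub _ _).trans (by linarith)
      · simp [he, hw e he]

theorem tendsto_natCast_pow_mul_exp_neg_sqrt (q : ℕ) {a : ℝ} (ha : 0 < a) :
    Tendsto (fun n : ℕ => (n : ℝ) ^ q * Real.exp (-(a * √√(n : ℝ)))) atTop (𝓝 0) := by
  have h1 : Tendsto (fun n : ℕ => √√(n : ℝ)) atTop atTop :=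
    (Real.tendsto_sqrt_atTop.comp Real.tendsto_sqrt_atTop).comp tendsto_natCast_atTop_atTop
  have h2 := (Real.tendsto_pow_mul_exp_neg_atTop_nhds_zero (4 * q)).comp (h1.const_mul_atTop ha)
  have h3 := h2.const_mul ((1 / a) ^ (4 * q))
  rw [mul_zero] at h3
  refine h3.congr fun n => ?_
  simp only [Function.comp_apply]
  rw [← mul_assoc, ← mul_pow]
  congr 1
  rw [← mul_assoc, one_div_mul_cancel ha.ne', one_mul, pow_mul]
  congr 1
  rw [show (4 : ℕ) = 2 * 2 from rfl, pow_mul, Real.sq_sqrt (Real.sqrt_nonneg _),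
    Real.sq_sqrt (Nat.cast_nonneg _)]

/-- Functionals of at most `n` levels and polynomially many sites deviate from their mean by
`ε n` with a probability that is smaller than every power of `n`.  The field is truncated at
`n ^ (1 / 4)`. -/
theorem concentration {c : ℝ} (hc : 0 < c) (hν : Integrable (fun x => Real.exp (c * |x|)) ν)
    (lvl : ι → ℕ) (A : ℝ) (Q : ℕ) {ε : ℝ} (hε : 0 < ε) :
    ∃ u : ℕ → ℝ, (∀ q : ℕ, Tendsto (fun n : ℕ => (n : ℝ) ^ q * u n) atTop (𝓝 0)) ∧
      ∀ᶠ n : ℕ in atTop, ∀ (R : Finset ι) (T : Finset ℕ) (F : (ι → ℝ) → ℝ),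
        T.card ≤ n → (R.card : ℝ) ≤ A * n ^ Q → Measurable F → LevelLip lvl R T F →
        (iidLaw ι ν).real {w | ε * n ≤ |F w - ∫ w, F w ∂(iidLaw ι ν)|} ≤ u n := by
  set K := ∫ x, Real.exp (c * |x|) ∂ν with hK
  have hK0 : 0 ≤ K := integral_nonneg fun x => (Real.exp_pos _).le
  refine ⟨fun n => A * n ^ Q * (K * Real.exp (-(c * √√(n : ℝ)))) +
    2 * Real.exp (-(ε ^ 2 / 32 * √√(n : ℝ))), ?_, ?_⟩
  · intro q
    have h1 := (tendsto_natCast_pow_mul_exp_neg_sqrt (q + Q) hc).const_mul (A * K)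
    have h2 := (tendsto_natCast_pow_mul_exp_neg_sqrt q (a := ε ^ 2 / 32) (by positivity)).const_mul 2
    have h3 := h1.add h2
    simp only [mul_zero, add_zero] at h3
    refine h3.congr fun n => ?_
    rw [pow_add]
    ring
  have hev : ∀ᶠ n : ℕ in atTop, A * (2 / c) * K *
      ((n : ℝ) ^ Q * Real.exp (-(c / 2 * √√(n : ℝ)))) < ε / 2 := by
    have h1 := (tendsto_natCast_pow_mul_exp_neg_sqrt Q (a := c / 2) (by positivity)).const_mul
      (A * (2 / c) * K)
    rw [mul_zero] at h1
    exact h1.eventually_lt_const (by positivity)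
  filter_upwards [hev, eventually_ge_atTop 1] with n hn hn1 R T F hT hR hF hL
  have hn1' : (1 : ℝ) ≤ n := by exact_mod_cast hn1
  -- large enough for the tail bound, small compared with the square root of `n`
  set b := √√(n : ℝ) with hb
  have hb1 : 1 ≤ b := by rw [hb, Real.one_le_sqrt, Real.one_le_sqrt]; exact hn1'
  have hb0 : 0 < b := by linarith
  have hb2 : b ^ 2 * b ^ 2 = n := by
    rw [hb, Real.sq_sqrt (Real.sqrt_nonneg _), Real.mul_self_sqrt (by positivity)]
  have hcl : Measurable (clamp b) := by unfold clamp; fun_prop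
  set Fb : (ι → ℝ) → ℝ := fun w => F (fun e => clamp b (w e)) with hFb
  have hFbm : Measurable Fb := hF.comp (by fun_prop)
  have hidν := integrable_id_of_exp hc hν
  have hFi := hL.integrable hF hidν
  have hexp : ∀ e : ι, Integrable (fun w : ι → ℝ => Real.exp (c * |w e|)) (iidLaw ι ν) := fun e =>
    (measurePreserving_apply (ν := ν) e).integrable_comp_of_integrable hν
  have hpt : ∀ w, |F w - Fb w| ≤
      n * ∑ e ∈ R, 2 / c * Real.exp (-(c * b / 2)) * Real.exp (c * |w e|) := by
    intro w
    refine (hL.abs_sub_le_card_mul _ _).trans ?_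
    have : (T.card : ℝ) ≤ n := by exact_mod_cast hT
    gcongr with e he
    exact abs_sub_clamp_le hb0.le hc _
  have hdom : Integrable (fun w : ι → ℝ =>
      n * ∑ e ∈ R, 2 / c * Real.exp (-(c * b / 2)) * Real.exp (c * |w e|)) (iidLaw ι ν) :=
    (integrable_finsetSum _ fun e _ => (hexp e).const_mul _).const_mul _
  have hdiff : Integrable (fun w => F w - Fb w) (iidLaw ι ν) :=
    hdom.mono' (hF.sub hFbm).aestronglyMeasurable (ae_of_all _ hpt)
  have hFbi : Integrable Fb (iidLaw ι ν) := by
    have := hFi.sub hdiff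
    refine this.congr (ae_of_all _ fun w => by simp)
  have hmean : |∫ w, F w ∂(iidLaw ι ν) - ∫ w, Fb w ∂(iidLaw ι ν)| ≤ ε / 2 * n := by
    rw [← integral_sub hFi hFbi]
    refine (abs_integral_le_integral_abs).trans ?_
    refine (integral_mono hdiff.abs hdom hpt).trans ?_
    rw [integral_const_mul, integral_finsetSum _ fun e _ => (hexp e).const_mul _]
    have : ∀ e ∈ R, ∫ w : ι → ℝ, 2 / c * Real.exp (-(c * b / 2)) * Real.exp (c * |w e|)
        ∂(iidLaw ι ν) = 2 / c * Real.exp (-(c * b / 2)) * K := by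
      intro e _
      rw [integral_const_mul, hK]
      congr 1
      exact integral_comp_measurePreserving (measurePreserving_apply (ν := ν) e)
        (F := fun x => Real.exp (c * |x|)) (by fun_prop)
    rw [Finset.sum_congr rfl this, Finset.sum_const, nsmul_eq_mul, mul_comm]
    refine mul_le_mul_of_nonneg_right ?_ (by positivity)
    refine le_trans ?_ hn.le
    calc _ ≤ A * n ^ Q * (2 / c * Real.exp (-(c * b / 2)) * K) := by gcongr
      _ = _ := by
        rw [show c * b / 2 = c / 2 * b by ring]
        ring
  have hsub : {w | ε * n ≤ |F w - ∫ w, F w ∂(iidLaw ι ν)|} ⊆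
      (⋃ e ∈ R, {w : ι → ℝ | b < |w e|}) ∪
      ({w | ε / 2 * n ≤ Fb w - ∫ w, Fb w ∂(iidLaw ι ν)} ∪
       {w | ε / 2 * n ≤ -Fb w - ∫ w, -Fb w ∂(iidLaw ι ν)}) := by
    intro w hw
    by_contra hcon
    simp only [Set.mem_union, Set.mem_iUnion, Set.mem_ofPred_eq, not_or, not_exists, not_lt,
      not_le, integral_neg] at hcon hw
    obtain ⟨h1, h2, h3⟩ := hcon
    have h4 : F w = Fb w := hL.dependsOn fun e he => by
      simp only [clamp_of_abs_le (h1 e he.1)]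
    rw [h4] at hw
    rw [abs_le] at hmean
    rcases le_abs.1 hw with h5 | h5 <;> linarith
  have hbad : (iidLaw ι ν).real (⋃ e ∈ R, {w : ι → ℝ | b < |w e|}) ≤
      A * n ^ Q * (K * Real.exp (-(c * b))) := by
    refine (measureReal_biUnion_finset_le _ _).trans ?_
    have : ∀ e ∈ R, (iidLaw ι ν).real {w : ι → ℝ | b < |w e|} ≤ K * Real.exp (-(c * b)) := by
      intro e _
      have hms : MeasurableSet {x : ℝ | b < |x|} := measurableSet_lt (by fun_prop) (by fun_prop)
      have := (measurePreserving_apply (ν := ν) e).measure_preimage hms.nullMeasurableSet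
      have h2 : (iidLaw ι ν).real {w : ι → ℝ | b < |w e|} = ν.real {x | b < |x|} := by
        simp only [Measure.real]
        rw [← this]; rfl
      rw [h2]
      exact measure_abs_gt_le hc hν b
    refine (Finset.sum_le_sum this).trans ?_
    rw [Finset.sum_const, nsmul_eq_mul]
    gcongr
  have hchern : ∀ G : (ι → ℝ) → ℝ, Measurable G → LevelLip lvl R T G →
      (iidLaw ι ν).real {w | ε / 2 * n ≤ G (fun e => clamp b (w e)) -
        ∫ w, G (fun e => clamp b (w e)) ∂(iidLaw ι ν)} ≤ Real.exp (-(ε ^ 2 / 32 * b)) := by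
    intro G hG hGL
    refine (hGL.measure_clamp_le hG hb0 (lam := ε / (8 * b ^ 2)) (by positivity)).trans ?_
    refine Real.exp_le_exp.2 ?_
    have hT' : (T.card : ℝ) ≤ b ^ 2 * b ^ 2 := by rw [hb2]; exact_mod_cast hT
    have h1 : (T.card : ℝ) * ((2 * b) ^ 2 * (ε / (8 * b ^ 2)) ^ 2 / 2) ≤
        (b ^ 2 * b ^ 2) * ((2 * b) ^ 2 * (ε / (8 * b ^ 2)) ^ 2 / 2) :=
      mul_le_mul_of_nonneg_right hT' (by positivity)
    have h2 : (b ^ 2 * b ^ 2) * ((2 * b) ^ 2 * (ε / (8 * b ^ 2)) ^ 2 / 2) -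
        ε / (8 * b ^ 2) * (ε / 2 * (b ^ 2 * b ^ 2)) = -(ε ^ 2 / 32 * b ^ 2) := by
      field_simp
      ring
    rw [← hb2]
    have h3 : ε ^ 2 / 32 * b ≤ ε ^ 2 / 32 * b ^ 2 := by
      refine mul_le_mul_of_nonneg_left ?_ (by positivity)
      nlinarith
    linarith
  refine (measureReal_mono hsub).trans ((measureReal_union_le _ _).trans ?_)
  refine add_le_add hbad ((measureReal_union_le _ _).trans ?_)
  have h1 := hchern F hF hL
  have h2 := hchern (fun w => -F w) hF.neg hL.neg
  have : ∀ x y z : ℝ, x ≤ z → y ≤ z → x + y ≤ 2 * z := fun x y z _ _ => by linarith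
  exact this _ _ _ h1 h2

end Concentration

end LPP

namespace LPP

/-! ### Directed paths as lists of steps -/

/-- A step direction: the coordinate that changes, and whether it increases. -/
abbrev Dir (d : ℕ) : Type := Fin d × Bool

/-- The spatial lattice. -/
abbrev Site (d : ℕ) : Type := Fin d → ℤ

/-- The edge that leaves the site `x` at time `k` in direction `c` is encoded as `(x, k, c)`.
Both parity classes of `ℤ^d × ℕ` are kept, so that translations act freely. -/
abbrev Bond (d : ℕ) : Type := Site d × ℕ × Dir d

variable {d : ℕ}

/-- The time coordinate of an edge. -/
def lvl (e : Bond d) : ℕ := e.2.1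

/-- The unit vector of a direction. -/
def stepVec (c : Dir d) : Site d := Pi.single c.1 (if c.2 then 1 else -1)

/-- The displacement of a path. -/
def disp : List (Dir d) → Site d
  | [] => 0
  | c :: l => stepVec c + disp l

/-- The value of the path with steps `l` that starts at the site `x` at time `k`. -/
def pathSum (w : Bond d → ℝ) : Site d → ℕ → List (Dir d) → ℝ
  | _, _, [] => 0
  | x, k, c :: l => w (x, k, c) + pathSum w (x + stepVec c) (k + 1) l

theorem disp_append (l l' : List (Dir d)) : disp (l ++ l') = disp l + disp l' := by
  induction l with
  | nil => simp [disp]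
  | cons c l ih => simp [disp, ih, add_assoc]

theorem pathSum_append (w : Bond d → ℝ) (l l' : List (Dir d)) (x : Site d) (k : ℕ) :
    pathSum w x k (l ++ l') = pathSum w x k l + pathSum w (x + disp l) (k + l.length) l' := by
  induction l generalizing x k with
  | nil => simp [disp, pathSum]
  | cons c l ih =>
    simp only [List.cons_append, pathSum, ih, disp, List.length_cons]
    rw [add_assoc x, add_assoc k, add_comm 1, add_assoc (w _)]

theorem measurable_pathSum (l : List (Dir d)) (x : Site d) (k : ℕ) :
    Measurable (fun w : Bond d → ℝ => pathSum w x k l) := by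
  induction l generalizing x k with
  | nil => simp only [pathSum]; fun_prop
  | cons c l ih =>
    simp only [pathSum]
    exact (measurable_pi_apply _).add (ih _ _)

theorem abs_stepVec_le (c : Dir d) (i : Fin d) : |stepVec c i| ≤ 1 := by
  unfold stepVec
  by_cases h : i = c.1
  · subst h; simp only [Pi.single_eq_same]; split_ifs <;> simp
  · simp [Pi.single_eq_of_ne h]

theorem abs_disp_le (l : List (Dir d)) (i : Fin d) : |disp l i| ≤ l.length := by
  induction l with
  | nil => simp [disp]
  | cons c l ih =>
    simp only [disp, Pi.add_apply, List.length_cons]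
    push_cast
    have := abs_add_le (stepVec c i) (disp l i)
    linarith [abs_stepVec_le c i]

/-- The sites within sup-distance `r` of `x`. -/
noncomputable def siteBox (x : Site d) (r : ℕ) : Finset (Site d) :=
  Finset.Icc (fun i => x i - r) (fun i => x i + r)

theorem mem_siteBox {x y : Site d} {r : ℕ} : y ∈ siteBox x r ↔ ∀ i, |y i - x i| ≤ r := by
  simp only [siteBox, Finset.mem_Icc, Pi.le_def, abs_le]
  constructor
  · rintro ⟨h1, h2⟩ i
    constructor <;> linarith [h1 i, h2 i]
  · intro h
    exact ⟨fun i => by linarith [(h i).1], fun i => by linarith [(h i).2]⟩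

theorem card_siteBox (x : Site d) (r : ℕ) : (siteBox x r).card = (2 * r + 1) ^ d := by
  rw [siteBox, Pi.card_Icc]
  have : ∀ i : Fin d, (Finset.Icc (x i - r) (x i + r)).card = 2 * r + 1 := by
    intro i
    rw [Int.card_Icc]
    omega
  simp [this]

/-- The edges that a path of length `n` started at the site `x` at time `k` can use. -/
noncomputable def bondBox (x : Site d) (k n : ℕ) : Finset (Bond d) :=
  siteBox x n ×ˢ (Finset.Ico k (k + n) ×ˢ Finset.univ)

theorem mem_bondBox {x : Site d} {k n : ℕ} {e : Bond d} :
    e ∈ bondBox x k n ↔ (∀ i, |e.1 i - x i| ≤ n) ∧ k ≤ lvl e ∧ lvl e < k + n := by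
  simp [bondBox, mem_siteBox, lvl]

theorem card_bondBox (x : Site d) (k n : ℕ) :
    (bondBox x k n).card = (2 * n + 1) ^ d * (n * (d * 2)) := by
  simp [bondBox, card_siteBox]

theorem card_bondBox_le (x : Site d) (k n : ℕ) :
    ((bondBox x k n).card : ℝ) ≤ (3 ^ d * (d * 2)) * (n : ℝ) ^ (d + 1) := by
  rw [card_bondBox]
  rcases Nat.eq_zero_or_pos n with rfl | hn
  · simp
  have hn' : (1 : ℝ) ≤ n := by exact_mod_cast hn
  push_cast
  calc ((2 * n + 1 : ℝ)) ^ d * (n * (d * 2)) ≤ (3 * n : ℝ) ^ d * (n * (d * 2)) := by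
        gcongr; linarith
    _ = _ := by rw [mul_pow]; ring

theorem pathSum_abs_sub_le (β : ℕ → ℝ) (w w' : Bond d → ℝ) (l : List (Dir d)) :
    ∀ (x : Site d) (k : ℕ),
      (∀ e ∈ bondBox x k l.length, |w e - w' e| ≤ β (lvl e)) →
      |pathSum w x k l - pathSum w' x k l| ≤ ∑ j ∈ Finset.Ico k (k + l.length), β j := by
  induction l with
  | nil => simp [pathSum]
  | cons c l ih =>
    intro x k h
    simp only [pathSum, List.length_cons] at h ⊢
    have h1 := h (x, k, c) (by
      rw [mem_bondBox]; simp only [sub_self, abs_zero, lvl]; exact ⟨fun _ => by positivity, by omega⟩)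
    have h2 := ih (x + stepVec c) (k + 1) (fun e he => h e ?_)
    · rw [Finset.sum_eq_sum_Ico_succ_bot (by omega)]
      have h3 : k + 1 + l.length = k + (l.length + 1) := by ring
      rw [h3] at h2
      have h4 := abs_add_le (w (x, k, c) - w' (x, k, c))
        (pathSum w (x + stepVec c) (k + 1) l - pathSum w' (x + stepVec c) (k + 1) l)
      have h5 : lvl (x, k, c) = k := rfl
      rw [h5] at h1
      rw [add_sub_add_comm]
      linarith
    · rw [mem_bondBox] at he ⊢
      refine ⟨fun i => ?_, by omega, by omega⟩
      have h1 := he.1 i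
      have h2 := abs_stepVec_le c i
      simp only [Pi.add_apply] at h1
      rw [abs_le] at h1 h2 ⊢
      push_cast
      constructor <;> linarith

/-- The largest value of a path from `x` at time `k` whose list of steps belongs to `A`.
It takes the junk value `0` for empty `A`. -/
noncomputable def pathMax (A : Finset (List (Dir d))) (w : Bond d → ℝ) (x : Site d) (k : ℕ) : ℝ :=
  ⨆ l : A, pathSum w x k l.1

theorem pathSum_le_pathMax {A : Finset (List (Dir d))} {l : List (Dir d)} (hl : l ∈ A)
    (w : Bond d → ℝ) (x : Site d) (k : ℕ) : pathSum w x k l ≤ pathMax A w x k :=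
  le_ciSup (f := fun l : A => pathSum w x k l.1) (Set.finite_range _).bddAbove ⟨l, hl⟩

theorem exists_pathMax_eq {A : Finset (List (Dir d))} (hA : A.Nonempty)
    (w : Bond d → ℝ) (x : Site d) (k : ℕ) : ∃ l ∈ A, pathMax A w x k = pathSum w x k l := by
  have : Nonempty A := hA.to_subtype
  obtain ⟨l, hl⟩ := exists_eq_ciSup_of_finite (f := fun l : A => pathSum w x k l.1)
  exact ⟨l.1, l.2, hl.symm⟩

theorem pathMax_le {A : Finset (List (Dir d))} (hA : A.Nonempty) {w : Bond d → ℝ} {x : Site d}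
    {k : ℕ} {b : ℝ} (h : ∀ l ∈ A, pathSum w x k l ≤ b) : pathMax A w x k ≤ b := by
  obtain ⟨l, hl, h2⟩ := exists_pathMax_eq hA w x k
  exact h2 ▸ h l hl

theorem measurable_pathMax (A : Finset (List (Dir d))) (x : Site d) (k : ℕ) :
    Measurable (fun w : Bond d → ℝ => pathMax A w x k) :=
  Measurable.iSup fun l => measurable_pathSum l.1 x k

theorem levelLip_pathMax {A : Finset (List (Dir d))} (hA : A.Nonempty) {n : ℕ}
    (hAn : ∀ l ∈ A, l.length = n) (x : Site d) (k : ℕ) :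
    LevelLip lvl (bondBox x k n) (Finset.Ico k (k + n)) (fun w => pathMax A w x k) := by
  intro β _ w w' h
  have key : ∀ l ∈ A, |pathSum w x k l - pathSum w' x k l| ≤ ∑ j ∈ Finset.Ico k (k + n), β j := by
    intro l hl
    have := pathSum_abs_sub_le β w w' l x k
    rw [hAn l hl] at this
    exact this h
  rw [abs_sub_le_iff]
  constructor
  · rw [sub_le_iff_le_add]
    refine pathMax_le hA fun l hl => ?_
    linarith [(abs_le.1 (key l hl)).2, pathSum_le_pathMax hl w' x k]
  · rw [sub_le_iff_le_add]
    refine pathMax_le hA fun l hl => ?_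
    linarith [(abs_le.1 (key l hl)).1, pathSum_le_pathMax hl w x k]

/-- All lists of `n` steps. -/
noncomputable def paths (d n : ℕ) : Finset (List (Dir d)) :=
  (List.finite_length_eq (Dir d) n).toFinset

@[simp] theorem mem_paths {n : ℕ} {l : List (Dir d)} : l ∈ paths d n ↔ l.length = n := by
  simp [paths]

theorem paths_nonempty (hd : 1 ≤ d) (n : ℕ) : (paths d n).Nonempty :=
  ⟨List.replicate n (⟨0, hd⟩, true), by simp⟩

/-- The lists of `n` steps with displacement `y`. -/
noncomputable def pathsTo (n : ℕ) (y : Site d) : Finset (List (Dir d)) := by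
  classical exact (paths d n).filter (fun l => disp l = y)

@[simp] theorem mem_pathsTo {n : ℕ} {y : Site d} {l : List (Dir d)} :
    l ∈ pathsTo n y ↔ l.length = n ∧ disp l = y := by
  simp [pathsTo]

theorem card_paths (d n : ℕ) : (paths d n).card = (d * 2) ^ n := by
  have h : (paths d n).card = Fintype.card (List.Vector (Dir d) n) := by
    rw [← Fintype.card_coe]
    exact Fintype.card_congr (Equiv.subtypeEquivRight fun l => by simp)
  rw [h, card_vector]
  simp

theorem pathSum_add_pathMax_le (hd : 1 ≤ d) {n m : ℕ} {l : List (Dir d)} (hl : l.length = n)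
    (w : Bond d → ℝ) (x : Site d) (k : ℕ) :
    pathSum w x k l + pathMax (paths d m) w (x + disp l) (k + n) ≤
      pathMax (paths d (n + m)) w x k := by
  obtain ⟨l', hl', h⟩ := exists_pathMax_eq (paths_nonempty hd m) w (x + disp l) (k + n)
  rw [h, ← hl, ← pathSum_append]
  exact pathSum_le_pathMax (by simp_all) w x k

/-! ### Invariance of the law -/

theorem pathSum_shift (w : Bond d → ℝ) (a : Site d) (s : ℕ) (l : List (Dir d)) (x : Site d)
    (k : ℕ) : pathSum (fun e => w (e.1 + a, e.2.1 + s, e.2.2)) x k l =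
      pathSum w (x + a) (k + s) l := by
  induction l generalizing x k with
  | nil => simp [pathSum]
  | cons c l ih =>
    simp only [pathSum, ih]
    rw [add_right_comm x, add_right_comm k]

/-- The opposite direction. -/
def flipDir (c : Dir d) : Dir d := (c.1, !c.2)

theorem stepVec_flipDir (c : Dir d) : stepVec (flipDir c) = -stepVec c := by
  obtain ⟨i, b⟩ := c
  cases b <;> simp [stepVec, flipDir, ← Pi.single_neg]

theorem flipDir_flipDir (c : Dir d) : flipDir (flipDir c) = c := by simp [flipDir]

theorem disp_map_flipDir (l : List (Dir d)) : disp (l.map flipDir) = -disp l := by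
  induction l with
  | nil => simp [disp]
  | cons c l ih => simp [disp, ih, stepVec_flipDir, add_comm]

/-- Reflecting the field in the spatial coordinates reflects the paths. -/
theorem pathSum_reflect (w : Bond d → ℝ) (l : List (Dir d)) (x : Site d) (k : ℕ) :
    pathSum (fun e => w (-e.1, e.2.1, flipDir e.2.2)) x k l =
      pathSum w (-x) k (l.map flipDir) := by
  induction l generalizing x k with
  | nil => simp [pathSum]
  | cons c l ih =>
    simp only [pathSum, ih, List.map_cons, stepVec_flipDir, neg_add]

variable {ν : Measure ℝ} [IsProbabilityMeasure ν]

theorem identDistrib_pathMax (A : Finset (List (Dir d))) (x : Site d) (k : ℕ) :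
    IdentDistrib (fun w : Bond d → ℝ => pathMax A w x k) (fun w => pathMax A w 0 0)
      (iidLaw (Bond d) ν) (iidLaw (Bond d) ν) := by
  set τ : Bond d → Bond d := fun e => (e.1 + x, e.2.1 + k, e.2.2) with hτ
  have hinj : Function.Injective τ := by
    rintro ⟨x, k, c⟩ ⟨x', k', c'⟩ h
    simpa [hτ] using h
  have hmp := measurePreserving_relabel (ν := ν) hinj
  refine ⟨(measurable_pathMax A x k).aemeasurable, (measurable_pathMax A 0 0).aemeasurable, ?_⟩
  conv_rhs => rw [← hmp.map_eq]
  rw [Measure.map_map (measurable_pathMax A 0 0) hmp.measurable]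
  congr 1
  funext w
  simp only [Function.comp_apply, pathMax, hτ, pathSum_shift, zero_add]

/-- By reflection, the passage value to `-y` has the same law as the passage value to `y`. -/
theorem identDistrib_pathMax_neg (n : ℕ) (y : Site d) :
    IdentDistrib (fun w : Bond d → ℝ => pathMax (pathsTo n (-y)) w 0 0)
      (fun w => pathMax (pathsTo n y) w 0 0)
      (iidLaw (Bond d) ν) (iidLaw (Bond d) ν) := by
  set τ : Bond d → Bond d := fun e => (-e.1, e.2.1, flipDir e.2.2) with hτ
  have hinj : Function.Injective τ := by
    have : Function.Involutive τ := by
      rintro ⟨x, k, c⟩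
      simp [hτ, flipDir_flipDir]
    exact this.injective
  have hmp := measurePreserving_relabel (ν := ν) hinj
  refine ⟨(measurable_pathMax _ 0 0).aemeasurable, (measurable_pathMax _ 0 0).aemeasurable, ?_⟩
  conv_rhs => rw [← hmp.map_eq]
  rw [Measure.map_map (measurable_pathMax _ 0 0) hmp.measurable]
  congr 1
  funext w
  simp only [Function.comp_apply, pathMax, hτ, pathSum_reflect, neg_zero]
  have hmem : ∀ z : Site d, ∀ l ∈ pathsTo n z, l.map flipDir ∈ pathsTo n (-z) := by
    intro z l hl
    rw [mem_pathsTo] at hl ⊢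
    simp [hl.1, disp_map_flipDir, hl.2]
  have hinv : ∀ l : List (Dir d), (l.map flipDir).map flipDir = l := by
    intro l
    rw [List.map_map]
    convert List.map_id l using 2
    funext c
    exact flipDir_flipDir c
  let E : (pathsTo n y) ≃ (pathsTo n (-y)) :=
    { toFun := fun l => ⟨l.1.map flipDir, hmem y l.1 l.2⟩
      invFun := fun l => ⟨l.1.map flipDir, by simpa using hmem (-y) l.1 l.2⟩
      left_inv := fun l => Subtype.ext (hinv l.1)
      right_inv := fun l => Subtype.ext (hinv l.1) }
  exact (E.iSup_comp (g := fun l : pathsTo n (-y) => pathSum w 0 0 l.1)).symm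

end LPP

namespace LPP

variable {d : ℕ} {ν : Measure ℝ} [IsProbabilityMeasure ν]

/-! ### The time constant and the law of large numbers -/

theorem integrable_pathMax {c : ℝ} (hc : 0 < c)
    (hν : Integrable (fun x => Real.exp (c * |x|)) ν) {A : Finset (List (Dir d))}
    (hA : A.Nonempty) {n : ℕ} (hAn : ∀ l ∈ A, l.length = n) (x : Site d) (k : ℕ) :
    Integrable (fun w : Bond d → ℝ => pathMax A w x k) (iidLaw (Bond d) ν) :=
  (levelLip_pathMax hA hAn x k).integrable (measurable_pathMax A x k) (integrable_id_of_exp hc hν)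

/-- Concentration of `pathMax`, uniformly in the starting point and in the set of paths. -/
theorem pathMax_concentration {c : ℝ} (hc : 0 < c)
    (hν : Integrable (fun x => Real.exp (c * |x|)) ν) {ε : ℝ} (hε : 0 < ε) :
    ∃ u : ℕ → ℝ, (∀ q : ℕ, Tendsto (fun n : ℕ => (n : ℝ) ^ q * u n) atTop (𝓝 0)) ∧
      ∀ᶠ n : ℕ in atTop, ∀ A : Finset (List (Dir d)), A.Nonempty → (∀ l ∈ A, l.length = n) →
        ∀ (x : Site d) (k : ℕ), (iidLaw (Bond d) ν).real {w | ε * n ≤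
          |pathMax A w x k - ∫ w, pathMax A w 0 0 ∂(iidLaw (Bond d) ν)|} ≤ u n := by
  obtain ⟨u, hu, h⟩ := concentration hc hν (lvl (d := d)) (3 ^ d * (d * 2)) (d + 1) hε
  refine ⟨u, hu, h.mono fun n hn A hA hAn x k => ?_⟩
  have := hn (bondBox x k n) (Finset.Ico k (k + n)) (fun w => pathMax A w x k) (by simp)
    (card_bondBox_le x k n) (measurable_pathMax A x k) (levelLip_pathMax hA hAn x k)
  rwa [(identDistrib_pathMax (ν := ν) A x k).integral_eq] at this

variable (d ν) in
/-- The expected passage value to time `n`. -/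
noncomputable def meanMax (n : ℕ) : ℝ := ∫ w, pathMax (paths d n) w 0 0 ∂(iidLaw (Bond d) ν)

theorem pathSum_dependsOn (l : List (Dir d)) (x : Site d) (k : ℕ) :
    DependsOn (fun w : Bond d → ℝ => pathSum w x k l)
      {e | k ≤ lvl e ∧ lvl e < k + l.length} := by
  induction l generalizing x k with
  | nil => intro w w' _; rfl
  | cons c l ih =>
    intro w w' h
    simp only [pathSum]
    rw [h (x, k, c) (by simp [lvl])]
    congr 1
    refine ih _ _ fun e he => h e ?_
    simp only [Set.mem_ofPred_eq, List.length_cons] at he ⊢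
    omega

/-- Conditionally on the field before time `n`, an optimal path to time `n` can be continued by an
optimal path from its endpoint. -/
theorem meanMax_superadditive (hd : 1 ≤ d) {c : ℝ} (hc : 0 < c)
    (hν : Integrable (fun x => Real.exp (c * |x|)) ν) (n m : ℕ) :
    meanMax d ν n + meanMax d ν m ≤ meanMax d ν (n + m) := by
  have hint : ∀ (n : ℕ) (x : Site d) (k : ℕ),
      Integrable (fun w : Bond d → ℝ => pathMax (paths d n) w x k) (iidLaw (Bond d) ν) :=
    fun n x k => integrable_pathMax hc hν (paths_nonempty hd n) (n := n) (by simp) x k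
  set S : Set (Bond d) := {e | n ≤ lvl e} with hS
  rw [meanMax, meanMax, meanMax, integral_splice S (hint (n + m) 0 0)]
  have hp := integrable_splice S (hint (n + m) 0 0)
  have hstep : ∀ᵐ w ∂(iidLaw (Bond d) ν), pathMax (paths d n) w 0 0 + meanMax d ν m ≤
      ∫ w', pathMax (paths d (n + m)) (splice S w w') 0 0 ∂(iidLaw (Bond d) ν) := by
    filter_upwards [hp.prod_right_ae] with w hw
    obtain ⟨l, hl, h⟩ := exists_pathMax_eq (paths_nonempty hd n) w 0 0
    rw [mem_paths] at hl
    rw [h]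
    have h1 : pathSum w 0 0 l + meanMax d ν m =
        ∫ w', (pathSum w 0 0 l + pathMax (paths d m) w' (0 + disp l) (0 + n))
          ∂(iidLaw (Bond d) ν) := by
      rw [integral_add (integrable_const _) (hint m _ _),
        (identDistrib_pathMax (ν := ν) (paths d m) (0 + disp l) (0 + n)).integral_eq]
      simp [meanMax]
    rw [h1]
    refine integral_mono ((integrable_const _).add (hint m _ _)) hw fun w' => ?_
    refine le_trans (le_of_eq ?_) (pathSum_add_pathMax_le hd hl (splice S w w') 0 0)
    simp only []
    congr 1
    · refine pathSum_dependsOn l 0 0 fun e he => (splice_of_notMem ?_ w w').symm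
      simp only [hS, Set.mem_ofPred_eq, zero_le, zero_add, true_and, hl, not_le] at he ⊢
      exact he
    · refine (levelLip_pathMax (paths_nonempty hd m) (n := m) (by simp) _ _).dependsOn
        fun e he => (splice_of_mem ?_ w w').symm
      have := he.2
      simp only [Finset.mem_Ico, zero_add] at this
      exact this.1
  have h3 := integral_mono_ae ((hint n 0 0).add (integrable_const (meanMax d ν m)))
    hp.integral_prod_left hstep
  refine le_trans (le_of_eq ?_) h3
  have h4 := integral_add (hint n 0 0) (integrable_const (μ := iidLaw (Bond d) ν) (meanMax d ν m))
  simp only [Pi.add_apply]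
  rw [h4]
  simp [meanMax]

theorem lintegral_exp_pathSum {c : ℝ} (l : List (Dir d)) (x : Site d) (k : ℕ) :
    ∫⁻ w, ENNReal.ofReal (Real.exp (c * pathSum w x k l)) ∂(iidLaw (Bond d) ν) =
      (∫⁻ x, ENNReal.ofReal (Real.exp (c * x)) ∂ν) ^ l.length := by
  induction l generalizing x k with
  | nil => simp [pathSum]
  | cons a l ih =>
    simp only [pathSum, mul_add, Real.exp_add, List.length_cons, pow_succ']
    simp_rw [ENNReal.ofReal_mul (Real.exp_pos _).le]
    rw [lintegral_mul_of_dependsOn (S := {e | lvl e = k}) (T := {e | k + 1 ≤ lvl e}), ih]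
    · congr 1
      exact (measurePreserving_apply (ν := ν) ((x, k, a) : Bond d)).lintegral_comp
        (f := fun y => ENNReal.ofReal (Real.exp (c * y))) (by fun_prop)
    · rw [Set.disjoint_left]
      intro e h1 h2
      simp only [Set.mem_ofPred_eq] at h1 h2
      omega
    · fun_prop
    · have := measurable_pathSum (d := d) l (x + stepVec a) (k + 1)
      fun_prop
    · intro w w' h
      simp only []
      rw [h (x, k, a) rfl]
    · intro w w' h
      have := pathSum_dependsOn l (x + stepVec a) (k + 1) fun e he => h e he.1
      simp only [] at this ⊢
      rw [this]

/-- The mean grows at most linearly: by the union bound, the maximum over `(2 d) ^ n` paths has an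
exponential moment of exponential order. -/
theorem meanMax_le (hd : 1 ≤ d) {c : ℝ} (hc : 0 < c)
    (hν : Integrable (fun x => Real.exp (c * |x|)) ν) :
    ∃ B : ℝ, ∀ n : ℕ, c * meanMax d ν n ≤ B * n + 1 := by
  have hexp : Integrable (fun x => Real.exp (c * x)) ν := by
    refine hν.mono' (by fun_prop) (ae_of_all _ fun x => ?_)
    rw [Real.norm_eq_abs, Real.abs_exp]
    exact Real.exp_le_exp.2 (mul_le_mul_of_nonneg_left (le_abs_self x) hc.le)
  set M := ∫ x, Real.exp (c * x) ∂ν with hM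
  have hMpos : 0 < M := integral_exp_pos hexp
  have hd' : (0 : ℝ) < d := by exact_mod_cast hd
  refine ⟨Real.log (d * 2 * M), fun n => ?_⟩
  have hMl : ∫⁻ x, ENNReal.ofReal (Real.exp (c * x)) ∂ν = ENNReal.ofReal M :=
    (ofReal_integral_eq_lintegral_ofReal hexp (ae_of_all _ fun x => (Real.exp_pos _).le)).symm
  have hlin : ∀ l ∈ paths d n, Integrable (fun w => Real.exp (c * pathSum w 0 0 l))
      (iidLaw (Bond d) ν) ∧ ∫ w, Real.exp (c * pathSum w 0 0 l) ∂(iidLaw (Bond d) ν) = M ^ n := by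
    intro l hl
    rw [mem_paths] at hl
    have h1 := lintegral_exp_pathSum (ν := ν) (c := c) l 0 0
    rw [hMl, hl, ← ENNReal.ofReal_pow hMpos.le] at h1
    have hm : Measurable (fun w : Bond d → ℝ => Real.exp (c * pathSum w 0 0 l)) := by
      have := measurable_pathSum (d := d) l 0 0
      fun_prop
    constructor
    · refine ⟨hm.aestronglyMeasurable, ?_⟩
      rw [hasFiniteIntegral_iff_ofReal (ae_of_all _ fun x => (Real.exp_pos _).le), h1]
      exact ENNReal.ofReal_lt_top
    · rw [integral_eq_lintegral_of_nonneg_ae (ae_of_all _ fun x => (Real.exp_pos _).le)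
        hm.aestronglyMeasurable, h1, ENNReal.toReal_ofReal (by positivity)]
  set L := d * 2 * M with hL
  have hLpos : 0 < L := by positivity
  have hpt : ∀ w : Bond d → ℝ, c * pathMax (paths d n) w 0 0 - Real.log L * n ≤
      ∑ l ∈ paths d n, Real.exp (c * pathSum w 0 0 l) / L ^ n := by
    intro w
    obtain ⟨l, hl, h⟩ := exists_pathMax_eq (paths_nonempty hd n) w 0 0
    rw [h]
    refine le_trans ?_ (Finset.single_le_sum
      (f := fun l => Real.exp (c * pathSum w 0 0 l) / L ^ n) (fun _ _ => by positivity) hl)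
    have h2 : Real.exp (c * pathSum w 0 0 l) / L ^ n =
        Real.exp (c * pathSum w 0 0 l - Real.log L * n) := by
      rw [Real.exp_sub, mul_comm (Real.log L), Real.exp_nat_mul, Real.exp_log hLpos]
    simp only [h2]
    linarith [Real.add_one_le_exp (c * pathSum w 0 0 l - Real.log L * n)]
  have hint := integrable_pathMax hc hν (paths_nonempty hd n) (n := n) (by simp) 0 0
  have h3 := integral_mono ((hint.const_mul c).sub (integrable_const (Real.log L * n)))
    (integrable_finsetSum _ fun l hl => (hlin l hl).1.div_const (L ^ n)) hpt
  rw [integral_finsetSum _ fun l hl => (hlin l hl).1.div_const (L ^ n)] at h3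
  have h4 : ∑ l ∈ paths d n, ∫ w, Real.exp (c * pathSum w 0 0 l) / L ^ n ∂(iidLaw (Bond d) ν) =
      1 := by
    rw [Finset.sum_congr rfl fun l hl => by rw [integral_div, (hlin l hl).2], Finset.sum_const,
      card_paths, nsmul_eq_mul, hL]
    push_cast
    rw [mul_pow (d * 2 : ℝ) M]
    field_simp
  rw [h4] at h3
  have h5 : ∫ w, ((fun w : Bond d → ℝ => c * pathMax (paths d n) w 0 0) - fun _ => Real.log L * n : (Bond d → ℝ) → ℝ) w
      ∂(iidLaw (Bond d) ν) = c * meanMax d ν n - Real.log L * n := by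
    simp only [Pi.sub_apply]
    rw [integral_sub (hint.const_mul c) (integrable_const _), integral_const_mul]
    simp [meanMax]
  rw [h5] at h3
  linarith

theorem exists_timeConstant (hd : 1 ≤ d) {c : ℝ} (hc : 0 < c)
    (hν : Integrable (fun x => Real.exp (c * |x|)) ν) :
    ∃ μ : ℝ, Tendsto (fun n : ℕ => meanMax d ν n / n) atTop (𝓝 μ) := by
  have hsub : Subadditive (fun n => -meanMax d ν n) := fun m n => by
    linarith [meanMax_superadditive hd hc hν m n]
  obtain ⟨B, hB⟩ := meanMax_le (ν := ν) hd hc hν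
  have h := hsub.tendsto_lim ⟨-(|B| + 1) / c, ?_⟩
  · refine ⟨-hsub.lim, ?_⟩
    refine h.neg.congr fun n => ?_
    ring
  · rintro _ ⟨n, rfl⟩
    simp only []
    rcases Nat.eq_zero_or_pos n with rfl | hn
    · simp only [Nat.cast_zero, div_zero]
      exact div_nonpos_of_nonpos_of_nonneg (by linarith [abs_nonneg B]) hc.le
    have hn1 : (1 : ℝ) ≤ n := by exact_mod_cast hn
    rw [div_le_div_iff₀ hc (by linarith)]
    have := hB n
    nlinarith [le_abs_self B]

/-- The law of large numbers, from concentration and the Borel-Cantelli lemma. -/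
theorem ae_tendsto_pathMax_div (hd : 1 ≤ d) {c : ℝ} (hc : 0 < c)
    (hν : Integrable (fun x => Real.exp (c * |x|)) ν) {μ : ℝ}
    (hμ : Tendsto (fun n : ℕ => meanMax d ν n / n) atTop (𝓝 μ)) :
    ∀ᵐ w ∂(iidLaw (Bond d) ν),
      Tendsto (fun n : ℕ => pathMax (paths d n) w 0 0 / n) atTop (𝓝 μ) := by
  have key : ∀ j : ℕ, ∀ᵐ w ∂(iidLaw (Bond d) ν), ∀ᶠ n : ℕ in atTop,
      |pathMax (paths d n) w 0 0 - meanMax d ν n| < 1 / ((j : ℝ) + 1) * n := by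
    intro j
    have hj : (0 : ℝ) < 1 / ((j : ℝ) + 1) := by positivity
    obtain ⟨u, hu, h⟩ := pathMax_concentration (d := d) hc hν hj
    have h2 : ∀ᶠ n : ℕ in atTop, (iidLaw (Bond d) ν).real {w | 1 / ((j : ℝ) + 1) * n ≤
          |pathMax (paths d n) w 0 0 - meanMax d ν n|} ≤ 1 / (n : ℝ) ^ 2 := by
      filter_upwards [h, (hu 2).eventually_lt_const zero_lt_one, eventually_ge_atTop 1]
        with n hn hn2 hn1
      refine (hn _ (paths_nonempty hd n) (by simp) 0 0).trans ?_
      have hn1' : (1 : ℝ) ≤ n := by exact_mod_cast hn1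
      rw [le_div_iff₀ (by positivity), mul_comm]
      exact hn2.le
    have hsum : Summable (fun n : ℕ => (iidLaw (Bond d) ν).real {w | 1 / ((j : ℝ) + 1) * n ≤
          |pathMax (paths d n) w 0 0 - meanMax d ν n|}) := by
      refine Summable.of_norm_bounded_eventually_nat
        (Real.summable_one_div_nat_pow.2 (by norm_num : 1 < 2)) ?_
      filter_upwards [h2] with n hn
      rwa [Real.norm_eq_abs, abs_of_nonneg measureReal_nonneg]
    have hbc := ae_eventually_notMem (μ := iidLaw (Bond d) ν)
      (s := fun n : ℕ => {w | 1 / ((j : ℝ) + 1) * n ≤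
          |pathMax (paths d n) w 0 0 - meanMax d ν n|})
      (by
        have h3 := hsum.tsum_ofReal_ne_top
        have h4 : ∀ s, ENNReal.ofReal ((iidLaw (Bond d) ν).real s) = iidLaw (Bond d) ν s :=
          fun s => ofReal_measureReal (measure_ne_top _ _)
        simpa only [h4] using h3)
    filter_upwards [hbc] with w hw
    filter_upwards [hw] with n hn
    simpa only [Set.mem_ofPred_eq, not_le] using hn
  filter_upwards [ae_all_iff.2 key] with w hw
  have h0 : Tendsto (fun n : ℕ => (pathMax (paths d n) w 0 0 - meanMax d ν n) / n) atTop (𝓝 0) := by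
    rw [Metric.tendsto_nhds]
    intro ε hε
    obtain ⟨j, hj⟩ := exists_nat_one_div_lt hε
    filter_upwards [hw j, eventually_ge_atTop 1] with n hn hn1
    have hn1' : (0 : ℝ) < n := by exact_mod_cast hn1
    rw [dist_zero_right, Real.norm_eq_abs, abs_div, abs_of_pos hn1', div_lt_iff₀ hn1']
    exact hn.trans (mul_lt_mul_of_pos_right hj hn1')
  have := h0.add hμ
  rw [zero_add] at this
  refine this.congr fun n => ?_
  ring

end LPP

namespace LPP

variable {d : ℕ} {ν : Measure ℝ} [IsProbabilityMeasure ν]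

/-! ### Point-to-point passage and tubes -/

/-- Some endpoint carries almost the whole time constant, because the number of endpoints is
polynomial in the length while deviations have superpolynomially small probability. -/
theorem exists_endpoint (hd : 1 ≤ d) {c : ℝ} (hc : 0 < c)
    (hν : Integrable (fun x => Real.exp (c * |x|)) ν) {μ : ℝ}
    (hμ : Tendsto (fun n : ℕ => meanMax d ν n / n) atTop (𝓝 μ)) {η : ℝ} (hη : 0 < η) :
    ∃ N : ℕ, 1 ≤ N ∧ ∃ y : Site d, (pathsTo N y).Nonempty ∧
      (μ - η) * N ≤ ∫ w, pathMax (pathsTo N y) w 0 0 ∂(iidLaw (Bond d) ν) := by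
  obtain ⟨u, hu, h⟩ := pathMax_concentration (d := d) hc hν (ε := η / 4) (by positivity)
  have hlim : Tendsto (fun n : ℕ => (3 : ℝ) ^ d * ((n : ℝ) ^ d * u n) + (n : ℝ) ^ 0 * u n) atTop
      (𝓝 0) := by
    simpa using ((hu d).const_mul ((3 : ℝ) ^ d)).add (hu 0)
  obtain ⟨N, hN, hN0, hN1, hNμ⟩ := (h.and ((hlim.eventually_lt_const zero_lt_one).and
    ((eventually_ge_atTop 1).and (hμ.eventually_const_lt
      (show μ - η / 4 < μ by linarith))))).exists
  have hNr : (1 : ℝ) ≤ N := by exact_mod_cast hN1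
  refine ⟨N, hN1, ?_⟩
  by_contra hcon
  push Not at hcon
  rw [lt_div_iff₀ (by linarith)] at hNμ
  classical
  set bad : Option (Site d) → Set (Bond d → ℝ) := fun o => match o with
    | none => {w | η / 4 * N ≤ |pathMax (paths d N) w 0 0 - meanMax d ν N|}
    | some y => if (pathsTo N y).Nonempty then {w | η / 4 * N ≤ |pathMax (pathsTo N y) w 0 0 -
        ∫ w, pathMax (pathsTo N y) w 0 0 ∂(iidLaw (Bond d) ν)|} else ∅ with hbad
  have hu0 : 0 ≤ u N := measureReal_nonneg.trans
    (hN (paths d N) (paths_nonempty hd N) (by simp) 0 0)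
  have hbadle : ∀ o, (iidLaw (Bond d) ν).real (bad o) ≤ u N := by
    intro o
    cases o with
    | none => exact hN (paths d N) (paths_nonempty hd N) (by simp) 0 0
    | some y =>
      simp only [hbad]
      split_ifs with hy
      · exact hN _ hy (fun l hl => (mem_pathsTo.1 hl).1) 0 0
      · simpa using hu0
  have hunion : (iidLaw (Bond d) ν).real
      (⋃ o ∈ Finset.insertNone (siteBox (0 : Site d) N), bad o) < 1 := by
    refine (measureReal_biUnion_finset_le _ _).trans_lt ?_
    refine (Finset.sum_le_sum fun o _ => hbadle o).trans_lt ?_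
    rw [Finset.sum_const, Finset.card_insertNone, card_siteBox, nsmul_eq_mul]
    refine lt_of_le_of_lt ?_ hN0
    push_cast
    have h3 : (2 * N + 1 : ℝ) ^ d ≤ 3 ^ d * (N : ℝ) ^ d := by
      rw [← mul_pow]; gcongr; linarith
    rw [pow_zero, one_mul, add_mul, one_mul, ← mul_assoc]
    gcongr
  obtain ⟨w, hw⟩ : ∃ w, w ∉ ⋃ o ∈ Finset.insertNone (siteBox (0 : Site d) N), bad o := by
    by_contra hall
    push Not at hall
    rw [Set.eq_univ_of_forall hall] at hunion
    simp at hunion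
  simp only [Set.mem_iUnion, not_exists] at hw
  have hw0 := hw none (by simp)
  simp only [hbad, Set.mem_ofPred_eq, not_le, abs_lt] at hw0
  obtain ⟨l, hl, hlmax⟩ := exists_pathMax_eq (paths_nonempty hd N) w 0 0
  rw [mem_paths] at hl
  have hly : l ∈ pathsTo N (disp l) := by simp [hl]
  have hmem : disp l ∈ siteBox (0 : Site d) N := by
    rw [mem_siteBox]
    intro i
    simpa [hl] using abs_disp_le l i
  have hw1 := hw (some (disp l)) (by simpa using hmem)
  simp only [hbad] at hw1
  rw [if_pos ⟨l, hly⟩] at hw1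
  simp only [Set.mem_ofPred_eq, not_le, abs_lt] at hw1
  have h1 := pathSum_le_pathMax hly w 0 0
  have h2 := hcon (disp l) ⟨l, hly⟩
  nlinarith [hw0.1, hw1.2]

/-- Since `F` grows at most like `T.card` times the sum of the `|w e|`, its exponential moments are
controlled by those of the one-site law. -/
theorem LevelLip.integrable_exp {ι : Type*} {lvl : ι → ℕ} {R : Finset ι} {T : Finset ℕ}
    {F : (ι → ℝ) → ℝ} (h : LevelLip lvl R T F) (hF : Measurable F) {c t : ℝ}
    (hν : Integrable (fun x => Real.exp (c * |x|)) ν) (ht : |t| * T.card ≤ c) :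
    Integrable (fun w => Real.exp (t * F w)) (iidLaw ι ν) := by
  have hprod : Integrable (fun w : ι → ℝ => ∏ e ∈ R, Real.exp (c * |w e|)) (iidLaw ι ν) := by
    refine ⟨(Finset.measurable_prod _ fun e _ => by fun_prop).aestronglyMeasurable, ?_⟩
    rw [hasFiniteIntegral_iff_ofReal (ae_of_all _ fun w =>
      Finset.prod_nonneg fun e _ => (Real.exp_pos _).le)]
    simp_rw [ENNReal.ofReal_prod_of_nonneg fun e _ => (Real.exp_pos _).le]
    rw [lintegral_prod_of_dependsOn R (fun e => {e}) (fun a _ b _ hab => by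
      simpa [Function.onFun] using hab) (fun e w => ENNReal.ofReal (Real.exp (c * |w e|)))
      (fun e _ => by fun_prop) (fun e _ w w' hw => by simp only [hw e rfl])]
    refine ENNReal.prod_lt_top fun e _ => ?_
    rw [(measurePreserving_apply (ν := ν) e).lintegral_comp
      (f := fun y => ENNReal.ofReal (Real.exp (c * |y|))) (by fun_prop)]
    exact (hasFiniteIntegral_iff_ofReal (ae_of_all _ fun w => (Real.exp_pos _).le)).1 hν.2
  refine (hprod.const_mul (Real.exp (|t| * |F 0|))).mono'
    (by have := hF; fun_prop) (ae_of_all _ fun w => ?_)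
  rw [Real.norm_eq_abs, Real.abs_exp, ← Real.exp_sum, ← Real.exp_add]
  refine Real.exp_le_exp.2 ((le_abs_self _).trans ?_)
  have h1 := h.abs_sub_le_card_mul w 0
  simp only [Pi.zero_apply, sub_zero] at h1
  have h2 := abs_sub_abs_le_abs_sub (F w) (F 0)
  have h3 : 0 ≤ ∑ e ∈ R, |w e| := Finset.sum_nonneg fun _ _ => abs_nonneg _
  rw [abs_mul, ← Finset.mul_sum]
  calc |t| * |F w| ≤ |t| * (|F 0| + T.card * ∑ e ∈ R, |w e|) := by gcongr; linarith
    _ = |t| * |F 0| + (|t| * T.card) * ∑ e ∈ R, |w e| := by ring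
    _ ≤ _ := by gcongr

/-- A random variable with positive mean and finite exponential moments has some negative
exponential moment below `1`. -/
theorem exists_mgf_neg_lt_one {Ω : Type*} [MeasurableSpace Ω] {P : Measure Ω}
    [IsProbabilityMeasure P] {Y : Ω → ℝ} (h0 : 0 ∈ interior (integrableExpSet Y P))
    (hY : 0 < P[Y]) :
    ∃ t : ℝ, 0 < t ∧ Integrable (fun ω => Real.exp (-t * Y ω)) P ∧ mgf Y P (-t) < 1 := by
  have h1 : HasDerivAt (mgf Y P) (P[Y]) 0 := by
    have := hasDerivAt_mgf h0
    simpa using this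
  rw [hasDerivAt_iff_tendsto_slope] at h1
  have h2 : ∀ᶠ t in 𝓝[<] (0 : ℝ), 0 < slope (mgf Y P) 0 t :=
    (h1.mono_left (nhdsWithin_mono _ fun t (ht : t < 0) => ht.ne)).eventually_const_lt hY
  have h3 : ∀ᶠ t in 𝓝[<] (0 : ℝ), t ∈ integrableExpSet Y P :=
    nhdsWithin_le_nhds (mem_interior_iff_mem_nhds.1 h0)
  obtain ⟨t, ht, ht2, ht3⟩ := (h2.and (h3.and self_mem_nhdsWithin)).exists
  have ht3' : t < 0 := ht3
  refine ⟨-t, by linarith, by rw [neg_neg]; exact ht2, ?_⟩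
  rw [neg_neg]
  rw [slope_def_field, sub_zero, mgf_zero] at ht
  by_contra hcon
  push Not at hcon
  exact absurd ht (not_lt.2 (div_nonpos_of_nonneg_of_nonpos (by linarith) ht3'.le))

/-- The step lists of the `j`-th block of a tube with block displacements `y, -y, y, -y, …`. -/
noncomputable def blockPaths (N : ℕ) (y : Site d) (j : ℕ) : Finset (List (Dir d)) :=
  if Even j then pathsTo N y else pathsTo N (-y)

/-- The starting point of the `j`-th block of the tube based at `z`. -/
def blockStart (y z : Site d) (j : ℕ) : Site d := if Even j then z else z + y

theorem pathsTo_neg_nonempty {N : ℕ} {y : Site d} (hy : (pathsTo N y).Nonempty) :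
    (pathsTo N (-y)).Nonempty := by
  obtain ⟨l, hl⟩ := hy
  rw [mem_pathsTo] at hl
  exact ⟨l.map flipDir, by simp [hl.1, disp_map_flipDir, hl.2]⟩

theorem blockPaths_nonempty {N : ℕ} {y : Site d} (hy : (pathsTo N y).Nonempty) (j : ℕ) :
    (blockPaths N y j).Nonempty := by
  unfold blockPaths
  split_ifs
  · exact hy
  · exact pathsTo_neg_nonempty hy

theorem length_of_mem_blockPaths {N j : ℕ} {y : Site d} {l : List (Dir d)}
    (hl : l ∈ blockPaths N y j) : l.length = N := by
  unfold blockPaths at hl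
  split_ifs at hl <;> exact (mem_pathsTo.1 hl).1

theorem identDistrib_block (N : ℕ) (y z : Site d) (m j : ℕ) :
    IdentDistrib (fun w : Bond d → ℝ => pathMax (blockPaths N y j) w (blockStart y z j) (m + N * j))
      (fun w => pathMax (pathsTo N y) w 0 0) (iidLaw (Bond d) ν) (iidLaw (Bond d) ν) := by
  refine (identDistrib_pathMax _ _ _).trans ?_
  unfold blockPaths
  split_ifs
  · exact IdentDistrib.refl (measurable_pathMax _ 0 0).aemeasurable
  · exact identDistrib_pathMax_neg N y

/-- The blocks of a tube concatenate to a single path, because their displacements alternate. -/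
theorem sum_block_le {N : ℕ} {y : Site d} (hy : (pathsTo N y).Nonempty) (z : Site d)
    (m J : ℕ) (w : Bond d → ℝ) :
    ∑ j ∈ Finset.range J, pathMax (blockPaths N y j) w (blockStart y z j) (m + N * j) ≤
      pathMax (paths d (N * J)) w z m := by
  have key : ∃ l : List (Dir d), l.length = N * J ∧ z + disp l = blockStart y z J ∧
      pathSum w z m l =
        ∑ j ∈ Finset.range J, pathMax (blockPaths N y j) w (blockStart y z j) (m + N * j) := by
    induction J with
    | zero => exact ⟨[], by simp [disp, pathSum, blockStart]⟩
    | succ J ih =>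
      obtain ⟨l, h1, h2, h3⟩ := ih
      obtain ⟨l', hl', h4⟩ := exists_pathMax_eq (blockPaths_nonempty hy J) w (blockStart y z J)
        (m + N * J)
      refine ⟨l ++ l', ?_, ?_, ?_⟩
      · rw [List.length_append, h1, length_of_mem_blockPaths hl']
        ring
      · rw [disp_append, ← add_assoc, h2]
        unfold blockPaths at hl'
        unfold blockStart
        by_cases hJ : Even J
        · rw [if_pos hJ, mem_pathsTo] at hl'
          rw [if_pos hJ, if_neg (by rw [Nat.even_add_one]; simpa using hJ), hl'.2]
        · rw [if_neg hJ, mem_pathsTo] at hl'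
          rw [if_neg hJ, if_pos (by rw [Nat.even_add_one]; exact hJ), hl'.2]
          abel
      · rw [pathSum_append, h2, h1, h3, Finset.sum_range_succ, h4]
  obtain ⟨l, h1, -, h3⟩ := key
  rw [← h3]
  exact pathSum_le_pathMax (by simpa using h1) w z m

/-- A set containing the edges that the `j`-th block of the tube based at `z` uses. -/
def blockSupport (N : ℕ) (z : Site d) (m j : ℕ) : Set (Bond d) :=
  {e | (∀ i, |e.1 i - z i| ≤ 2 * N) ∧ m + N * j ≤ lvl e ∧ lvl e < m + N * (j + 1)}

theorem block_dependsOn {N : ℕ} {y : Site d} (hy : (pathsTo N y).Nonempty) (z : Site d)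
    (m j : ℕ) :
    DependsOn (fun w : Bond d → ℝ => pathMax (blockPaths N y j) w (blockStart y z j) (m + N * j))
      (blockSupport N z m j) := by
  refine DependsOn.mono ?_ (levelLip_pathMax (blockPaths_nonempty hy j) (n := N)
    (fun l hl => length_of_mem_blockPaths hl) (blockStart y z j) (m + N * j)).dependsOn
  intro e he
  have h1 := mem_bondBox.1 he.1
  refine ⟨fun i => ?_, h1.2.1, by rw [mul_add, mul_one, ← add_assoc]; exact h1.2.2⟩
  obtain ⟨l, hl⟩ := hy
  rw [mem_pathsTo] at hl
  have h2 := abs_disp_le l i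
  rw [hl.1, hl.2] at h2
  have h3 := h1.1 i
  unfold blockStart at h3
  rw [abs_le] at h2 h3 ⊢
  split_ifs at h3
  · constructor <;> linarith
  · simp only [Pi.add_apply] at h3
    constructor <;> linarith

/-- Tubes based at points that are congruent modulo `4 N + 1` do not overlap. -/
theorem blockSupport_disjoint {N : ℕ} {z z' : Site d} {m j j' : ℕ}
    (hz : ∀ i, z i ≡ z' i [ZMOD (4 * N + 1)]) (h : (z, j) ≠ (z', j')) :
    Disjoint (blockSupport N z m j) (blockSupport N z' m j') := by
  rw [Set.disjoint_left]
  rintro e ⟨h1, h2, h3⟩ ⟨h1', h2', h3'⟩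
  have hj : j = j' := by
    have h4 : N * j < N * (j' + 1) := by omega
    have h5 : N * j' < N * (j + 1) := by omega
    have := lt_of_mul_lt_mul_left h4 (Nat.zero_le _)
    have := lt_of_mul_lt_mul_left h5 (Nat.zero_le _)
    omega
  refine h (Prod.ext (funext fun i => ?_) hj)
  have h6 := abs_le.1 (h1 i)
  have h7 := abs_le.1 (h1' i)
  have h8 := (hz i).symm.dvd
  have h9 : z i - z' i = 0 := by
    refine Int.eq_zero_of_abs_lt_dvd h8 ?_
    rw [abs_lt]
    constructor <;> linarith
  simpa using sub_eq_zero.1 h9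

/-- Every set `S` of starting points at time `m` contains a proportion of points whose tubes are
disjoint, hence independent; each tube of `J` blocks fails to have speed `μ - η` with a
probability exponentially small in `J`. -/
theorem tubes_fail_le (hd : 1 ≤ d) {c : ℝ} (hc : 0 < c)
    (hν : Integrable (fun x => Real.exp (c * |x|)) ν) {μ : ℝ}
    (hμ : Tendsto (fun n : ℕ => meanMax d ν n / n) atTop (𝓝 μ)) {η : ℝ} (hη : 0 < η) :
    ∃ N : ℕ, 1 ≤ N ∧ ∃ K : ℕ, 1 ≤ K ∧ ∃ ρ : ℝ, 0 < ρ ∧ ρ < 1 ∧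
      ∀ (S : Finset (Site d)) (m J : ℕ), ∃ s : ℕ, S.card ≤ K * s ∧
        iidLaw (Bond d) ν {w | ∀ z ∈ S,
          pathMax (paths d (N * J)) w z m ≤ (μ - η) * (N * J)} ≤ ENNReal.ofReal ρ ^ (s * J) := by
  classical
  obtain ⟨N, hN1, y, hy, hmean⟩ := exists_endpoint hd hc hν hμ (η := η / 2) (by positivity)
  have hNr : (1 : ℝ) ≤ N := by exact_mod_cast hN1
  set H : (Bond d → ℝ) → ℝ := fun w => pathMax (pathsTo N y) w 0 0 with hH
  have hHm : Measurable H := measurable_pathMax _ 0 0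
  have hLip := levelLip_pathMax hy (n := N) (fun l hl => (mem_pathsTo.1 hl).1) 0 0
  set h := (μ - η) * N with hh
  have hHi : Integrable H (iidLaw (Bond d) ν) := integrable_pathMax hc hν hy
    (fun l hl => (mem_pathsTo.1 hl).1) 0 0
  have hint : ∀ t : ℝ, |t| * N ≤ c →
      Integrable (fun w => Real.exp (t * (H w - h))) (iidLaw (Bond d) ν) := by
    intro t ht
    have := (hLip.integrable_exp hHm hν (t := t) (by simpa using ht)).mul_const
      (Real.exp (-(t * h)))
    refine this.congr (ae_of_all _ fun w => ?_)
    simp only []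
    rw [← Real.exp_add]
    congr 1
    simp only [hH]
    ring
  have h0 : (0 : ℝ) ∈ interior (integrableExpSet (fun w => H w - h) (iidLaw (Bond d) ν)) := by
    rw [mem_interior]
    refine ⟨Set.Ioo (-(c / N)) (c / N), fun t ht => ?_, isOpen_Ioo, by
      constructor
      · simp; positivity
      · positivity⟩
    refine hint t ?_
    rw [← le_div_iff₀ (by linarith)]
    exact (abs_lt.2 ht).le
  obtain ⟨t, ht0, htint, htlt⟩ := exists_mgf_neg_lt_one h0 (by
    rw [integral_sub hHi (integrable_const _)]
    simp only [integral_const, probReal_univ, smul_eq_mul, one_mul]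
    have : (μ - η / 2) * N ≤ ∫ w, H w ∂(iidLaw (Bond d) ν) := hmean
    have : h < (μ - η / 2) * N := by rw [hh]; gcongr; linarith
    linarith)
  set ρ := mgf (fun w => H w - h) (iidLaw (Bond d) ν) (-t) with hρ
  have hρ0 : 0 < ρ := mgf_pos htint
  refine ⟨N, hN1, (4 * N + 1) ^ d, Nat.one_le_pow _ _ (by omega), ρ, hρ0, htlt, ?_⟩
  intro S m J
  -- a residue class that contains a proportion of the points
  obtain ⟨r, hr⟩ : ∃ r : Fin d → ZMod (4 * N + 1),
      S.card ≤ (4 * N + 1) ^ d * (S.filter (fun z => (fun i => (z i : ZMod (4 * N + 1))) = r)).card := by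
    by_contra hcon
    push Not at hcon
    have h1 := Finset.card_eq_sum_card_fiberwise (s := S) (t := Finset.univ)
      (f := fun (z : Site d) (i : Fin d) => (z i : ZMod (4 * N + 1))) (fun _ _ => by simp)
    have h2 : ∑ r : Fin d → ZMod (4 * N + 1), (4 * N + 1) ^ d *
        (S.filter (fun z => (fun i => (z i : ZMod (4 * N + 1))) = r)).card <
        ∑ r : Fin d → ZMod (4 * N + 1), S.card :=
      Finset.sum_lt_sum_of_nonempty Finset.univ_nonempty fun r _ => hcon r
    rw [← Finset.mul_sum, ← h1, Finset.sum_const, Finset.card_univ, Fintype.card_pi,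
      Finset.prod_const, ZMod.card, Finset.card_univ, Fintype.card_fin] at h2
    simp at h2
  set S' := S.filter (fun z => (fun i => (z i : ZMod (4 * N + 1))) = r) with hS'
  refine ⟨S'.card, hr, ?_⟩
  set B : Site d × ℕ → (Bond d → ℝ) → ℝ := fun p w =>
    pathMax (blockPaths N y p.2) w (blockStart y p.1 p.2) (m + N * p.2) with hB
  have hBm : ∀ p, Measurable (B p) := fun p => measurable_pathMax _ _ _
  set I := S' ×ˢ Finset.range J with hI
  have hsub : {w | ∀ z ∈ S, pathMax (paths d (N * J)) w z m ≤ (μ - η) * (N * J)} ⊆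
      {w | 1 ≤ ∏ p ∈ I, ENNReal.ofReal (Real.exp (-t * (B p w - h)))} := by
    intro w hw
    simp only [Set.mem_ofPred_eq] at hw ⊢
    rw [← ENNReal.ofReal_prod_of_nonneg fun p _ => (Real.exp_pos _).le, ← Real.exp_sum,
      ENNReal.one_le_ofReal, Real.one_le_exp_iff, ← Finset.mul_sum, neg_mul, Left.nonneg_neg_iff,
      hI, Finset.sum_product]
    refine mul_nonpos_of_nonneg_of_nonpos ht0.le (Finset.sum_nonpos fun z hz => ?_)
    have h1 := sum_block_le hy z m J w
    have h2 := hw z (Finset.mem_filter.1 hz).1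
    rw [Finset.sum_sub_distrib, Finset.sum_const, Finset.card_range, nsmul_eq_mul]
    simp only [hB]
    rw [hh]
    linarith
  refine (measure_mono hsub).trans ?_
  have hmeas : ∀ p, Measurable (fun w => ENNReal.ofReal (Real.exp (-t * (B p w - h)))) := fun p => by
    have := hBm p
    fun_prop
  have hmark := mul_meas_ge_le_lintegral (μ := iidLaw (Bond d) ν)
    (f := fun w => ∏ p ∈ I, ENNReal.ofReal (Real.exp (-t * (B p w - h))))
    (Finset.measurable_prod _ fun p _ => hmeas p) 1
  rw [one_mul] at hmark
  refine hmark.trans ?_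
  rw [lintegral_prod_of_dependsOn I (fun p => blockSupport N p.1 m p.2) ?_ _
    (fun p _ => hmeas p) ?_]
  · have : ∀ p ∈ I, ∫⁻ w, ENNReal.ofReal (Real.exp (-t * (B p w - h))) ∂(iidLaw (Bond d) ν) =
        ENNReal.ofReal ρ := by
      intro p _
      have h1 := (identDistrib_block (ν := ν) N y p.1 m p.2).comp
        (u := fun x => ENNReal.ofReal (Real.exp (-t * (x - h)))) (by fun_prop)
      have h2 := h1.lintegral_eq
      simp only [Function.comp_def] at h2
      rw [hρ, mgf, ofReal_integral_eq_lintegral_ofReal htint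
        (ae_of_all _ fun x => (Real.exp_pos _).le)]
      exact h2
    rw [Finset.prod_congr rfl this, Finset.prod_const, hI, Finset.card_product, Finset.card_range]
  · rintro ⟨z, j⟩ hp ⟨z', j'⟩ hp' hne
    refine blockSupport_disjoint (fun i => ?_) hne
    simp only [hI, Finset.coe_product, Set.mem_prod, Finset.mem_coe, hS', Finset.mem_filter] at hp hp'
    have h1 := congrFun (hp.1.2.trans hp'.1.2.symm) i
    have h2 := (ZMod.intCast_eq_intCast_iff _ _ _).1 h1
    push_cast at h2
    exact h2
  · intro p _ w w' hw
    have := block_dependsOn hy p.1 m p.2 hw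
    simp only [hB] at this ⊢
    rw [this]

end LPP

namespace LPP

variable {d : ℕ} {ν : Measure ℝ} [IsProbabilityMeasure ν]

/-! ### The urn -/

/-- The urn configurations with `d + 1` colours after `k` draws. -/
def simplex (d k : ℕ) : Finset (Fin (d + 1) → ℕ) := Finset.piAntidiag Finset.univ k

theorem mem_simplex {k : ℕ} {a : Fin (d + 1) → ℕ} : a ∈ simplex d k ↔ ∑ c, a c = k := by
  simp [simplex]

theorem sum_sub_single {a : Fin (d + 1) → ℕ} {k : ℕ} (ha : ∑ c, a c = k + 1) {c : Fin (d + 1)}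
    (hc : a c ≠ 0) : (a - Pi.single c 1) + Pi.single c 1 = a ∧
      ∑ i, (a - Pi.single c 1 : Fin (d + 1) → ℕ) i = k := by
  have h1 : (a - Pi.single c 1) + Pi.single c 1 = a := by
    funext i
    by_cases h : i = c
    · subst h; simp; omega
    · simp [Pi.single_eq_of_ne h]
  refine ⟨h1, ?_⟩
  have h2 : ∑ i, ((a - Pi.single c 1) + Pi.single c 1 : Fin (d + 1) → ℕ) i = k + 1 := by rw [h1, ha]
  simp only [Pi.add_apply, Finset.sum_add_distrib, Finset.sum_pi_single', Finset.mem_univ,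
    if_true] at h2
  simpa using h2

/-- Removing a drawn ball and adding one are inverse to each other. -/
theorem sum_simplex_succ (k : ℕ) (G : (Fin (d + 1) → ℕ) → Fin (d + 1) → ℝ) :
    ∑ a ∈ simplex d (k + 1), ∑ c, (a c : ℝ) * G (a - Pi.single c 1) c =
      ∑ a ∈ simplex d k, ∑ c, ((a c : ℝ) + 1) * G a c := by
  rw [Finset.sum_comm, Finset.sum_comm (s := simplex d k)]
  refine Finset.sum_congr rfl fun c _ => ?_
  have h1 : ∑ a ∈ simplex d k, ((a c : ℝ) + 1) * G a c =
      ∑ a ∈ simplex d k, ((a + Pi.single c 1 : Fin (d + 1) → ℕ) c : ℝ) *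
        G ((a + Pi.single c 1) - Pi.single c 1) c := by
    refine Finset.sum_congr rfl fun a _ => ?_
    simp
  rw [h1]
  refine Eq.trans (Eq.symm ?_) (Finset.sum_image (s := simplex d k)
    (g := fun a => a + Pi.single c 1)
    (f := fun a : Fin (d + 1) → ℕ => (a c : ℝ) * G (a - Pi.single c 1) c)
    (fun a _ b _ hab => add_right_cancel hab))
  refine Finset.sum_subset ?_ ?_
  · intro a ha
    obtain ⟨b, hb, rfl⟩ := Finset.mem_image.1 ha
    rw [mem_simplex] at hb ⊢
    simp [Finset.sum_add_distrib, hb]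
  · intro a ha hna
    by_cases h : a c = 0
    · simp [h]
    · exfalso
      refine hna (Finset.mem_image.2 ⟨a - Pi.single c 1, ?_, ?_⟩)
      · rw [mem_simplex] at ha ⊢
        exact (sum_sub_single ha h).2
      · exact (sum_sub_single (mem_simplex.1 ha) h).1

theorem card_simplex (d k : ℕ) : (simplex d k).card = (k + d).choose d := by
  induction k with
  | zero =>
    have : simplex d 0 = {0} := by
      ext a
      rw [mem_simplex, Finset.mem_singleton]
      simp [funext_iff]
    simp [this]
  | succ k ih =>
    have h := sum_simplex_succ (d := d) k (fun _ _ => 1)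
    have h1 : ∑ a ∈ simplex d (k + 1), ∑ c, (a c : ℝ) * 1 = ((simplex d (k + 1)).card : ℝ) * (k + 1) := by
      rw [← nsmul_eq_mul, ← Finset.sum_const]
      refine Finset.sum_congr rfl fun a ha => ?_
      rw [mem_simplex] at ha
      simp only [mul_one]
      exact_mod_cast ha
    have h2 : ∑ a ∈ simplex d k, ∑ c, ((a c : ℝ) + 1) * 1 =
        ((simplex d k).card : ℝ) * (k + d + 1) := by
      rw [← nsmul_eq_mul, ← Finset.sum_const]
      refine Finset.sum_congr rfl fun a ha => ?_
      rw [mem_simplex] at ha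
      simp only [mul_one, Finset.sum_add_distrib, Finset.sum_const, Finset.card_univ,
        Fintype.card_fin, nsmul_eq_mul]
      have : ∑ c, (a c : ℝ) = k := by exact_mod_cast ha
      rw [this]
      push_cast
      ring
    rw [h1, h2, ih] at h
    have h3 : (simplex d (k + 1)).card * (k + 1) = (k + d).choose d * (k + d + 1) := by
      exact_mod_cast h
    have h4 := Nat.choose_mul_succ_eq (k + d) d
    rw [show k + d + 1 - d = k + 1 by omega, ← h3] at h4
    rw [show k + 1 + d = k + d + 1 by ring]
    exact Nat.eq_of_mul_eq_mul_right (Nat.succ_pos k) h4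

theorem card_simplex_succ (d k : ℕ) :
    ((simplex d (k + 1)).card : ℝ) * (k + 1) = (simplex d k).card * (k + d + 1) := by
  rw [card_simplex, card_simplex]
  have h4 := Nat.choose_mul_succ_eq (k + d) d
  rw [show k + d + 1 - d = k + 1 by omega] at h4
  rw [show k + 1 + d = k + d + 1 by ring]
  exact_mod_cast h4.symm

theorem card_simplex_pos (d k : ℕ) : 0 < (simplex d k).card := by
  rw [card_simplex]
  exact Nat.choose_pos (by omega)

theorem card_simplex_le (d k : ℕ) : (simplex d k).card ≤ (k + 1) ^ d := by
  rw [card_simplex]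
  induction d with
  | zero => simp
  | succ d ih =>
    have h := Nat.add_one_mul_choose_eq (k + d) d
    refine Nat.le_of_mul_le_mul_right (c := d + 1) ?_ (Nat.succ_pos d)
    rw [show k + (d + 1) = k + d + 1 by ring, ← h, pow_succ]
    calc (k + d + 1) * (k + d).choose d ≤ ((k + 1) * (d + 1)) * (k + 1) ^ d := by
          refine Nat.mul_le_mul ?_ ih
          nlinarith [Nat.zero_le (k * d)]
      _ = _ := by ring

/-- The urn configurations after `k` draws have the same order of magnitude as the full box: `k ^ d`. -/
theorem pow_le_card_simplex (d k : ℕ) : (k + 1) ^ d ≤ d.factorial * (simplex d k).card := by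
  rw [card_simplex, ← Nat.descFactorial_eq_factorial_mul_choose]
  have := Nat.pow_sub_le_descFactorial (k + d) d
  rwa [show k + d + 1 - d = k + 1 by omega] at this

/-- The step that belongs to a colour of the urn: the first `d` colours are the positive coordinate
directions, the last one is the negative first coordinate direction. -/
def urnDir (hd : 1 ≤ d) (c : Fin (d + 1)) : Dir d :=
  if h : c.1 < d then (⟨c.1, h⟩, true) else (⟨0, hd⟩, false)

/-- The site that a path reaches whose numbers of steps of the colours are given by `a`. -/
def urnPos (hd : 1 ≤ d) (a : Fin (d + 1) → ℕ) : Site d := ∑ c, a c • stepVec (urnDir hd c)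

theorem urnDir_injective (hd : 1 ≤ d) : Function.Injective (urnDir hd) := by
  intro c c' h
  unfold urnDir at h
  split_ifs at h with h1 h2 h2
  · simp only [Prod.mk.injEq, Fin.mk.injEq, and_true] at h
    exact Fin.ext h
  · simp at h
  · simp at h
  · exact Fin.ext (by omega)

theorem urnPos_apply (hd : 1 ≤ d) (a : Fin (d + 1) → ℕ) (i : Fin d) :
    urnPos hd a i = a i.castSucc - if i = ⟨0, hd⟩ then (a (Fin.last d) : ℤ) else 0 := by
  unfold urnPos
  rw [Finset.sum_apply, Fin.sum_univ_castSucc]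
  have h1 : ∀ j : Fin d, (a j.castSucc • stepVec (urnDir hd j.castSucc)) i =
      if j = i then (a i.castSucc : ℤ) else 0 := by
    intro j
    have : urnDir hd j.castSucc = (j, true) := by simp [urnDir]
    rw [this]
    by_cases h : j = i
    · subst h; simp [stepVec]
    · simp [stepVec, h]
  have h2 : urnDir hd (Fin.last d) = (⟨0, hd⟩, false) := by simp [urnDir]
  rw [Finset.sum_congr rfl fun j _ => h1 j, Finset.sum_ite_eq', if_pos (Finset.mem_univ _), h2]
  by_cases h : i = ⟨0, hd⟩
  · simp [stepVec, h, sub_eq_add_neg]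
  · simp [stepVec, h]

/-- At a fixed time, different urn configurations sit at different sites. This is why the steps are
`e_1, …, e_d, -e_1`, which are affinely independent. -/
theorem urnPos_injOn (hd : 1 ≤ d) (k : ℕ) : Set.InjOn (urnPos hd) (simplex d k) := by
  intro a ha b hb h
  simp only [Finset.mem_coe, mem_simplex] at ha hb
  have h1 : ∀ i : Fin d, i ≠ ⟨0, hd⟩ → a i.castSucc = b i.castSucc := by
    intro i hi
    have := congrFun h i
    rw [urnPos_apply, urnPos_apply, if_neg hi, if_neg hi] at this
    omega
  have h2 := congrFun h ⟨0, hd⟩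
  rw [urnPos_apply, urnPos_apply, if_pos rfl, if_pos rfl] at h2
  rw [Fin.sum_univ_castSucc, ← Finset.add_sum_erase _ _ (Finset.mem_univ (⟨0, hd⟩ : Fin d))]
    at ha hb
  have h3 : ∑ i ∈ Finset.univ.erase (⟨0, hd⟩ : Fin d), a i.castSucc =
      ∑ i ∈ Finset.univ.erase (⟨0, hd⟩ : Fin d), b i.castSucc :=
    Finset.sum_congr rfl fun i hi => h1 i (Finset.ne_of_mem_erase hi)
  funext c
  refine Fin.lastCases ?_ (fun i => ?_) c
  · omega
  · by_cases hi : i = ⟨0, hd⟩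
    · subst hi; omega
    · exact h1 i hi

theorem urnPos_add_single (hd : 1 ≤ d) (a : Fin (d + 1) → ℕ) (c : Fin (d + 1)) :
    urnPos hd (a + Pi.single c 1) = urnPos hd a + stepVec (urnDir hd c) := by
  unfold urnPos
  simp only [Pi.add_apply, add_smul, Finset.sum_add_distrib]
  congr 1
  rw [Finset.sum_eq_single c]
  · simp
  · intro b _ hb
    simp [Pi.single_eq_of_ne hb]
  · simp

/-- The edge by which the urn path leaves the configuration `a` at time `k` in colour `c`. -/
def urnBond (hd : 1 ≤ d) (k : ℕ) (a : Fin (d + 1) → ℕ) (c : Fin (d + 1)) : Bond d :=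
  (urnPos hd a, k, urnDir hd c)

/-- The conditional expectation of the sum of the negative parts of the field along the path of a
Pólya urn with `d + 1` colours (started from one ball of each colour), given that its
configuration after `k` draws is `a`. -/
noncomputable def urnCost (hd : 1 ≤ d) (w : Bond d → ℝ) : ℕ → (Fin (d + 1) → ℕ) → ℝ
  | 0, _ => 0
  | k + 1, a => (∑ c, (a c : ℝ) * (urnCost hd w k (a - Pi.single c 1) +
      max (-w (urnBond hd k (a - Pi.single c 1) c)) 0)) / (k + 1)

theorem urnCost_nonneg (hd : 1 ≤ d) (w : Bond d → ℝ) (k : ℕ) (a : Fin (d + 1) → ℕ) :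
    0 ≤ urnCost hd w k a := by
  induction k generalizing a with
  | zero => simp [urnCost]
  | succ k ih =>
    rw [urnCost]
    refine div_nonneg (Finset.sum_nonneg fun c _ => mul_nonneg (Nat.cast_nonneg _)
      (add_nonneg (ih _) (le_max_right _ _))) (by positivity)

/-- Some path realizes at most the average cost, as `urnCost` is an iterated weighted average. -/
theorem exists_path_urnCost (hd : 1 ≤ d) (w : Bond d → ℝ) (k : ℕ) (a : Fin (d + 1) → ℕ)
    (ha : ∑ c, a c = k) :
    ∃ l : List (Dir d), l.length = k ∧ disp l = urnPos hd a ∧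
      -urnCost hd w k a ≤ pathSum w 0 0 l := by
  induction k generalizing a with
  | zero =>
    refine ⟨[], rfl, ?_, by simp [urnCost, pathSum]⟩
    have : ∀ c, a c = 0 := by simpa using ha
    simp [disp, urnPos, this]
  | succ k ih =>
    set v : Fin (d + 1) → ℝ := fun c => urnCost hd w k (a - Pi.single c 1) +
      max (-w (urnBond hd k (a - Pi.single c 1) c)) 0 with hv
    -- a weighted average is at least one of its entries of positive weight
    obtain ⟨c, hc0, hc⟩ : ∃ c, a c ≠ 0 ∧ v c ≤ urnCost hd w (k + 1) a := by
      by_contra hcon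
      push Not at hcon
      obtain ⟨c₀, hc₀⟩ : ∃ c, a c ≠ 0 := by
        by_contra h0
        push Not at h0
        simp [h0] at ha
      have h1 : ∑ c, (a c : ℝ) * urnCost hd w (k + 1) a < ∑ c, (a c : ℝ) * v c := by
        refine Finset.sum_lt_sum (fun c _ => ?_) ⟨c₀, Finset.mem_univ _, ?_⟩
        · by_cases h : a c = 0
          · simp [h]
          · exact mul_le_mul_of_nonneg_left (hcon c h).le (Nat.cast_nonneg _)
        · exact mul_lt_mul_of_pos_left (hcon c₀ hc₀) (by positivity)
      have h2 : ∑ c, (a c : ℝ) = k + 1 := by exact_mod_cast ha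
      rw [← Finset.sum_mul, h2, urnCost, mul_div_cancel₀ _ (by positivity)] at h1
      exact lt_irrefl _ h1
    obtain ⟨h1, h2⟩ := sum_sub_single ha hc0
    obtain ⟨l, hl, hdl, hle⟩ := ih _ h2
    refine ⟨l ++ [urnDir hd c], by simp [hl], ?_, ?_⟩
    · rw [disp_append, hdl]
      conv_rhs => rw [← h1, urnPos_add_single]
      simp [disp]
    · rw [pathSum_append, hl, hdl]
      simp only [pathSum, zero_add, add_zero]
      have h3 : -max (-w (urnBond hd k (a - Pi.single c 1) c)) 0 ≤
          w (urnPos hd (a - Pi.single c 1), k, urnDir hd c) := by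
        rw [neg_le]
        exact le_max_left _ _
      simp only [hv] at hc
      linarith

/-- The urn is uniformly distributed on the simplex at each time, so that the average cost is at most
a sum in which each edge out of level `k` has weight `1 / (simplex d k).card`. -/
theorem sum_urnCost_le (hd : 1 ≤ d) (w : Bond d → ℝ) (m : ℕ) :
    ∑ a ∈ simplex d m, urnCost hd w m a ≤ (simplex d m).card *
      ∑ k ∈ Finset.range m, ∑ a ∈ simplex d k, ∑ c,
        1 / ((simplex d k).card : ℝ) * max (-w (urnBond hd k a c)) 0 := by
  induction m with
  | zero => simp [urnCost]
  | succ m ih =>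
    have hN : (0 : ℝ) < (simplex d m).card := by exact_mod_cast card_simplex_pos d m
    have hsucc := card_simplex_succ d m
    have h1 : ∑ a ∈ simplex d (m + 1), urnCost hd w (m + 1) a =
        (∑ a ∈ simplex d m, ∑ c, ((a c : ℝ) + 1) *
          (urnCost hd w m a + max (-w (urnBond hd m a c)) 0)) / (m + 1) := by
      rw [← sum_simplex_succ m (fun a c => urnCost hd w m a + max (-w (urnBond hd m a c)) 0),
        Finset.sum_div]
      rfl
    have h2 : ∑ a ∈ simplex d m, ∑ c, ((a c : ℝ) + 1) *
          (urnCost hd w m a + max (-w (urnBond hd m a c)) 0) ≤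
        ∑ a ∈ simplex d m, ((m + d + 1) * urnCost hd w m a +
          (m + d + 1) * ∑ c, max (-w (urnBond hd m a c)) 0) := by
      refine Finset.sum_le_sum fun a ha => ?_
      rw [mem_simplex] at ha
      simp only [mul_add, Finset.sum_add_distrib]
      refine add_le_add (le_of_eq ?_) ?_
      · rw [← Finset.sum_mul, Finset.sum_add_distrib]
        have : ∑ c, (a c : ℝ) = m := by exact_mod_cast ha
        rw [this]
        simp
        left
        ring
      · rw [Finset.mul_sum]
        refine Finset.sum_le_sum fun c _ => mul_le_mul_of_nonneg_right ?_ (le_max_right _ _)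
        have : a c ≤ m := ha ▸ Finset.single_le_sum (f := a) (fun _ _ => Nat.zero_le _)
          (Finset.mem_univ c)
        have : (a c : ℝ) ≤ m := by exact_mod_cast this
        have : (0 : ℝ) ≤ d := Nat.cast_nonneg _
        linarith
    rw [h1, div_le_iff₀ (by positivity), mul_right_comm, hsucc]
    refine h2.trans ?_
    rw [Finset.sum_add_distrib, ← Finset.mul_sum, ← Finset.mul_sum, Finset.sum_range_succ, mul_add]
    simp only [← Finset.mul_sum]
    simp only [← Finset.mul_sum] at ih
    refine add_le_add ?_ (le_of_eq ?_)
    · have h4 := mul_le_mul_of_nonneg_left ih (show (0 : ℝ) ≤ m + d + 1 by positivity)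
      refine h4.trans (le_of_eq ?_)
      ring
    · field_simp

/-- A Chernoff bound for the average of `urnCost`: the edges of the urn are distinct, so that
their contributions are independent. -/
theorem measure_urnCost_le (hd : 1 ≤ d) (m : ℕ) {θ t : ℝ} (hθ : 0 ≤ θ) (L : ℕ → ℝ)
    (hL : ∀ k < m, ∫⁻ x, ENNReal.ofReal (Real.exp (θ / (simplex d k).card * max (-x) 0)) ∂ν ≤
      ENNReal.ofReal (Real.exp (L k))) :
    iidLaw (Bond d) ν {w | (simplex d m).card * t < ∑ a ∈ simplex d m, urnCost hd w m a} ≤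
      ENNReal.ofReal (Real.exp (-(θ * t) +
        ∑ k ∈ Finset.range m, (d + 1) * (simplex d k).card * L k)) := by
  classical
  set I : Finset (Σ _ : ℕ, (Fin (d + 1) → ℕ) × Fin (d + 1)) :=
    (Finset.range m).sigma (fun k => simplex d k ×ˢ Finset.univ) with hI
  set b : (Σ _ : ℕ, (Fin (d + 1) → ℕ) × Fin (d + 1)) → Bond d :=
    fun p => urnBond hd p.1 p.2.1 p.2.2 with hb
  set G : (Σ _ : ℕ, (Fin (d + 1) → ℕ) × Fin (d + 1)) → (Bond d → ℝ) → ENNReal := fun p w =>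
    ENNReal.ofReal (Real.exp (θ / (simplex d p.1).card * max (-w (b p)) 0)) with hG
  have hGm : ∀ p, Measurable (G p) := fun p => by simp only [hG]; fun_prop
  have hsub : {w | (simplex d m).card * t < ∑ a ∈ simplex d m, urnCost hd w m a} ⊆
      {w | ENNReal.ofReal (Real.exp (θ * t)) ≤ ∏ p ∈ I, G p w} := by
    intro w hw
    simp only [Set.mem_ofPred_eq] at hw ⊢
    simp only [hG]
    rw [← ENNReal.ofReal_prod_of_nonneg fun p _ => (Real.exp_pos _).le, ← Real.exp_sum]
    refine ENNReal.ofReal_le_ofReal (Real.exp_le_exp.2 ?_)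
    have h1 := hw.le.trans (sum_urnCost_le hd w m)
    have h2 := le_of_mul_le_mul_left h1 (by exact_mod_cast card_simplex_pos d m)
    refine (mul_le_mul_of_nonneg_left h2 hθ).trans (le_of_eq ?_)
    rw [hI, Finset.sum_sigma, Finset.mul_sum]
    refine Finset.sum_congr rfl fun k _ => ?_
    rw [Finset.sum_product, Finset.mul_sum]
    refine Finset.sum_congr rfl fun a _ => ?_
    rw [Finset.mul_sum]
    refine Finset.sum_congr rfl fun c _ => ?_
    simp only [hb]
    ring
  refine (measure_mono hsub).trans ?_
  have hmark := mul_meas_ge_le_lintegral (μ := iidLaw (Bond d) ν)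
    (f := fun w => ∏ p ∈ I, G p w) (Finset.measurable_prod _ fun p _ => hGm p)
    (ENNReal.ofReal (Real.exp (θ * t)))
  have hpos : 0 < ENNReal.ofReal (Real.exp (θ * t)) := ENNReal.ofReal_pos.2 (Real.exp_pos _)
  rw [mul_comm, ← ENNReal.le_div_iff_mul_le (Or.inl hpos.ne') (Or.inl ENNReal.ofReal_ne_top)]
    at hmark
  refine hmark.trans ?_
  rw [Real.exp_add, Real.exp_neg, ENNReal.ofReal_mul (by positivity),
    ENNReal.ofReal_inv_of_pos (Real.exp_pos _), ENNReal.div_eq_inv_mul]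
  refine mul_le_mul' le_rfl ?_
  rw [lintegral_prod_of_dependsOn I (fun p => {b p}) ?_ G (fun p _ => hGm p) ?_]
  · rw [hI, Finset.prod_sigma, Real.exp_sum, ENNReal.ofReal_prod_of_nonneg fun p _ =>
      (Real.exp_pos _).le]
    refine Finset.prod_le_prod' fun k hk => ?_
    have h1 : ∀ p ∈ simplex d k ×ˢ (Finset.univ : Finset (Fin (d + 1))),
        ∫⁻ w, G ⟨k, p⟩ w ∂(iidLaw (Bond d) ν) ≤ ENNReal.ofReal (Real.exp (L k)) := by
      intro p _
      refine le_trans (le_of_eq ?_) (hL k (Finset.mem_range.1 hk))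
      exact (measurePreserving_apply (ν := ν) (b ⟨k, p⟩)).lintegral_comp
        (f := fun y => ENNReal.ofReal (Real.exp (θ / (simplex d k).card * max (-y) 0)))
        (by fun_prop)
    refine (Finset.prod_le_prod' h1).trans (le_of_eq ?_)
    rw [Finset.prod_const, Finset.card_product, Finset.card_univ, Fintype.card_fin,
      ← ENNReal.ofReal_pow (Real.exp_pos _).le, ← Real.exp_nat_mul]
    push_cast
    ring_nf
  · rintro ⟨k, a, c⟩ hp ⟨k', a', c'⟩ hp' hne
    rw [Function.onFun, Set.disjoint_singleton]
    intro heq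
    refine hne ?_
    simp only [hb, urnBond, Prod.mk.injEq] at heq
    obtain ⟨h1, h2, h3⟩ := heq
    subst h2
    simp only [hI, Finset.mem_coe, Finset.mem_sigma, Finset.mem_product] at hp hp'
    rw [urnPos_injOn hd k hp.2.1 hp'.2.1 h1, urnDir_injective hd h3]
  · intro p _ w w' hw
    simp only [hG, hw (b p) rfl]

end LPP

namespace LPP

variable {d : ℕ} {ν : Measure ℝ} [IsProbabilityMeasure ν]

/-! ### Exponential moments at the dyadic scales -/

/-- The lower tail of the one-site law. The left hand side of `htail` is not the junk value
`log 0 = 0` because the right hand side is negative. -/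
theorem measure_Iio_neg {M₀ : ℝ} (hM₀ : 0 < M₀) {f : ℝ → ℝ} (hfpos : ∀ x, 0 < x → 0 < f x)
    (htail : ∀ x : ℝ, x < -M₀ → Real.log (ν.real (Set.Iio x)) = -((-x) ^ (d + 1) * f (-x)))
    {h : ℝ} (hh : M₀ < h) :
    ν (Set.Iio (-h)) = ENNReal.ofReal (Real.exp (-(h ^ (d + 1) * f h))) := by
  have h1 := htail (-h) (by linarith)
  rw [neg_neg] at h1
  have hpos : 0 < h ^ (d + 1) * f h := mul_pos (pow_pos (by linarith) _) (hfpos h (by linarith))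
  have h2 : 0 < ν.real (Set.Iio (-h)) := by
    refine lt_of_le_of_ne measureReal_nonneg fun h0 => ?_
    rw [← h0, Real.log_zero] at h1
    linarith
  rw [← h1, Real.exp_log h2, ofReal_measureReal (measure_ne_top _ _)]

/-- When the lower tail beyond `T` decays at twice the exponential rate `s`, the exponential moment of
the negative part with parameter `s` is essentially `exp (s T)`. -/
theorem lintegral_exp_negPart_le {s T : ℝ} (hs : 1 ≤ s) (hT : 1 ≤ T)
    (htail : ∀ h, T ≤ h → ν (Set.Iio (-h)) ≤ ENNReal.ofReal (Real.exp (-(2 * s * h)))) :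
    ∫⁻ x, ENNReal.ofReal (Real.exp (s * max (-x) 0)) ∂ν ≤
      ENNReal.ofReal (Real.exp (s * T + 2)) := by
  have hpt : ∀ x : ℝ, ENNReal.ofReal (Real.exp (s * max (-x) 0)) ≤
      ENNReal.ofReal (Real.exp (s * T)) + ∑' j : ℕ, (Set.Iio (-(T + j))).indicator
        (fun _ => ENNReal.ofReal (Real.exp (s * (T + j + 1)))) x := by
    intro x
    rcases le_or_gt (max (-x) 0) T with h | h
    · refine le_add_right (ENNReal.ofReal_le_ofReal (Real.exp_le_exp.2 ?_))
      exact mul_le_mul_of_nonneg_left h (by linarith)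
    · refine le_add_left ?_
      have hx : max (-x) 0 = -x := by
        rcases max_choice (-x) 0 with h1 | h1
        · exact h1
        · rw [h1] at h; linarith
      rw [hx] at h ⊢
      have hceil : 1 ≤ ⌈-x - T⌉₊ := Nat.one_le_iff_ne_zero.2 (by
        rw [ne_eq, Nat.ceil_eq_zero]; linarith)
      obtain ⟨j, hj⟩ : ∃ j : ℕ, ⌈-x - T⌉₊ = j + 1 := ⟨_, (Nat.sub_add_cancel hceil).symm⟩
      have h1 : -x - T ≤ j + 1 := by
        have := Nat.le_ceil (-x - T)
        rw [hj] at this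
        exact_mod_cast this
      have h2 : (j : ℝ) < -x - T := by
        have : j < ⌈-x - T⌉₊ := by omega
        exact Nat.lt_ceil.1 this
      refine le_trans ?_ (ENNReal.le_tsum j)
      rw [Set.indicator_of_mem (by rw [Set.mem_Iio]; linarith)]
      refine ENNReal.ofReal_le_ofReal (Real.exp_le_exp.2 ?_)
      exact mul_le_mul_of_nonneg_left (by linarith) (by linarith)
  refine (lintegral_mono hpt).trans ?_
  rw [lintegral_add_left measurable_const, lintegral_tsum fun j =>
    (measurable_const.indicator measurableSet_Iio).aemeasurable]
  have hterm : ∀ j : ℕ, ∫⁻ x, (Set.Iio (-(T + j))).indicator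
        (fun _ => ENNReal.ofReal (Real.exp (s * (T + j + 1)))) x ∂ν ≤ 2⁻¹ ^ j := by
    intro j
    rw [lintegral_indicator_const measurableSet_Iio]
    have hj : (0 : ℝ) ≤ j := Nat.cast_nonneg j
    calc _ ≤ ENNReal.ofReal (Real.exp (s * (T + j + 1))) *
          ENNReal.ofReal (Real.exp (-(2 * s * (T + j)))) := by
          gcongr
          exact htail _ (by linarith)
      _ = ENNReal.ofReal (Real.exp (s * (T + j + 1) + -(2 * s * (T + j)))) := by
          rw [← ENNReal.ofReal_mul (Real.exp_pos _).le, Real.exp_add]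
      _ ≤ ENNReal.ofReal (Real.exp (-1) ^ j) := by
          refine ENNReal.ofReal_le_ofReal ?_
          rw [← Real.exp_nat_mul]
          refine Real.exp_le_exp.2 ?_
          nlinarith [mul_nonneg (sub_nonneg.2 hs) hj, mul_nonneg (sub_nonneg.2 hs) (sub_nonneg.2 hT)]
      _ ≤ ENNReal.ofReal ((1 / 2) ^ j) := by
          refine ENNReal.ofReal_le_ofReal (pow_le_pow_left₀ (Real.exp_pos _).le ?_ j)
          rw [Real.exp_neg, one_div]
          refine inv_anti₀ (by norm_num) ?_
          linarith [Real.add_one_le_exp (1 : ℝ)]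
      _ = _ := by
          rw [ENNReal.ofReal_pow (by norm_num), one_div, ENNReal.ofReal_inv_of_pos (by norm_num)]
          norm_num
  have hsum : ∑' j : ℕ, ∫⁻ x, (Set.Iio (-(T + j))).indicator
        (fun _ => ENNReal.ofReal (Real.exp (s * (T + j + 1)))) x ∂ν ≤ ENNReal.ofReal 2 := by
    refine (ENNReal.tsum_le_tsum hterm).trans ?_
    rw [ENNReal.tsum_geometric, ENNReal.one_sub_inv_two, inv_inv]
    norm_num
  have h1 : ∫⁻ _, ENNReal.ofReal (Real.exp (s * T)) ∂ν = ENNReal.ofReal (Real.exp (s * T)) := by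
    simp
  rw [h1]
  refine (add_le_add le_rfl hsum).trans ?_
  rw [← ENNReal.ofReal_add (Real.exp_pos _).le (by norm_num)]
  refine ENNReal.ofReal_le_ofReal ?_
  rw [Real.exp_add]
  have h3 : 1 ≤ Real.exp (s * T) := Real.one_le_exp (by positivity)
  have h4 := Real.add_one_le_exp (2 : ℝ)
  nlinarith

theorem pow_log_mul_le {b : ℕ} {n k : ℕ} (hk : k + 1 ≤ n) :
    (k + 1) * b ^ Nat.log b (n / (k + 1)) ≤ n := by
  have h0 : n / (k + 1) ≠ 0 := (Nat.div_pos hk (Nat.succ_pos k)).ne'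
  calc _ ≤ (k + 1) * (n / (k + 1)) := Nat.mul_le_mul_left _ (Nat.pow_log_le_self b h0)
    _ ≤ n := Nat.mul_div_le _ _

theorem lt_mul_pow_log {b : ℕ} (hb : 1 < b) (n k : ℕ) :
    n < (k + 1) * b ^ (Nat.log b (n / (k + 1)) + 1) := by
  have h := Nat.lt_pow_succ_log_self hb (n / (k + 1))
  rw [Nat.div_lt_iff_lt_mul (Nat.succ_pos k), mul_comm] at h
  exact h

/-- A sum over the levels `k` that only depends on the scale `log_b (n / (k + 1))`, regrouped by
scales. -/
theorem sum_log_div_le {b : ℕ} (hb : 1 < b) {T : ℕ → ℝ} (hT : ∀ i, 0 ≤ T i) {m n i₀ : ℕ}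
    (hm : m * b ^ i₀ ≤ n) :
    ∑ k ∈ Finset.range m, T (Nat.log b (n / (k + 1))) ≤
      n * ∑ i ∈ Finset.Ico i₀ (Nat.log b n + 1), T i / (b : ℝ) ^ i := by
  have hb0 : 0 < b := by omega
  have hmn : m ≤ n := le_trans (Nat.le_mul_of_pos_right _ (pow_pos hb0 _)) hm
  have hmaps : ∀ k ∈ Finset.range m, Nat.log b (n / (k + 1)) ∈
      Finset.Ico i₀ (Nat.log b n + 1) := by
    intro k hk
    rw [Finset.mem_range] at hk
    rw [Finset.mem_Ico, Nat.lt_succ_iff]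
    refine ⟨?_, Nat.log_mono_right (Nat.div_le_self _ _)⟩
    refine Nat.le_log_of_pow_le hb ?_
    rw [Nat.le_div_iff_mul_le (Nat.succ_pos k)]
    refine le_trans ?_ hm
    rw [mul_comm]
    exact Nat.mul_le_mul_right _ hk
  rw [← Finset.sum_fiberwise_of_maps_to hmaps, Finset.mul_sum]
  refine Finset.sum_le_sum fun i _ => ?_
  rw [Finset.sum_congr rfl fun k hk => by rw [(Finset.mem_filter.1 hk).2], Finset.sum_const,
    nsmul_eq_mul, mul_div_assoc', mul_div_right_comm]
  refine mul_le_mul_of_nonneg_right ?_ (hT i)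
  have hsub : (Finset.range m).filter (fun k => Nat.log b (n / (k + 1)) = i) ⊆
      Finset.range (n / b ^ i) := by
    intro k hk
    rw [Finset.mem_filter, Finset.mem_range] at hk
    rw [Finset.mem_range, ← Nat.succ_le_iff, Nat.le_div_iff_mul_le (pow_pos hb0 _), ← hk.2]
    exact pow_log_mul_le (by omega)
  have h1 := Finset.card_le_card hsub
  rw [Finset.card_range] at h1
  have h2 : ((n / b ^ i : ℕ) : ℝ) ≤ n / (b : ℝ) ^ i := by
    have := @Nat.cast_div_le ℝ _ _ _ n (b ^ i)
    push_cast at this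
    exact this
  exact le_trans (by exact_mod_cast h1) h2

/-- The weight `f (2 ^ i) ^ (-1 / d)` of the scale `2 ^ i`. -/
noncomputable def scaleWeight (d : ℕ) (f : ℝ → ℝ) (i : ℕ) : ℝ := 1 / f (2 ^ i) ^ (1 / (d : ℝ))

theorem scaleWeight_pos {f : ℝ → ℝ} (hfpos : ∀ x, 0 < x → 0 < f x) (i : ℕ) :
    0 < scaleWeight d f i :=
  one_div_pos.2 (Real.rpow_pos_of_pos (hfpos _ (by positivity)) _)

theorem scaleWeight_pow (hd : 1 ≤ d) {f : ℝ → ℝ} (hfpos : ∀ x, 0 < x → 0 < f x) (i : ℕ) :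
    scaleWeight d f i ^ d * f (2 ^ i) = 1 := by
  have h := hfpos (2 ^ i) (by positivity)
  have hd' : (d : ℝ) ≠ 0 := by positivity
  rw [scaleWeight, div_pow, one_pow, ← Real.rpow_natCast, ← Real.rpow_mul h.le,
    one_div_mul_cancel hd', Real.rpow_one, one_div_mul_cancel h.ne']

/-- When the weights of the scales are summable, the average cost of the urn paths up to a small
multiple of `n` exceeds `η n` with probability at most `exp (-(η / 2) n ^ (d + 1))`. -/
theorem measure_urnCost_le_exp (hd : 1 ≤ d) {M₀ : ℝ} (hM₀ : 0 < M₀) {f : ℝ → ℝ}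
    (hfpos : ∀ x, 0 < x → 0 < f x) (hfmono : MonotoneOn f (Set.Ioi M₀))
    (htail : ∀ x : ℝ, x < -M₀ → Real.log (ν.real (Set.Iio x)) = -((-x) ^ (d + 1) * f (-x)))
    (hsum : Summable (scaleWeight d f)) {η : ℝ} (hη : 0 < η) :
    ∃ i₁ : ℕ, ∀ i₀ ≥ i₁, ∀ n m : ℕ, m * 4 ^ i₀ ≤ n →
      iidLaw (Bond d) ν {w | (simplex d m).card * (η * n) <
        ∑ a ∈ simplex d m, urnCost hd w m a} ≤
      ENNReal.ofReal (Real.exp (-(η / 2 * (n : ℝ) ^ (d + 1)))) := by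
  set D : ℝ := (d.factorial : ℝ) with hD
  have hD1 : 1 ≤ D := by rw [hD]; exact_mod_cast Nat.succ_le_of_lt (Nat.factorial_pos d)
  -- At the levels `k` with `n / (k + 1)` of order `4 ^ i`, the Chernoff parameter `n ^ d` gives an edge
  -- the parameter `s` of order `4 ^ (i d)`. A value below `-h` costs `h ^ (d + 1) f h`, which exceeds
  -- `2 s h` from the threshold `T i` on. The levels `4 ^ i` are used with the weights at `2 ^ i`, as
  -- then `f (T i) ≥ f (2 ^ i)` and both parts of `T i / 4 ^ i` are summable.
  set T : ℕ → ℝ := fun i => 2 ^ i + 8 * D * 4 ^ i * scaleWeight d f i with hT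
  have hTpos : ∀ i, 0 ≤ T i := fun i => by
    have := (scaleWeight_pos (d := d) hfpos i).le
    positivity
  have hsumT : Summable (fun i => (T i + 2) / ((4 : ℕ) : ℝ) ^ i) := by
    have h1 : Summable (fun i : ℕ => ((1 : ℝ) / 2) ^ i + 8 * D * scaleWeight d f i +
        2 * (1 / 4) ^ i) :=
      ((summable_geometric_of_lt_one (by norm_num) (by norm_num)).add (hsum.mul_left _)).add
        ((summable_geometric_of_lt_one (by norm_num) (by norm_num)).mul_left 2)
    refine h1.congr fun i => ?_
    have h2 : (2 : ℝ) ^ i / 4 ^ i = (1 / 2) ^ i := by rw [← div_pow]; norm_num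
    simp only [hT]
    push_cast
    rw [add_div, add_div, h2, one_div_pow 4]
    field_simp
  have hev : ∀ᶠ i₀ : ℕ in atTop, (∑' i, (T (i + i₀) + 2) / ((4 : ℕ) : ℝ) ^ (i + i₀)) <
      η / (2 * (d + 1)) :=
    (tendsto_sum_nat_add (fun i => (T i + 2) / ((4 : ℕ) : ℝ) ^ i)).eventually_lt_const
      (by positivity)
  have hev2 : ∀ᶠ i₀ : ℕ in atTop, M₀ < (2 : ℝ) ^ i₀ :=
    (tendsto_pow_atTop_atTop_of_one_lt (by norm_num : (1 : ℝ) < 2)).eventually_gt_atTop M₀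
  obtain ⟨i₁, hi₁⟩ := (hev.and hev2).exists_forall_of_atTop
  refine ⟨i₁, fun i₀ hi₀ n m hm => ?_⟩
  obtain ⟨htau, hM⟩ := hi₁ i₀ hi₀
  have hmn : m ≤ n := le_trans (Nat.le_mul_of_pos_right _ (by positivity)) hm
  have hcard : ∀ k, (0 : ℝ) < (simplex d k).card := fun k => by
    exact_mod_cast card_simplex_pos d k
  have hcardle : ∀ k < m, ((simplex d k).card : ℝ) ≤ (n : ℝ) ^ d := by
    intro k hk
    have := (card_simplex_le d k).trans (Nat.pow_le_pow_left (show k + 1 ≤ n by omega) d)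
    exact_mod_cast this
  set L : ℕ → ℝ := fun k => (n : ℝ) ^ d / (simplex d k).card * T (Nat.log 4 (n / (k + 1))) + 2
    with hL
  refine (measure_urnCost_le (ν := ν) hd m (θ := (n : ℝ) ^ d) (t := η * n) (by positivity) L
    ?_).trans ?_
  · intro k hk
    set i := Nat.log 4 (n / (k + 1)) with hi
    have hi₀i : i₀ ≤ i := by
      refine Nat.le_log_of_pow_le (by norm_num) ?_
      rw [Nat.le_div_iff_mul_le (Nat.succ_pos k)]
      refine le_trans ?_ hm
      rw [mul_comm]
      exact Nat.mul_le_mul_right _ hk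
    have h2i : M₀ < (2 : ℝ) ^ i := hM.trans_le (pow_le_pow_right₀ (by norm_num) hi₀i)
    have hg := scaleWeight_pos (d := d) hfpos i
    have hT2 : (2 : ℝ) ^ i ≤ T i := by
      simp only [hT]
      have : 0 ≤ 8 * D * 4 ^ i * scaleWeight d f i := by positivity
      linarith
    refine lintegral_exp_negPart_le ?_ ((one_le_pow₀ (by norm_num)).trans hT2) fun h hh => ?_
    · rw [one_le_div (hcard k)]
      exact hcardle k hk
    · have hhM : M₀ < h := h2i.trans_le (hT2.trans hh)
      have hh0 : 0 < h := hM₀.trans hhM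
      rw [measure_Iio_neg hM₀ hfpos htail hhM]
      refine ENNReal.ofReal_le_ofReal (Real.exp_le_exp.2 (neg_le_neg ?_))
      -- the choice of `T i` makes the tail dominate the exponential moment
      have h1 : (n : ℝ) ^ d / (simplex d k).card ≤ D * (4 * 4 ^ i) ^ d := by
        rw [div_le_iff₀ (hcard k)]
        have h3 := pow_le_card_simplex d k
        have h3' : ((k : ℝ) + 1) ^ d ≤ D * (simplex d k).card := by
          rw [hD]; exact_mod_cast h3
        have h4 := lt_mul_pow_log (b := 4) (by norm_num) n k
        have h4' : (n : ℝ) ≤ (k + 1) * (4 * 4 ^ i) := by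
          rw [pow_succ, mul_comm _ 4] at h4
          exact_mod_cast h4.le
        calc (n : ℝ) ^ d ≤ ((k + 1) * (4 * 4 ^ i)) ^ d := by gcongr
          _ = (k + 1 : ℝ) ^ d * (4 * 4 ^ i) ^ d := mul_pow _ _ _
          _ ≤ (D * (simplex d k).card) * (4 * 4 ^ i) ^ d := by gcongr
          _ = _ := by ring
      have h2 : 2 * (D * (4 * 4 ^ i) ^ d) ≤ h ^ d * f h := by
        have h5 : 8 * D * 4 ^ i * scaleWeight d f i ≤ h := by
          refine le_trans ?_ hh
          simp only [hT]
          have : (0 : ℝ) ≤ 2 ^ i := by positivity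
          linarith
        have h6 : f (2 ^ i) ≤ f h := hfmono h2i hhM (hT2.trans hh)
        calc 2 * (D * (4 * 4 ^ i) ^ d) ≤ (2 * D) ^ d * (4 * 4 ^ i) ^ d := by
              rw [← mul_assoc]
              gcongr
              exact le_self_pow₀ (by linarith) (by omega)
          _ = (8 * D * 4 ^ i) ^ d * (scaleWeight d f i ^ d * f (2 ^ i)) := by
              rw [scaleWeight_pow hd hfpos, mul_one, ← mul_pow]
              ring_nf
          _ = (8 * D * 4 ^ i * scaleWeight d f i) ^ d * f (2 ^ i) := by
              rw [mul_pow _ (scaleWeight d f i)]; ring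
          _ ≤ h ^ d * f h := by
              have := (hfpos (2 ^ i) (by positivity)).le
              gcongr
      calc 2 * ((n : ℝ) ^ d / (simplex d k).card) * h
          ≤ 2 * (D * (4 * 4 ^ i) ^ d) * h := by gcongr
        _ ≤ (h ^ d * f h) * h := by gcongr
        _ = _ := by ring
  · refine ENNReal.ofReal_le_ofReal (Real.exp_le_exp.2 ?_)
    have h1 : ∑ k ∈ Finset.range m, (d + 1 : ℝ) * (simplex d k).card * L k ≤
        (d + 1) * (n : ℝ) ^ d * ∑ k ∈ Finset.range m, (T (Nat.log 4 (n / (k + 1))) + 2) := by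
      rw [Finset.mul_sum]
      refine Finset.sum_le_sum fun k hk => ?_
      rw [Finset.mem_range] at hk
      simp only [hL]
      rw [mul_assoc, mul_assoc]
      refine mul_le_mul_of_nonneg_left ?_ (by positivity)
      have hk2 := hcardle k hk
      have hne := (hcard k).ne'
      calc ((simplex d k).card : ℝ) *
            ((n : ℝ) ^ d / (simplex d k).card * T (Nat.log 4 (n / (k + 1))) + 2)
          = (n : ℝ) ^ d * T (Nat.log 4 (n / (k + 1))) + (simplex d k).card * 2 := by
            rw [mul_add, ← mul_assoc, mul_div_cancel₀ _ hne]
        _ ≤ _ := by linarith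
    have h2 := sum_log_div_le (b := 4) (by norm_num) (T := fun i => T i + 2)
      (fun i => by linarith [hTpos i]) hm
    have h3 : ∑ i ∈ Finset.Ico i₀ (Nat.log 4 n + 1), (T i + 2) / ((4 : ℕ) : ℝ) ^ i ≤
        η / (2 * (d + 1)) := by
      refine le_trans ?_ htau.le
      rw [Finset.sum_Ico_eq_sum_range]
      simp only [add_comm i₀]
      exact ((summable_nat_add_iff i₀).2 hsumT).sum_le_tsum _ (fun i _ => by
        have := hTpos (i + i₀)
        positivity)
    have h4 : ∑ k ∈ Finset.range m, (T (Nat.log 4 (n / (k + 1))) + 2) ≤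
        n * (η / (2 * (d + 1))) := h2.trans (mul_le_mul_of_nonneg_left h3 (Nat.cast_nonneg n))
    have h5 : (d + 1) * (n : ℝ) ^ d * ∑ k ∈ Finset.range m, (T (Nat.log 4 (n / (k + 1))) + 2) ≤
        (d + 1) * (n : ℝ) ^ d * (n * (η / (2 * (d + 1)))) :=
      mul_le_mul_of_nonneg_left h4 (by positivity)
    have h6 : (d + 1) * (n : ℝ) ^ d * (n * (η / (2 * (d + 1)))) = η / 2 * (n : ℝ) ^ (d + 1) := by
      field_simp
      ring
    have h7 : (n : ℝ) ^ d * (η * n) = η * (n : ℝ) ^ (d + 1) := by ring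
    rw [h7]
    linarith

end LPP

namespace LPP

variable {d : ℕ} {ν : Measure ℝ} [IsProbabilityMeasure ν]

/-! ### The upper bound when the weights are summable -/

/-- The set of starting points of tubes that the urn reaches at cost at most `2 t` is at least half
of the simplex when the average cost is at most `t`. -/
theorem card_simplex_le_two_mul_card_filter (hd : 1 ≤ d) (w : Bond d → ℝ) (m : ℕ) {t : ℝ}
    (ht : 0 < t) (h : ∑ a ∈ simplex d m, urnCost hd w m a ≤ (simplex d m).card * t) :
    (simplex d m).card ≤ 2 * ((simplex d m).filter (fun a => urnCost hd w m a ≤ 2 * t)).card := by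
  have h1 := Finset.card_filter_add_card_filter_not (s := simplex d m)
    (fun a => urnCost hd w m a ≤ 2 * t)
  set B := (simplex d m).filter (fun a => ¬ urnCost hd w m a ≤ 2 * t) with hB
  have h2 : (B.card : ℝ) * (2 * t) ≤ ∑ a ∈ simplex d m, urnCost hd w m a := by
    rw [← nsmul_eq_mul, ← Finset.sum_const]
    refine (Finset.sum_le_sum fun a ha => ?_).trans
      (Finset.sum_le_sum_of_subset_of_nonneg (Finset.filter_subset _ _)
        fun a _ _ => urnCost_nonneg hd w m a)
    exact (not_le.1 (Finset.mem_filter.1 ha).2).le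
  have h3 : (B.card : ℝ) * 2 ≤ (simplex d m).card := by
    have := h2.trans h
    nlinarith
  have h4 : B.card * 2 ≤ (simplex d m).card := by exact_mod_cast h3
  omega

/-- A path from the origin follows the urn for `m` steps and then a tube. -/
theorem pathMax_tube_le (hd : 1 ≤ d) {n m r : ℕ} (hn : m + r = n) (w : Bond d → ℝ)
    {a : Fin (d + 1) → ℕ} (ha : a ∈ simplex d m) :
    -urnCost hd w m a + pathMax (paths d r) w (urnPos hd a) m ≤ pathMax (paths d n) w 0 0 := by
  obtain ⟨l, hl, hdl, hle⟩ := exists_path_urnCost hd w m a (mem_simplex.1 ha)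
  have := pathSum_add_pathMax_le hd (m := r) hl w 0 0
  rw [hdl, zero_add, zero_add, hn] at this
  linarith

/-- If the passage value is low, then either the average cost of the urn is high, or all the tubes that
start at some set of at least half of the reachable points fail. The second event is bounded by a
union over all such sets. -/
theorem measure_low_le_of_split (hd : 1 ≤ d) {n m r : ℕ} (hn : m + r = n) {t v b : ℝ}
    (ht : 0 < t) (hv : v + 2 * t ≤ b) {C : ENNReal}
    (hC : ∀ S : Finset (Site d), (simplex d m).card ≤ 2 * S.card →
      iidLaw (Bond d) ν {w | ∀ z ∈ S, pathMax (paths d r) w z m ≤ b} ≤ C) :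
    iidLaw (Bond d) ν {w | pathMax (paths d n) w 0 0 ≤ v} ≤
      iidLaw (Bond d) ν {w | (simplex d m).card * t < ∑ a ∈ simplex d m, urnCost hd w m a} +
        2 ^ (simplex d m).card * C := by
  classical
  set fam := (simplex d m).powerset.filter (fun S => (simplex d m).card ≤ 2 * S.card) with hfam
  have hsub : {w | pathMax (paths d n) w 0 0 ≤ v} ⊆
      {w | (simplex d m).card * t < ∑ a ∈ simplex d m, urnCost hd w m a} ∪
      ⋃ S ∈ fam, {w | ∀ z ∈ S.image (urnPos hd), pathMax (paths d r) w z m ≤ b} := by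
    intro w hw
    by_cases h : (simplex d m).card * t < ∑ a ∈ simplex d m, urnCost hd w m a
    · exact Or.inl h
    refine Or.inr ?_
    have h1 := card_simplex_le_two_mul_card_filter hd w m ht (not_lt.1 h)
    refine Set.mem_biUnion (Finset.mem_filter.2 ⟨Finset.mem_powerset.2
      (Finset.filter_subset _ _), h1⟩) ?_
    intro z hz
    obtain ⟨a, ha, rfl⟩ := Finset.mem_image.1 hz
    rw [Finset.mem_filter] at ha
    have h2 := pathMax_tube_le hd hn w ha.1
    have h3 : pathMax (paths d n) w 0 0 ≤ v := hw
    linarith [ha.2]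
  refine (measure_mono hsub).trans ((measure_union_le _ _).trans (add_le_add le_rfl ?_))
  refine (measure_biUnion_finset_le _ _).trans ?_
  refine (Finset.sum_le_sum (g := fun _ => C) fun S hS => hC _ ?_).trans ?_
  · rw [hfam, Finset.mem_filter, Finset.mem_powerset] at hS
    rw [Finset.card_image_of_injOn ((urnPos_injOn hd m).mono (by exact_mod_cast hS.1))]
    exact hS.2
  · rw [Finset.sum_const, nsmul_eq_mul]
    gcongr
    have := Finset.card_le_card (Finset.filter_subset
      (fun S => (simplex d m).card ≤ 2 * S.card) (simplex d m).powerset)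
    rw [Finset.card_powerset] at this
    exact_mod_cast this

/-- For long tubes, the failure probability beats the number `2 ^ M` of sets of starting points. -/
theorem two_pow_mul_pow_le {K s J M : ℕ} (hK : 1 ≤ K) {ρ β : ℝ} (hρ : ρ = Real.exp (-β))
    (hβ : 0 < β) (hs : M ≤ 2 * (K * s)) (hJ : 4 * K ≤ β * J) :
    (2 : ENNReal) ^ M * ENNReal.ofReal ρ ^ (s * J) ≤
      ENNReal.ofReal (Real.exp (-(M * (β * J) / (4 * K)))) := by
  have h2 : (2 : ENNReal) = ENNReal.ofReal 2 := by norm_num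
  have hρ0 : 0 < ρ := hρ ▸ Real.exp_pos _
  rw [h2, ← ENNReal.ofReal_pow (by norm_num), ← ENNReal.ofReal_pow hρ0.le,
    ← ENNReal.ofReal_mul (by positivity)]
  refine ENNReal.ofReal_le_ofReal ?_
  have h3 : (2 : ℝ) ^ M ≤ Real.exp M := by
    calc (2 : ℝ) ^ M ≤ Real.exp 1 ^ M := by
          gcongr
          linarith [Real.add_one_le_exp (1 : ℝ)]
      _ = Real.exp M := by rw [← Real.exp_nat_mul, mul_one]
  have h4 : ρ ^ (s * J) = Real.exp (-(s * (β * J))) := by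
    rw [hρ, ← Real.exp_nat_mul]
    push_cast
    ring_nf
  rw [h4]
  refine (mul_le_mul_of_nonneg_right h3 (Real.exp_pos _).le).trans ?_
  rw [← Real.exp_add]
  refine Real.exp_le_exp.2 ?_
  have hK' : (0 : ℝ) < K := by exact_mod_cast hK
  have hs' : (M : ℝ) ≤ 2 * (K * s) := by exact_mod_cast hs
  have hJ0 : (0 : ℝ) ≤ β * J := by positivity
  have h5 : (M : ℝ) * (β * J) / (4 * K) ≤ s * (β * J) / 2 := by
    rw [div_le_div_iff₀ (by positivity) (by norm_num)]
    nlinarith [mul_le_mul_of_nonneg_right hs' hJ0]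
  have h6 : (M : ℝ) ≤ s * (β * J) / 2 := by
    have : (s : ℝ) * (4 * K) ≤ s * (β * J) := by gcongr
    linarith
  linarith

theorem rate_rearrange (A B β n : ℝ) {N K : ℝ} (hN : N ≠ 0) (hK : K ≠ 0) :
    A * β / (8 * N * K) * (B * n) = B * A * (β * (n / (2 * N))) / (4 * K) := by
  field_simp
  ring

/-- Summability of the weights forces the speed `n ^ (d + 1)`. -/
theorem measure_low_le_exp (hd : 1 ≤ d) {c : ℝ} (hc : 0 < c)
    (hν : Integrable (fun x => Real.exp (c * |x|)) ν) {μ : ℝ}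
    (hμ : Tendsto (fun n : ℕ => meanMax d ν n / n) atTop (𝓝 μ))
    {M₀ : ℝ} (hM₀ : 0 < M₀) {f : ℝ → ℝ}
    (hfpos : ∀ x, 0 < x → 0 < f x) (hfmono : MonotoneOn f (Set.Ioi M₀))
    (htail : ∀ x : ℝ, x < -M₀ → Real.log (ν.real (Set.Iio x)) = -((-x) ^ (d + 1) * f (-x)))
    (hsum : Summable (scaleWeight d f)) {ε : ℝ} (hε : 0 < ε) :
    ∃ δ : ℝ, 0 < δ ∧ ∀ᶠ n : ℕ in atTop,
      iidLaw (Bond d) ν {w | pathMax (paths d n) w 0 0 ≤ (μ - ε) * n} ≤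
        ENNReal.ofReal (Real.exp (-(δ * (n : ℝ) ^ (d + 1)))) := by
  set η := ε / 8 with hη
  have hη0 : 0 < η := by positivity
  obtain ⟨N, hN1, K, hK1, ρ, hρ0, hρ1, htube⟩ := tubes_fail_le hd hc hν hμ hη0
  obtain ⟨i₁, hurn⟩ := measure_urnCost_le_exp (ν := ν) hd hM₀ hfpos hfmono htail hsum hη0
  -- the time spent in the urn is a proportion `4 ^ (-i₀)` of the total time
  obtain ⟨i₀, hi₀, hi₀1, hi₀μ⟩ : ∃ i₀, i₁ ≤ i₀ ∧ 1 ≤ i₀ ∧ |μ - η| / η < (4 : ℝ) ^ i₀ :=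
    ((eventually_ge_atTop i₁).and ((eventually_ge_atTop 1).and
      ((tendsto_pow_atTop_atTop_of_one_lt (by norm_num : (1 : ℝ) < 4)).eventually_gt_atTop
        _))).exists
  set β := -Real.log ρ with hβ
  have hβ0 : 0 < β := neg_pos.2 (Real.log_neg hρ0 hρ1)
  have hρβ : ρ = Real.exp (-β) := by rw [hβ, neg_neg, Real.exp_log hρ0]
  have hNr : (1 : ℝ) ≤ N := by exact_mod_cast hN1
  have hKr : (1 : ℝ) ≤ K := by exact_mod_cast hK1
  set P := 4 ^ i₀ with hP
  have hP4 : 4 ≤ P := by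
    calc 4 = 4 ^ 1 := rfl
      _ ≤ P := Nat.pow_le_pow_right (by norm_num) hi₀1
  have hPr : (4 : ℝ) ≤ P := by exact_mod_cast hP4
  set δ₂ := (1 / (4 * (P : ℝ))) ^ d / d.factorial * β / (8 * N * K) with hδ₂
  have hδ₂0 : 0 < δ₂ := by positivity
  set δ₀ := min (η / 2) δ₂ with hδ₀
  have hδ₀0 : 0 < δ₀ := lt_min (by positivity) hδ₂0
  have hlarge : Tendsto (fun n : ℕ => (n : ℝ)) atTop atTop := tendsto_natCast_atTop_atTop
  refine ⟨δ₀ / 2, by positivity, ?_⟩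
  filter_upwards [eventually_ge_atTop (4 * N * P), eventually_ge_atTop 1,
    hlarge.eventually_ge_atTop (8 * N * K / β), hlarge.eventually_ge_atTop (2 / δ₀)]
    with n hn hn1 hnJ hnδ
  have hn1' : (1 : ℝ) ≤ n := by exact_mod_cast hn1
  set q := n / P with hq
  have hP0 : 0 < P := by omega
  have hqn : q * P ≤ n := Nat.div_mul_le_self n P
  have hq4 : 4 * N ≤ q := by
    rw [hq, Nat.le_div_iff_mul_le hP0]
    exact hn
  have hnq : n < (q + 1) * P := by
    rw [mul_comm, hq]
    exact Nat.lt_mul_div_succ n hP0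
  -- rounded up, so that the length of the tubes is a multiple of `N` and the urn phase is not longer
  -- than `q`
  set J := (n - q + (N - 1)) / N with hJ
  have hqn' : 4 * q ≤ n := le_trans (by rw [mul_comm]; exact Nat.mul_le_mul_left _ hP4) hqn
  have hJ1 : N * J ≤ n - q + (N - 1) := Nat.mul_div_le _ _
  have hJ2 : n - q ≤ N * J := by
    have := Nat.lt_mul_div_succ (n - q + (N - 1)) (show 0 < N by omega)
    rw [← hJ, mul_add, mul_one] at this
    omega
  set m := n - N * J with hm
  have hmn : m + N * J = n := by omega
  have hmq : m ≤ q := by omega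
  have hmlow : q ≤ m + N := by omega
  have hmP : m * P ≤ n := (Nat.mul_le_mul_right P hmq).trans hqn
  have hmnr : (m : ℝ) + N * J = n := by exact_mod_cast hmn
  -- the tubes only have to make up for the urn phase
  have hspeed : (μ - ε) * n + 2 * (η * n) ≤ (μ - η) * (N * J) := by
    have h1 : |μ - η| * m ≤ η * n := by
      have h2 : |μ - η| ≤ η * P := by
        have := (div_lt_iff₀ hη0).1 hi₀μ
        rw [hP]; push_cast
        linarith
      have h3 : (m : ℝ) * P ≤ n := by exact_mod_cast hmP
      calc |μ - η| * m ≤ η * P * m := by gcongr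
        _ = η * (m * P) := by ring
        _ ≤ η * n := by gcongr
    have h4 : (μ - η) * m ≤ η * n :=
      (mul_le_mul_of_nonneg_right (le_abs_self _) (Nat.cast_nonneg m)).trans h1
    have h5 : (N : ℝ) * J = n - m := by linarith
    have h6 : ε = 8 * η := by rw [hη]; ring
    rw [h5, h6]
    nlinarith [mul_pos hη0 (show (0 : ℝ) < n by linarith)]
  have hJlow : (n : ℝ) ≤ 2 * (N * J) := by
    have : n ≤ 2 * (N * J) := by omega
    exact_mod_cast this
  have hβJ : 4 * (K : ℝ) ≤ β * J := by
    rw [div_le_iff₀ hβ0] at hnJ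
    have h1 : (n : ℝ) * β ≤ 2 * (N * J) * β := by gcongr
    have h2 : (N : ℝ) * (8 * K) ≤ N * (2 * (β * J)) := by linarith
    have := le_of_mul_le_mul_left h2 (by linarith)
    linarith
  have hcardlow : (n : ℝ) ^ d * ((1 / (4 * (P : ℝ))) ^ d / d.factorial) ≤ (simplex d m).card := by
    have h1 : n ≤ (m + 1) * (4 * P) := by
      have : q + 1 ≤ 4 * (m + 1) := by omega
      calc n ≤ (q + 1) * P := hnq.le
        _ ≤ 4 * (m + 1) * P := Nat.mul_le_mul_right _ this
        _ = _ := by ring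
    have h1' : (n : ℝ) * (1 / (4 * P)) ≤ m + 1 := by
      rw [mul_one_div, div_le_iff₀ (by positivity)]
      exact_mod_cast h1
    have h2 : ((m : ℝ) + 1) ^ d ≤ d.factorial * (simplex d m).card := by
      exact_mod_cast pow_le_card_simplex d m
    rw [mul_div_assoc', div_le_iff₀ (by positivity), ← mul_pow, mul_comm _ (d.factorial : ℝ)]
    exact le_trans (by gcongr) h2
  have hC : ∀ S : Finset (Site d), (simplex d m).card ≤ 2 * S.card →
      iidLaw (Bond d) ν {w | ∀ z ∈ S, pathMax (paths d (N * J)) w z m ≤ (μ - η) * (N * J)} ≤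
        ENNReal.ofReal ρ ^ (((simplex d m).card + 2 * K - 1) / (2 * K) * J) := by
    intro S hS
    obtain ⟨s, hs, hle⟩ := htube S m J
    refine hle.trans ?_
    have h1 : ENNReal.ofReal ρ ≤ 1 := by
      rw [← ENNReal.ofReal_one]; exact ENNReal.ofReal_le_ofReal hρ1.le
    refine pow_le_pow_right_of_le_one' h1 (Nat.mul_le_mul_right _ ?_)
    have h2 : (simplex d m).card ≤ 2 * K * s := by
      calc _ ≤ 2 * S.card := hS
        _ ≤ 2 * (K * s) := by omega
        _ = _ := by ring
    rw [← Nat.lt_succ_iff, Nat.div_lt_iff_lt_mul (by omega)]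
    have h3 : s.succ * (2 * K) = 2 * K * s + 2 * K := by rw [Nat.succ_eq_add_one]; ring
    omega
  have hsplit := measure_low_le_of_split (ν := ν) hd hmn (t := η * n) (by positivity) hspeed hC
  have hpow := two_pow_mul_pow_le (K := K) (s := ((simplex d m).card + 2 * K - 1) / (2 * K))
    (J := J) (M := (simplex d m).card) hK1 hρβ hβ0 (by
      have := Nat.lt_mul_div_succ ((simplex d m).card + 2 * K - 1) (show 0 < 2 * K by omega)
      rw [← mul_assoc]
      rw [mul_add, mul_one] at this
      omega) hβJ
  have hu := hurn i₀ hi₀ n m hmP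
  refine hsplit.trans ((add_le_add hu hpow).trans ?_)
  rw [← ENNReal.ofReal_add (Real.exp_pos _).le (Real.exp_pos _).le]
  refine ENNReal.ofReal_le_ofReal ?_
  have hnp : (0 : ℝ) < (n : ℝ) ^ (d + 1) := by positivity
  have h1 : Real.exp (-(η / 2 * (n : ℝ) ^ (d + 1))) ≤ Real.exp (-(δ₀ * (n : ℝ) ^ (d + 1))) := by
    refine Real.exp_le_exp.2 (neg_le_neg ?_)
    gcongr
    exact min_le_left _ _
  have h2 : Real.exp (-((simplex d m).card * (β * J) / (4 * K))) ≤
      Real.exp (-(δ₀ * (n : ℝ) ^ (d + 1))) := by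
    refine Real.exp_le_exp.2 (neg_le_neg ?_)
    calc δ₀ * (n : ℝ) ^ (d + 1) ≤ δ₂ * (n : ℝ) ^ (d + 1) := by
          gcongr
          exact min_le_right _ _
      _ = ((n : ℝ) ^ d * ((1 / (4 * (P : ℝ))) ^ d / d.factorial)) * (β * (n / (2 * N))) /
          (4 * K) := by
          rw [hδ₂, pow_succ]
          exact rate_rearrange _ _ _ _ (by positivity) (by positivity)
      _ ≤ (simplex d m).card * (β * J) / (4 * K) := by
          refine div_le_div_of_nonneg_right (mul_le_mul hcardlow ?_ (by positivity)
            (Nat.cast_nonneg _)) (by linarith)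
          refine mul_le_mul_of_nonneg_left ?_ hβ0.le
          rw [div_le_iff₀ (by linarith)]
          linarith
  have h3 : 2 * Real.exp (-(δ₀ * (n : ℝ) ^ (d + 1))) ≤
      Real.exp (-(δ₀ / 2 * (n : ℝ) ^ (d + 1))) := by
    have h4 : 1 ≤ δ₀ / 2 * (n : ℝ) ^ (d + 1) := by
      rw [div_le_iff₀ hδ₀0] at hnδ
      have h5 : (n : ℝ) ≤ (n : ℝ) ^ (d + 1) := le_self_pow₀ hn1' (by omega)
      nlinarith
    have h6 : (2 : ℝ) ≤ Real.exp (δ₀ / 2 * (n : ℝ) ^ (d + 1)) := by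
      linarith [Real.add_one_le_exp (δ₀ / 2 * (n : ℝ) ^ (d + 1))]
    calc 2 * Real.exp (-(δ₀ * (n : ℝ) ^ (d + 1))) ≤
          Real.exp (δ₀ / 2 * (n : ℝ) ^ (d + 1)) * Real.exp (-(δ₀ * (n : ℝ) ^ (d + 1))) := by gcongr
      _ = _ := by
          rw [← Real.exp_add]
          ring_nf
  linarith

end LPP

namespace LPP

variable {d : ℕ} {ν : Measure ℝ} [IsProbabilityMeasure ν]

/-! ### The barrier when the weights are not summable -/

/-- The edges at times before `m` that can be reached from the origin. -/
noncomputable def coneBonds (d m : ℕ) : Finset (Bond d) := by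
  classical exact (Finset.range m).biUnion fun k => siteBox 0 k ×ˢ ({k} ×ˢ Finset.univ)

theorem mem_coneBonds {m : ℕ} {e : Bond d} :
    e ∈ coneBonds d m ↔ lvl e < m ∧ e.1 ∈ siteBox 0 (lvl e) := by
  simp only [coneBonds, Finset.mem_biUnion, Finset.mem_range, Finset.mem_product,
    Finset.mem_singleton, Finset.mem_univ, and_true, lvl]
  constructor
  · rintro ⟨k, hk, h1, rfl⟩
    exact ⟨hk, h1⟩
  · rintro ⟨h1, h2⟩
    exact ⟨_, h1, h2, rfl⟩

theorem sum_coneBonds (m : ℕ) (g : ℕ → ℝ) :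
    ∑ e ∈ coneBonds d m, g (lvl e) = ∑ k ∈ Finset.range m, ((2 * k + 1) ^ d * (d * 2) : ℝ) * g k := by
  classical
  unfold coneBonds
  rw [Finset.sum_biUnion]
  · refine Finset.sum_congr rfl fun k _ => ?_
    have : ∀ e ∈ siteBox (0 : Site d) k ×ˢ ({k} ×ˢ (Finset.univ : Finset (Dir d))),
        g (lvl e) = g k := by
      intro e he
      simp only [Finset.mem_product, Finset.mem_singleton] at he
      rw [lvl, he.2.1]
    rw [Finset.sum_congr rfl this, Finset.sum_const, nsmul_eq_mul]
    simp [card_siteBox]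
  · intro k _ k' _ hne
    rw [Function.onFun, Finset.disjoint_left]
    intro e he he'
    simp only [Finset.mem_product, Finset.mem_singleton] at he he'
    exact hne (he.2.1.symm.trans he'.2.1)

theorem pathSum_le_neg_sum {w : Bond d → ℝ} {h : ℕ → ℝ} {m : ℕ}
    (hw : ∀ e ∈ coneBonds d m, w e < -h (lvl e)) (l : List (Dir d)) :
    ∀ (x : Site d) (k : ℕ), (∀ i, |x i| ≤ k) → k + l.length ≤ m →
      pathSum w x k l ≤ -∑ j ∈ Finset.Ico k (k + l.length), h j := by
  induction l with
  | nil => intro x k _ _; simp [pathSum]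
  | cons c l ih =>
    intro x k hx hk
    simp only [List.length_cons] at hk ⊢
    have h1 := hw (x, k, c) (mem_coneBonds.2 ⟨by simp only [lvl]; omega, by
      rw [mem_siteBox]; simpa [lvl] using hx⟩)
    have h2 := ih (x + stepVec c) (k + 1) (fun i => ?_) (by omega)
    · rw [Finset.sum_eq_sum_Ico_succ_bot (by omega), pathSum]
      have h3 : k + 1 + l.length = k + (l.length + 1) := by ring
      rw [h3] at h2
      have h5 : lvl (x, k, c) = k := rfl
      rw [h5] at h1
      linarith
    · have h3 := abs_add_le (x i) (stepVec c i)
      have h4 := abs_stepVec_le c i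
      have h5 := hx i
      rw [Pi.add_apply]
      push_cast
      linarith

/-- On the barrier, a path pays for crossing the first `m` levels. -/
theorem pathMax_le_of_barrier (hd : 1 ≤ d) {w : Bond d → ℝ} {h : ℕ → ℝ} {n m r : ℕ}
    (hn : m + r = n) (hw : ∀ e ∈ coneBonds d m, w e < -h (lvl e)) {b : ℝ}
    (hb : ∀ x ∈ siteBox (0 : Site d) m, pathMax (paths d r) w x m ≤ b) :
    pathMax (paths d n) w 0 0 ≤ b - ∑ k ∈ Finset.range m, h k := by
  refine pathMax_le (paths_nonempty hd n) fun l hl => ?_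
  rw [mem_paths] at hl
  have hl1 : (l.take m).length = m := by rw [List.length_take]; omega
  have hl2 : (l.drop m).length = r := by rw [List.length_drop]; omega
  have h1 := pathSum_append w (l.take m) (l.drop m) 0 0
  rw [List.take_append_drop, hl1, zero_add, zero_add] at h1
  have h2 := pathSum_le_neg_sum hw (l.take m) 0 0 (by simp) (by omega)
  rw [hl1, zero_add, ← Finset.range_eq_Ico] at h2
  have h3 := hb (disp (l.take m)) (by
    rw [mem_siteBox]
    intro i
    have := abs_disp_le (l.take m) i
    rw [hl1] at this
    simpa using this)
  have h4 := pathSum_le_pathMax (A := paths d r) (l := l.drop m) (by simpa using hl2) w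
    (disp (l.take m)) m
  linarith

/-- The cost of a barrier of height `h k` on all the edges of level `k` that the origin can reach. -/
theorem measure_barrier (m : ℕ) (h C : ℕ → ℝ)
    (hC : ∀ k < m, ν (Set.Iio (-h k)) = ENNReal.ofReal (Real.exp (-C k))) :
    iidLaw (Bond d) ν {w | ∀ e ∈ coneBonds d m, w e < -h (lvl e)} =
      ENNReal.ofReal (Real.exp (-∑ k ∈ Finset.range m,
        ((2 * k + 1) ^ d * (d * 2) : ℝ) * C k)) := by
  have h1 : {w : Bond d → ℝ | ∀ e ∈ coneBonds d m, w e < -h (lvl e)} =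
      Set.pi (coneBonds d m) (fun e => Set.Iio (-h (lvl e))) := by
    ext w
    simp [Set.mem_pi]
  rw [h1, Measure.infinitePi_pi _ (fun _ _ => measurableSet_Iio),
    Finset.prod_congr rfl fun e he => hC _ (mem_coneBonds.1 he).1,
    ← ENNReal.ofReal_prod_of_nonneg fun _ _ => (Real.exp_pos _).le, ← Real.exp_sum,
    Finset.sum_neg_distrib, sum_coneBonds]

/-- With probability at least `1 / 2` no path after time `m` is faster than `|μ| + 2`. -/
theorem eventually_half_le_measure (hd : 1 ≤ d) {c : ℝ} (hc : 0 < c)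
    (hν : Integrable (fun x => Real.exp (c * |x|)) ν) {μ : ℝ}
    (hμ : Tendsto (fun n : ℕ => meanMax d ν n / n) atTop (𝓝 μ)) :
    ∀ᶠ r : ℕ in atTop, ∀ m ≤ r, 1 / 2 ≤ iidLaw (Bond d) ν
      {w | ∀ x ∈ siteBox (0 : Site d) m, pathMax (paths d r) w x m ≤ (|μ| + 2) * r} := by
  obtain ⟨u, hu, h⟩ := pathMax_concentration (d := d) hc hν zero_lt_one
  have hlim := (hu d).const_mul ((3 : ℝ) ^ d)
  rw [mul_zero] at hlim
  filter_upwards [h, hlim.eventually_lt_const (by norm_num : (0 : ℝ) < 1 / 2),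
    eventually_ge_atTop 1, hμ.eventually_lt_const (show μ < |μ| + 1 by linarith [le_abs_self μ])]
    with r hr hr2 hr1 hrμ m hm
  have hr1' : (1 : ℝ) ≤ r := by exact_mod_cast hr1
  rw [div_lt_iff₀ (by linarith)] at hrμ
  set U := {w : Bond d → ℝ | ∀ x ∈ siteBox (0 : Site d) m,
    pathMax (paths d r) w x m ≤ (|μ| + 2) * r} with hU
  have hUm : MeasurableSet U := by
    rw [hU]
    simp only [Set.ofPred_forall]
    exact MeasurableSet.iInter fun x => MeasurableSet.iInter fun _ =>
      measurableSet_le (measurable_pathMax _ x m) measurable_const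
  have hsub : Uᶜ ⊆ ⋃ x ∈ siteBox (0 : Site d) m, {w | 1 * (r : ℝ) ≤
      |pathMax (paths d r) w x m - ∫ w, pathMax (paths d r) w 0 0 ∂(iidLaw (Bond d) ν)|} := by
    intro w hw
    simp only [hU, Set.mem_compl_iff, Set.mem_ofPred_eq, not_forall, not_le] at hw
    obtain ⟨x, hx, hlt⟩ := hw
    refine Set.mem_biUnion hx ?_
    simp only [Set.mem_ofPred_eq]
    refine le_trans ?_ (le_abs_self _)
    have : ∫ w, pathMax (paths d r) w 0 0 ∂(iidLaw (Bond d) ν) = meanMax d ν r := rfl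
    rw [this]
    linarith
  have hcompl : (iidLaw (Bond d) ν).real Uᶜ ≤ 1 / 2 := by
    refine (measureReal_mono hsub (measure_ne_top _ _)).trans ((measureReal_biUnion_finset_le _ _).trans ?_)
    refine (Finset.sum_le_sum fun x _ => hr _ (paths_nonempty hd r) (by simp) x m).trans ?_
    rw [Finset.sum_const, card_siteBox, nsmul_eq_mul]
    refine le_trans ?_ hr2.le
    have hu0 : 0 ≤ u r := measureReal_nonneg.trans
      (hr _ (paths_nonempty hd r) (by simp) 0 0)
    rw [← mul_assoc, ← mul_pow]
    have hmr : (m : ℝ) ≤ r := by exact_mod_cast hm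
    push_cast
    gcongr
    linarith
  rw [probReal_compl_eq_one_sub hUm] at hcompl
  have h2 : (1 / 2 : ℝ) ≤ (iidLaw (Bond d) ν).real U := by linarith
  have h3 := ENNReal.ofReal_le_ofReal h2
  rw [ofReal_measureReal (measure_ne_top _ _)] at h3
  refine le_trans (le_of_eq ?_) h3
  rw [ENNReal.ofReal_div_of_pos (by norm_num)]
  norm_num

/-- The barrier is independent of the field after it, so that it occurs together with the typical
behaviour afterwards. -/
theorem measure_low_ge_of_barrier (hd : 1 ≤ d) {n m r : ℕ} (hn : m + r = n) (h C : ℕ → ℝ)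
    (hC : ∀ k < m, ν (Set.Iio (-h k)) = ENNReal.ofReal (Real.exp (-C k))) {b v : ℝ}
    (hhalf : 1 / 2 ≤ iidLaw (Bond d) ν
      {w | ∀ x ∈ siteBox (0 : Site d) m, pathMax (paths d r) w x m ≤ b})
    (hv : b - ∑ k ∈ Finset.range m, h k ≤ v) :
    ENNReal.ofReal (Real.exp (-∑ k ∈ Finset.range m,
        ((2 * k + 1) ^ d * (d * 2) : ℝ) * C k)) * (1 / 2) ≤
      iidLaw (Bond d) ν {w | pathMax (paths d n) w 0 0 ≤ v} := by
  rw [← measure_barrier (ν := ν) m h C hC]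
  refine (mul_le_mul' le_rfl hhalf).trans ?_
  rw [← measure_inter_of_dependsOn (S := {e | lvl e < m}) (T := {e | m ≤ lvl e})]
  · refine measure_mono fun w hw => ?_
    exact (pathMax_le_of_barrier hd hn hw.1 hw.2).trans hv
  · rw [Set.disjoint_left]
    intro e h1 h2
    simp only [Set.mem_ofPred_eq] at h1 h2
    omega
  · simp only [Set.ofPred_forall]
    exact MeasurableSet.biInter (coneBonds d m).countable_toSet fun e _ =>
      measurableSet_lt (measurable_pi_apply e) measurable_const
  · simp only [Set.ofPred_forall]
    exact MeasurableSet.iInter fun x => MeasurableSet.iInter fun _ =>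
      measurableSet_le (measurable_pathMax _ x m) measurable_const
  · intro w w' hww
    simp only [Set.mem_ofPred_eq, eq_iff_iff]
    refine forall₂_congr fun e he => ?_
    rw [hww e (mem_coneBonds.1 he).1]
  · intro w w' hww
    simp only [Set.mem_ofPred_eq, eq_iff_iff]
    refine forall₂_congr fun x _ => ?_
    have := (levelLip_pathMax (paths_nonempty hd r) (n := r) (by simp) x m).dependsOn
      (x := w) (y := w') (fun e he => hww e (by
        have := he.2
        rw [Finset.mem_Ico] at this
        exact this.1))
    rw [this]

/-- The scales `i` in `[i₀, i₁)` contribute to a sum over levels in proportion to `2 ^ (-i)`. -/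
theorem le_sum_log_div {T : ℕ → ℝ} (hT : ∀ i, 0 ≤ T i) {n i₀ i₁ : ℕ} (hn : 2 ^ (i₁ + 1) ≤ n) :
    n / 4 * ∑ i ∈ Finset.Ico i₀ i₁, T i / 2 ^ i ≤
      ∑ k ∈ Finset.range (n / 2 ^ i₀), T (Nat.log 2 (n / (k + 1))) := by
  have h1 : ∀ i ∈ Finset.Ico i₀ i₁, (n : ℝ) / 4 * (T i / 2 ^ i) ≤
      ∑ k ∈ (Finset.range (n / 2 ^ i₀)).filter (fun k => Nat.log 2 (n / (k + 1)) = i),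
        T (Nat.log 2 (n / (k + 1))) := by
    intro i hi
    rw [Finset.mem_Ico] at hi
    rw [Finset.sum_congr rfl fun k hk => by rw [(Finset.mem_filter.1 hk).2], Finset.sum_const,
      nsmul_eq_mul, mul_div_assoc', mul_div_right_comm]
    refine mul_le_mul_of_nonneg_right ?_ (hT i)
    have hsub : Finset.Ico (n / 2 ^ (i + 1)) (n / 2 ^ i) ⊆
        (Finset.range (n / 2 ^ i₀)).filter (fun k => Nat.log 2 (n / (k + 1)) = i) := by
      intro k hk
      rw [Finset.mem_Ico] at hk
      rw [Finset.mem_filter, Finset.mem_range]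
      constructor
      · exact hk.2.trans_le (Nat.div_le_div_left (Nat.pow_le_pow_right (by norm_num) hi.1)
          (by positivity))
      · have h2 : 2 ^ i ≤ n / (k + 1) := by
          rw [Nat.le_div_iff_mul_le (Nat.succ_pos k), mul_comm,
            ← Nat.le_div_iff_mul_le (by positivity)]
          exact hk.2
        have h3 : n / (k + 1) < 2 ^ (i + 1) := by
          rw [Nat.div_lt_iff_lt_mul (Nat.succ_pos k), mul_comm,
            ← Nat.div_lt_iff_lt_mul (by positivity)]
          exact Nat.lt_succ_of_le hk.1
        exact Nat.log_eq_of_pow_le_of_lt_pow h2 h3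
    have h2 := Finset.card_le_card hsub
    rw [Nat.card_Ico] at h2
    have h3 : n / 2 ^ (i + 1) ≤ n / 2 ^ i :=
      Nat.div_le_div_left (Nat.pow_le_pow_right (by norm_num) (by omega)) (by positivity)
    have h4 : ((n / 2 ^ i : ℕ) : ℝ) - (n / 2 ^ (i + 1) : ℕ) ≤
        (((Finset.range (n / 2 ^ i₀)).filter
          (fun k => Nat.log 2 (n / (k + 1)) = i)).card : ℝ) := by
      rw [← Nat.cast_sub h3]
      exact_mod_cast h2
    have h5 : ((n / 2 ^ (i + 1) : ℕ) : ℝ) ≤ n / 2 ^ (i + 1) := by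
      have := @Nat.cast_div_le ℝ _ _ _ n (2 ^ (i + 1))
      push_cast at this
      exact this
    have h6 : (n : ℝ) / 2 ^ i < (n / 2 ^ i : ℕ) + 1 := by
      rw [div_lt_iff₀ (by positivity)]
      have := Nat.lt_mul_div_succ n (show 0 < 2 ^ i by positivity)
      rw [mul_comm] at this
      exact_mod_cast this
    have h7 : (n : ℝ) / 2 ^ i = 2 * (n / 2 ^ (i + 1)) := by
      rw [pow_succ]; field_simp
    have h8 : 1 ≤ (n : ℝ) / 4 / 2 ^ i := by
      rw [le_div_iff₀ (by positivity), le_div_iff₀ (by norm_num), one_mul]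
      have h9 : 2 ^ i * 4 ≤ n := by
        refine le_trans ?_ hn
        calc 2 ^ i * 4 = 2 ^ (i + 2) := by rw [pow_add]; norm_num
          _ ≤ 2 ^ (i₁ + 1) := Nat.pow_le_pow_right (by norm_num) (by omega)
      exact_mod_cast h9
    have h10 : (n : ℝ) / 4 / 2 ^ i = n / 2 ^ (i + 1) / 2 := by
      rw [pow_succ]; field_simp; norm_num
    linarith
  rw [Finset.mul_sum]
  refine (Finset.sum_le_sum h1).trans ?_
  rw [← Finset.sum_biUnion]
  · refine Finset.sum_le_sum_of_subset_of_nonneg ?_ fun k _ _ => hT _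
    intro k hk
    simp only [Finset.mem_biUnion, Finset.mem_filter] at hk
    obtain ⟨_, _, h, _⟩ := hk
    exact h
  · intro i _ j _ hij
    rw [Function.onFun, Finset.disjoint_left]
    intro k hk hk'
    exact hij ((Finset.mem_filter.1 hk).2.symm.trans (Finset.mem_filter.1 hk').2)

/-- Without summability every exponential rate at speed `n ^ (d + 1)` is eventually exceeded. -/
theorem exp_le_measure_low (hd : 1 ≤ d) {c : ℝ} (hc : 0 < c)
    (hν : Integrable (fun x => Real.exp (c * |x|)) ν) {μ : ℝ}
    (hμ : Tendsto (fun n : ℕ => meanMax d ν n / n) atTop (𝓝 μ))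
    {M₀ : ℝ} (hM₀ : 0 < M₀) {f : ℝ → ℝ}
    (hfpos : ∀ x, 0 < x → 0 < f x) (hfmono : MonotoneOn f (Set.Ioi M₀))
    (htail : ∀ x : ℝ, x < -M₀ → Real.log (ν.real (Set.Iio x)) = -((-x) ^ (d + 1) * f (-x)))
    (hsum : ¬ Summable (scaleWeight d f)) {ε : ℝ} (hε : 0 < ε) {δ : ℝ} (hδ : 0 < δ) :
    ∀ᶠ n : ℕ in atTop, ENNReal.ofReal (Real.exp (-(δ * (n : ℝ) ^ (d + 1)))) ≤
      iidLaw (Bond d) ν {w | pathMax (paths d n) w 0 0 ≤ (μ - ε) * n} := by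
  set g := scaleWeight d f with hg
  have hgpos : ∀ i, 0 < g i := scaleWeight_pos hfpos
  set M₁ := M₀ + 1 with hM₁
  set K₀ := M₁ ^ (d + 1) * f M₁ with hK₀
  have hfM₁ : 0 < f M₁ := hfpos _ (by linarith)
  have hK₀0 : 0 < K₀ := mul_pos (pow_pos (by linarith) _) hfM₁
  set Cd : ℝ := 2 ^ d * (d * 2) with hCd
  have hd0 : (0 : ℝ) < d := by exact_mod_cast hd
  have hCd0 : 0 < Cd := by positivity
  set B := 4 * (2 * |μ| + 2 + ε) with hB
  have hB0 : 0 < B := by positivity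
  -- the number of omitted scales, then the number of used scales
  obtain ⟨i₀, hi₀1, hi₀M, hi₀K⟩ : ∃ i₀ : ℕ, 1 ≤ i₀ ∧ M₀ < 2 ^ i₀ ∧
      8 * Cd * K₀ / δ < 2 ^ i₀ :=
    ((eventually_ge_atTop 1).and
      (((tendsto_pow_atTop_atTop_of_one_lt (by norm_num : (1 : ℝ) < 2)).eventually_gt_atTop _).and
      ((tendsto_pow_atTop_atTop_of_one_lt (by norm_num : (1 : ℝ) < 2)).eventually_gt_atTop
        _))).exists
  have hdiv := (not_summable_iff_tendsto_nat_atTop_of_nonneg fun i => (hgpos i).le).1 hsum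
  obtain ⟨i₁, hi₁, hS⟩ : ∃ i₁ : ℕ, i₀ ≤ i₁ ∧
      1 + B * g i₀ + 4 * Cd * B ^ (d + 1) / δ + ∑ i ∈ Finset.range i₀, g i ≤
      ∑ i ∈ Finset.range i₁, g i :=
    ((eventually_ge_atTop i₀).and (hdiv.eventually_ge_atTop _)).exists
  set S := ∑ i ∈ Finset.Ico i₀ i₁, g i with hSdef
  have hS' : 1 + B * g i₀ + 4 * Cd * B ^ (d + 1) / δ ≤ S := by
    have := Finset.sum_range_add_sum_Ico g hi₁
    linarith
  have hpos1 : 0 < B * g i₀ := mul_pos hB0 (hgpos i₀)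
  have hpos2 : 0 < 4 * Cd * B ^ (d + 1) / δ := by positivity
  have hS1 : 1 ≤ S := by linarith
  set A := B / S with hA
  have hA0 : 0 < A := by positivity
  have hgmono : ∀ i, i₀ ≤ i → g i ≤ g i₀ := by
    intro i hi
    have h2 : (2 : ℝ) ^ i₀ ≤ 2 ^ i := pow_le_pow_right₀ (by norm_num) hi
    have h3 := hfmono hi₀M (hi₀M.trans_le h2) h2
    have h4 := hfpos (2 ^ i₀) (by positivity)
    simp only [hg, scaleWeight]
    gcongr
  have hAg : ∀ i, i₀ ≤ i → A * g i ≤ 1 := by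
    intro i hi
    rw [hA, div_mul_eq_mul_div, div_le_one (by linarith)]
    have := mul_le_mul_of_nonneg_left (hgmono i hi) hB0.le
    linarith
  -- The height at scale `i` is proportional to `2 ^ i g i`, for which cost and reward of the scale are
  -- both proportional to `g i`; `A` makes the reward a fixed multiple of `n`, and the total cost is of
  -- order `A ^ (d + 1) S`, hence small for large `S`. Below `M₁` the tail is unknown.
  set Hh : ℕ → ℝ := fun i => max M₁ (if i < i₁ then A * 2 ^ i * g i else 0) with hHh
  have hHM : ∀ i, M₀ < Hh i := fun i => lt_of_lt_of_le (by linarith) (le_max_left _ _)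
  have hcost : ∀ i, i₀ ≤ i → Hh i ^ (d + 1) * f (Hh i) ≤
      K₀ + if i < i₁ then A ^ (d + 1) * (2 ^ i) ^ (d + 1) * g i else 0 := by
    intro i hi
    have hnn : 0 ≤ if i < i₁ then A ^ (d + 1) * (2 ^ i) ^ (d + 1) * g i else 0 := by
      have := (hgpos i).le
      split_ifs <;> positivity
    rcases max_choice M₁ (if i < i₁ then A * 2 ^ i * g i else 0) with h | h
    · simp only [hHh, h]
      linarith
    · have hH := hHM i
      simp only [hHh, h] at hH ⊢
      by_cases h1 : i < i₁
      · simp only [if_pos h1] at hH ⊢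
        have h2 : A * 2 ^ i * g i ≤ 2 ^ i := by
          have := mul_le_mul_of_nonneg_right (hAg i hi) (show (0 : ℝ) ≤ 2 ^ i by positivity)
          linarith
        have h3 := hfmono (show A * 2 ^ i * g i ∈ Set.Ioi M₀ from hH)
          (show (2 : ℝ) ^ i ∈ Set.Ioi M₀ from lt_of_lt_of_le hH h2) h2
        have h4 := hgpos i
        calc (A * 2 ^ i * g i) ^ (d + 1) * f (A * 2 ^ i * g i)
            ≤ (A * 2 ^ i * g i) ^ (d + 1) * f (2 ^ i) := by gcongr
          _ = A ^ (d + 1) * (2 ^ i) ^ (d + 1) * g i * (g i ^ d * f (2 ^ i)) := by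
              rw [mul_pow, mul_pow]; ring
          _ = A ^ (d + 1) * (2 ^ i) ^ (d + 1) * g i := by
              rw [hg, scaleWeight_pow hd hfpos, mul_one]
          _ ≤ _ := by linarith
      · rw [if_neg h1] at hH
        linarith
  have hr : ∀ᶠ n : ℕ in atTop, ∀ m ≤ n - n / 2 ^ i₀, 1 / 2 ≤ iidLaw (Bond d) ν
      {w | ∀ x ∈ siteBox (0 : Site d) m, pathMax (paths d (n - n / 2 ^ i₀)) w x m ≤
        (|μ| + 2) * (n - n / 2 ^ i₀ : ℕ)} := by
    have ht : Tendsto (fun n : ℕ => n - n / 2 ^ i₀) atTop atTop := by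
      refine tendsto_atTop_mono (f := fun n : ℕ => n / 2) (fun n => ?_)
        (Nat.tendsto_div_const_atTop (by norm_num))
      have h1 : n / 2 ^ i₀ ≤ n / 2 ^ 1 :=
        Nat.div_le_div_left (Nat.pow_le_pow_right (by norm_num) hi₀1) (by norm_num)
      simp only [pow_one] at h1
      omega
    exact ht.eventually (eventually_half_le_measure hd hc hν hμ)
  have hlarge : Tendsto (fun n : ℕ => (n : ℝ)) atTop atTop := tendsto_natCast_atTop_atTop
  filter_upwards [hr, eventually_ge_atTop (2 ^ (i₁ + 1)), eventually_ge_atTop 1,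
    hlarge.eventually_ge_atTop (2 / δ)] with n hn hni₁ hn1 hnδ
  have hn1' : (1 : ℝ) ≤ n := by exact_mod_cast hn1
  set m := n / 2 ^ i₀ with hm
  have hm2 : m ≤ n - m := by
    have h1 : n / 2 ^ i₀ ≤ n / 2 ^ 1 :=
      Nat.div_le_div_left (Nat.pow_le_pow_right (by norm_num) hi₀1) (by norm_num)
    simp only [pow_one] at h1
    omega
  have hmn : m + (n - m) = n := by omega
  have hmP : m * 2 ^ i₀ ≤ n := Nat.div_mul_le_self n _
  set hgt : ℕ → ℝ := fun k => Hh (Nat.log 2 (n / (k + 1))) with hhgt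
  have hreward : (|μ| + 2) * (n - m : ℕ) - ∑ k ∈ Finset.range m, hgt k ≤ (μ - ε) * n := by
    have hT0 : ∀ i, 0 ≤ if i < i₁ then A * 2 ^ i * g i else 0 := fun i => by
      have := (hgpos i).le
      split_ifs <;> positivity
    have h1 := le_sum_log_div (T := fun i => if i < i₁ then A * 2 ^ i * g i else 0) hT0
      (i₀ := i₀) hni₁
    have h2 : ∑ i ∈ Finset.Ico i₀ i₁, (if i < i₁ then A * 2 ^ i * g i else 0) / 2 ^ i = B := by
      have : ∀ i ∈ Finset.Ico i₀ i₁, (if i < i₁ then A * 2 ^ i * g i else 0) / 2 ^ i =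
          A * g i := by
        intro i hi
        rw [if_pos (Finset.mem_Ico.1 hi).2]
        field_simp
      rw [Finset.sum_congr rfl this, ← Finset.mul_sum, ← hSdef, hA, div_mul_cancel₀ _ (by linarith)]
    rw [h2] at h1
    have h3 : ∑ k ∈ Finset.range m, (if Nat.log 2 (n / (k + 1)) < i₁ then
        A * 2 ^ Nat.log 2 (n / (k + 1)) * g (Nat.log 2 (n / (k + 1))) else 0) ≤
        ∑ k ∈ Finset.range m, hgt k :=
      Finset.sum_le_sum fun k _ => le_max_right _ _
    have h4 : ((n - m : ℕ) : ℝ) ≤ n := by exact_mod_cast Nat.sub_le n m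
    have h5 : (|μ| + 2) * ((n - m : ℕ) : ℝ) ≤ (|μ| + 2) * n := by gcongr
    have h6 : (n : ℝ) / 4 * B = (2 * |μ| + 2 + ε) * n := by rw [hB]; ring
    have h7 : -(|μ| * n) ≤ μ * n := by
      have := mul_le_mul_of_nonneg_right (neg_abs_le μ) (show (0 : ℝ) ≤ n by linarith)
      linarith
    linarith
  have hlow := measure_low_ge_of_barrier (ν := ν) hd hmn hgt
    (fun k => hgt k ^ (d + 1) * f (hgt k))
    (fun k _ => measure_Iio_neg hM₀ hfpos htail (hHM _)) (hn m hm2) hreward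
  refine le_trans ?_ hlow
  set T : ℕ → ℝ := fun i => Cd * (n / 2 ^ i) ^ d *
    (K₀ + if i < i₁ then A ^ (d + 1) * (2 ^ i) ^ (d + 1) * g i else 0) with hT
  have hT0 : ∀ i, 0 ≤ T i := fun i => by
    have := (hgpos i).le
    simp only [hT]
    split_ifs <;> positivity
  have htotal : ∑ k ∈ Finset.range m, ((2 * k + 1) ^ d * (d * 2) : ℝ) *
      (hgt k ^ (d + 1) * f (hgt k)) ≤ δ / 2 * (n : ℝ) ^ (d + 1) := by
    have h1 : ∀ k ∈ Finset.range m, ((2 * k + 1) ^ d * (d * 2) : ℝ) *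
        (hgt k ^ (d + 1) * f (hgt k)) ≤ T (Nat.log 2 (n / (k + 1))) := by
      intro k hk
      rw [Finset.mem_range] at hk
      set i := Nat.log 2 (n / (k + 1)) with hi
      have hkn : k + 1 ≤ n := by omega
      have hi₀i : i₀ ≤ i := by
        refine Nat.le_log_of_pow_le (by norm_num) ?_
        rw [Nat.le_div_iff_mul_le (Nat.succ_pos k)]
        refine le_trans ?_ hmP
        rw [mul_comm]
        exact Nat.mul_le_mul_right _ hk
      have h2 := hcost i hi₀i
      have h3 : ((k : ℝ) + 1) ≤ n / 2 ^ i := by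
        rw [le_div_iff₀ (by positivity)]
        exact_mod_cast pow_log_mul_le (b := 2) hkn
      have h4 : ((2 * k + 1) ^ d * (d * 2) : ℝ) ≤ Cd * (n / 2 ^ i) ^ d := by
        calc ((2 * k + 1) ^ d * (d * 2) : ℝ) ≤ (2 * (n / 2 ^ i)) ^ d * (d * 2) := by
              gcongr
              linarith
          _ = _ := by rw [hCd, mul_pow]; ring
      simp only [hT]
      have h5 : 0 < Hh i ^ (d + 1) * f (Hh i) :=
        mul_pos (pow_pos (hM₀.trans (hHM i)) _) (hfpos _ (hM₀.trans (hHM i)))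
      exact mul_le_mul h4 h2 h5.le (by positivity)
    refine (Finset.sum_le_sum h1).trans ((sum_log_div_le (b := 2) (by norm_num) hT0 hmP).trans ?_)
    have h2 : ∀ i, T i / ((2 : ℕ) : ℝ) ^ i = Cd * (n : ℝ) ^ d *
        (K₀ * (1 / 2 ^ (d + 1)) ^ i + if i < i₁ then A ^ (d + 1) * g i else 0) := by
      intro i
      have hp : (0 : ℝ) < 2 ^ i := by positivity
      have hp2 : (1 / 2 ^ (d + 1) : ℝ) ^ i = 1 / (2 ^ i) ^ (d + 1) := by
        rw [one_div_pow, ← pow_mul, ← pow_mul, mul_comm]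
      rw [hp2]
      simp only [hT]
      push_cast
      generalize (2 : ℝ) ^ i = z at hp
      split_ifs
      · rw [div_pow, pow_succ z]
        field_simp
      · rw [div_pow, pow_succ z]
        field_simp
        ring
    have h3 : ∑ i ∈ Finset.Ico i₀ (Nat.log 2 n + 1), K₀ * (1 / 2 ^ (d + 1) : ℝ) ^ i ≤
        K₀ * (2 / 2 ^ i₀) := by
      rw [← Finset.mul_sum]
      refine mul_le_mul_of_nonneg_left ?_ hK₀0.le
      have h4 : ∀ i ∈ Finset.Ico i₀ (Nat.log 2 n + 1), (1 / 2 ^ (d + 1) : ℝ) ^ i ≤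
          (1 / 2 : ℝ) ^ i := by
        intro i _
        refine pow_le_pow_left₀ (by positivity) ?_ i
        refine one_div_le_one_div_of_le (by norm_num) ?_
        exact le_self_pow₀ (by norm_num) (by omega)
      refine (Finset.sum_le_sum h4).trans ?_
      rw [Finset.sum_Ico_eq_sum_range]
      simp only [pow_add]
      rw [← Finset.mul_sum, one_div_pow, div_eq_mul_one_div 2, mul_comm (2 : ℝ)]
      refine mul_le_mul_of_nonneg_left ?_ (by positivity)
      have := (summable_geometric_two).sum_le_tsum (Finset.range (Nat.log 2 n + 1 - i₀))
        (fun i _ => by positivity)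
      rwa [tsum_geometric_two] at this
    have h5 : ∑ i ∈ Finset.Ico i₀ (Nat.log 2 n + 1),
        (if i < i₁ then A ^ (d + 1) * g i else 0) ≤ A ^ (d + 1) * S := by
      rw [← Finset.sum_filter, hSdef, Finset.mul_sum]
      refine Finset.sum_le_sum_of_subset_of_nonneg ?_ fun i _ _ => by
        have := (hgpos i).le
        positivity
      intro i hi
      simp only [Finset.mem_filter, Finset.mem_Ico] at hi ⊢
      exact ⟨hi.1.1, hi.2⟩
    have h6 : A ^ (d + 1) * S ≤ δ / (4 * Cd) := by
      have h7 : A ^ (d + 1) * S ≤ B ^ (d + 1) / S := by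
        rw [hA, div_pow, le_div_iff₀ (by linarith), div_mul_eq_mul_div, div_mul_eq_mul_div,
          div_le_iff₀ (by positivity)]
        rw [mul_assoc]
        refine mul_le_mul_of_nonneg_left ?_ (by positivity)
        calc S * S = S ^ 2 := by ring
          _ ≤ S ^ (d + 1) := pow_le_pow_right₀ hS1 (by omega)
      refine h7.trans ?_
      rw [div_le_div_iff₀ (by linarith) (by positivity)]
      have h8 : 4 * Cd * B ^ (d + 1) / δ ≤ S := by linarith
      rw [div_le_iff₀ hδ] at h8
      linarith
    have h9 : K₀ * (2 / 2 ^ i₀) ≤ δ / (4 * Cd) := by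
      rw [div_lt_iff₀ hδ] at hi₀K
      rw [mul_div_assoc', div_le_div_iff₀ (by positivity) (by positivity)]
      linarith
    rw [Finset.sum_congr rfl fun i _ => h2 i, ← Finset.mul_sum, Finset.sum_add_distrib]
    calc (n : ℝ) * (Cd * (n : ℝ) ^ d * (∑ i ∈ Finset.Ico i₀ (Nat.log 2 n + 1),
          K₀ * (1 / 2 ^ (d + 1) : ℝ) ^ i + ∑ i ∈ Finset.Ico i₀ (Nat.log 2 n + 1),
          (if i < i₁ then A ^ (d + 1) * g i else 0)))
        ≤ (n : ℝ) * (Cd * (n : ℝ) ^ d * (δ / (4 * Cd) + δ / (4 * Cd))) := by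
          refine mul_le_mul_of_nonneg_left ?_ (by linarith)
          refine mul_le_mul_of_nonneg_left ?_ (by positivity)
          exact add_le_add (h3.trans h9) (h5.trans h6)
      _ = δ / 2 * (n : ℝ) ^ (d + 1) := by
          rw [pow_succ]
          field_simp
          ring
  have hhalf : (1 / 2 : ENNReal) = ENNReal.ofReal (1 / 2) := by
    rw [ENNReal.ofReal_div_of_pos (by norm_num)]
    norm_num
  rw [hhalf, ← ENNReal.ofReal_mul (Real.exp_pos _).le]
  refine ENNReal.ofReal_le_ofReal ?_
  have h1 : 1 ≤ δ / 2 * (n : ℝ) ^ (d + 1) := by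
    rw [div_le_iff₀ hδ] at hnδ
    have h5 : (n : ℝ) ≤ (n : ℝ) ^ (d + 1) := le_self_pow₀ hn1' (by omega)
    nlinarith
  have h2 : Real.exp (-1) ≤ 1 / 2 := by
    rw [Real.exp_neg, one_div]
    refine inv_anti₀ (by norm_num) ?_
    linarith [Real.add_one_le_exp (1 : ℝ)]
  calc Real.exp (-(δ * (n : ℝ) ^ (d + 1)))
      ≤ Real.exp (-∑ k ∈ Finset.range m, ((2 * k + 1) ^ d * (d * 2) : ℝ) *
        (hgt k ^ (d + 1) * f (hgt k))) * Real.exp (-1) := by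
        rw [← Real.exp_add]
        refine Real.exp_le_exp.2 ?_
        linarith
    _ ≤ _ := mul_le_mul_of_nonneg_left h2 (Real.exp_pos _).le

end LPP

namespace LPP

variable {d : ℕ}

/-! ### Transfer to the full lattice -/

theorem exists_stepVec {u v : Xi d} (h : IsEdge u v) : ∃ c : Dir d, v.1.1 = u.1.1 + stepVec c := by
  obtain ⟨-, i, hi | hi⟩ := h
  · exact ⟨(i, true), by simpa [stepVec] using hi⟩
  · exact ⟨(i, false), by simp [stepVec, hi, sub_eq_add_neg, Pi.single_neg]⟩

/-- The code of an edge of `Ξ`. -/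
noncomputable def toBond (e : Edge d) : Bond d :=
  (e.1.1.1.1, e.1.1.1.2, (exists_stepVec e.2).choose)

/-- The chosen direction is a step from the tail of the edge to its head. -/
theorem toBond_spec (e : Edge d) : e.1.2.1.1 = e.1.1.1.1 + stepVec (toBond e).2.2 :=
  (exists_stepVec e.2).choose_spec

theorem toBond_injective : Function.Injective (toBond (d := d)) := by
  intro e e' h
  have h1 : e.1.1 = e'.1.1 := Subtype.ext (Prod.ext (congrArg (fun b : Bond d => b.1) h)
    (congrArg (fun b : Bond d => b.2.1) h))
  have h2 : e.1.2 = e'.1.2 := by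
    refine Subtype.ext (Prod.ext ?_ ?_)
    · rw [toBond_spec, toBond_spec, h1, h]
    · rw [e.2.1, e'.2.1, h1]
  exact Subtype.ext (Prod.ext h1 h2)

theorem stepVec_injective : Function.Injective (stepVec (d := d)) := by
  rintro ⟨i, b⟩ ⟨j, b'⟩ h
  have h1 := congrFun h i
  simp only [stepVec, Pi.single_eq_same] at h1
  by_cases hij : i = j
  · subst hij
    rw [Pi.single_eq_same] at h1
    cases b <;> cases b' <;> simp_all
  · rw [Pi.single_eq_of_ne hij] at h1
    cases b <;> simp at h1

theorem disp_take_succ {l : List (Dir d)} {k : ℕ} (hk : k < l.length) :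
    disp (l.take (k + 1)) = disp (l.take k) + stepVec l[k] := by
  rw [← List.take_append_getElem hk, disp_append]
  simp [disp]

theorem pathSum_eq_sum (w : Bond d → ℝ) (l : List (Dir d)) (n : ℕ) (hn : l.length = n) :
    pathSum w 0 0 l = ∑ i : Fin n, w (disp (l.take i), i, l[i]) := by
  have key : ∀ k ≤ n, pathSum w 0 0 (l.take k) = ∑ i ∈ Finset.range k,
      if h : i < n then w (disp (l.take i), i, l[i]) else 0 := by
    intro k
    induction k with
    | zero => intro _; simp [pathSum]
    | succ k ih =>
      intro hk
      rw [Finset.sum_range_succ, ← ih (by omega), dif_pos (by omega),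
        ← List.take_append_getElem (show k < l.length by omega), pathSum_append]
      have h1 : (l.take k).length = k := by rw [List.length_take]; omega
      simp [pathSum, h1]
  have h := key n le_rfl
  rw [List.take_of_length_le hn.le] at h
  rw [h, Finset.sum_range]
  refine Finset.sum_congr rfl fun i _ => ?_
  rw [dif_pos i.2]
  rfl

/-- Paths from the origin stay in `Ξ`. -/
theorem sum_disp_emod (l : List (Dir d)) : (∑ i, |disp l i|) + (l.length : ℤ) ≡ 0 [ZMOD 2] := by
  have habs : ∀ z : ℤ, |z| ≡ z [ZMOD 2] := by
    intro z
    rcases abs_choice z with h | h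
    · rw [h]
    · rw [h, Int.ModEq]; omega
  have h1 : ∑ i, |disp l i| ≡ ∑ i, disp l i [ZMOD 2] := by
    unfold Int.ModEq
    rw [Finset.sum_int_mod, Finset.sum_int_mod (f := fun i => disp l i)]
    congr 1
    exact Finset.sum_congr rfl fun i _ => habs _
  have h2 : ∑ i, disp l i + (l.length : ℤ) ≡ 0 [ZMOD 2] := by
    induction l with
    | nil => simp [disp]
    | cons c l ih =>
      have h3 : ∑ i, stepVec c i = if c.2 then 1 else -1 := by
        simp [stepVec]
      have h4 := ih (by
        unfold Int.ModEq
        rw [Finset.sum_int_mod, Finset.sum_int_mod (f := fun i => disp l i)]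
        congr 1
        exact Finset.sum_congr rfl fun i _ => habs _)
      simp only [disp, Pi.add_apply, Finset.sum_add_distrib, h3, List.length_cons]
      unfold Int.ModEq at h4 ⊢
      push_cast
      split_ifs <;> omega
  exact (h1.add_right _).trans h2

/-- The path in `Ξ` with a given list of steps. -/
def listPath {n : ℕ} (l : List (Dir d)) (hl : l.length = n) : Path d n where
  vertex k := ⟨(disp (l.take k), k), by
    have h := sum_disp_emod (l.take k)
    have h1 : (l.take k).length = k := by
      rw [List.length_take]
      have := k.2
      omega
    rw [h1] at h
    exact h⟩
  start := by
    apply Subtype.ext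
    simp [origin, disp]
  step i := by
    refine ⟨by simp, ?_⟩
    have hi : (i : ℕ) < l.length := by rw [hl]; exact i.2
    have h := disp_take_succ hi
    simp only [Fin.val_succ, Fin.val_castSucc, h]
    refine ⟨(l[(i : ℕ)]).1, ?_⟩
    cases hc : (l[(i : ℕ)]).2
    · right
      rw [sub_eq_add_neg, ← Pi.single_neg]
      simp [stepVec, hc]
    · left
      simp [stepVec, hc]

theorem listPath_value {n : ℕ} (l : List (Dir d)) (hl : l.length = n) (w : Bond d → ℝ) :
    (listPath l hl).value (fun e => w (toBond e)) = pathSum w 0 0 l := by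
  rw [pathSum_eq_sum w l n hl, Path.value]
  refine Finset.sum_congr rfl fun i _ => ?_
  congr 1
  have hi : (i : ℕ) < l.length := by rw [hl]; exact i.2
  have h := toBond_spec ((listPath l hl).edge i)
  have h2 : disp (l.take ((i : ℕ) + 1)) =
      disp (l.take i) + stepVec (toBond ((listPath l hl).edge i)).2.2 := h
  rw [disp_take_succ hi] at h2
  have h3 := stepVec_injective (add_left_cancel h2)
  refine Prod.ext rfl (Prod.ext rfl h3.symm)

theorem Path.exists_list {n : ℕ} (γ : Path d n) (w : Bond d → ℝ) :
    ∃ l ∈ paths d n, γ.value (fun e => w (toBond e)) = pathSum w 0 0 l := by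
  have key : ∀ k (hk : k ≤ n), ∃ l : List (Dir d), l.length = k ∧
      disp l = (γ.vertex ⟨k, by omega⟩).1.1 ∧ (γ.vertex ⟨k, by omega⟩).1.2 = k ∧
      pathSum w 0 0 l = ∑ i ∈ Finset.range k,
        if h : i < n then w (toBond (γ.edge ⟨i, h⟩)) else 0 := by
    intro k
    induction k with
    | zero =>
      intro _
      have h0 : γ.vertex ⟨0, by omega⟩ = origin d := γ.start
      exact ⟨[], rfl, by rw [h0]; rfl, by rw [h0]; rfl, by simp [pathSum]⟩
    | succ k ih =>
      intro hk
      obtain ⟨l, h1, h2, h3, h4⟩ := ih (by omega)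
      have h5 := toBond_spec (γ.edge ⟨k, by omega⟩)
      have h6 := (γ.step ⟨k, by omega⟩).1
      refine ⟨l ++ [(toBond (γ.edge ⟨k, by omega⟩)).2.2], by simp [h1], ?_, ?_, ?_⟩
      · rw [disp_append, h2]
        simp only [disp, add_zero]
        exact h5.symm
      · exact h6.trans (congrArg (· + 1) h3)
      · rw [pathSum_append, h4, Finset.sum_range_succ, dif_pos (by omega)]
        congr 1
        simp only [pathSum, zero_add, add_zero, h1, h2]
        congr 1
        exact Prod.ext rfl (Prod.ext h3.symm rfl)
  obtain ⟨l, h1, -, -, h4⟩ := key n le_rfl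
  refine ⟨l, by simpa using h1, ?_⟩
  rw [h4, Path.value, Finset.sum_range]
  exact Finset.sum_congr rfl fun i _ => by rw [dif_pos i.2]

/-- The paths in `Ξ` and the lists of steps have the same values. -/
theorem iSup_path_value (hd : 1 ≤ d) (n : ℕ) (w : Bond d → ℝ) :
    ⨆ γ : Path d n, γ.value (fun e => w (toBond e)) = pathMax (paths d n) w 0 0 := by
  have : Nonempty (Path d n) := Path.nonempty hd n
  refine le_antisymm (ciSup_le fun γ => ?_) (pathMax_le (paths_nonempty hd n) fun l hl => ?_)
  · obtain ⟨l, hl, h⟩ := γ.exists_list w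
    rw [h]
    exact pathSum_le_pathMax hl w 0 0
  · rw [mem_paths] at hl
    rw [← listPath_value l hl w]
    exact le_ciSup (f := fun γ : Path d n => γ.value (fun e => w (toBond e)))
      (Set.finite_range _).bddAbove (listPath l hl)

theorem measurable_iSup_path_value (n : ℕ) :
    Measurable (fun v : Edge d → ℝ => ⨆ γ : Path d n, γ.value v) := by
  refine Measurable.iSup fun γ => ?_
  unfold Path.value
  fun_prop

section Transfer

variable {Ω : Type*} [MeasurableSpace Ω] {P : Measure Ω} [IsProbabilityMeasure P]
  {X : Edge d → Ω → ℝ} {ν : Measure ℝ} [IsProbabilityMeasure ν]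

theorem measurePreserving_field (hmeas : ∀ e, Measurable (X e)) (hindep : iIndepFun X P)
    (hlaw : ∀ e, P.map (X e) = ν) :
    MeasurePreserving (fun ω e => X e ω) P (iidLaw (Edge d) ν) := by
  refine ⟨measurable_pi_lambda _ hmeas, ?_⟩
  rw [(iIndepFun_iff_map_fun_eq_infinitePi_map hmeas).1 hindep]
  simp only [hlaw]

/-- The law of `Z` is that of `pathMax` in a canonical field on all the edges of the lattice, of which
the edges of `Ξ` form a subset. -/
theorem measure_Z_le (hd : 1 ≤ d) (hmeas : ∀ e, Measurable (X e)) (hindep : iIndepFun X P)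
    (hlaw : ∀ e, P.map (X e) = ν) (n : ℕ) (v : ℝ) :
    P {ω | Z X n ω ≤ v} = iidLaw (Bond d) ν {w | pathMax (paths d n) w 0 0 ≤ v} := by
  have hms : MeasurableSet {u : Edge d → ℝ | ⨆ γ : Path d n, γ.value u ≤ v} :=
    measurableSet_le (measurable_iSup_path_value n) measurable_const
  have h1 := (measurePreserving_field hmeas hindep hlaw).measure_preimage hms.nullMeasurableSet
  have h2 := (measurePreserving_relabel (ν := ν) (toBond_injective (d := d))).measure_preimage
    hms.nullMeasurableSet
  refine (h1.trans h2.symm).trans ?_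
  congr 1
  ext w
  simp only [Set.mem_preimage, Set.mem_ofPred_eq]
  rw [iSup_path_value hd n w]

theorem ae_tendsto_Z_div (hd : 1 ≤ d) (hmeas : ∀ e, Measurable (X e)) (hindep : iIndepFun X P)
    (hlaw : ∀ e, P.map (X e) = ν) {μ : ℝ}
    (h : ∀ᵐ w ∂(iidLaw (Bond d) ν),
      Tendsto (fun n : ℕ => pathMax (paths d n) w 0 0 / n) atTop (𝓝 μ)) :
    ∀ᵐ ω ∂P, Tendsto (fun n : ℕ => Z X n ω / n) atTop (𝓝 μ) := by
  have hms : MeasurableSet {u : Edge d → ℝ |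
      Tendsto (fun n : ℕ => (⨆ γ : Path d n, γ.value u) / n) atTop (𝓝 μ)} :=
    measurableSet_tendsto _ fun n => (measurable_iSup_path_value n).div_const _
  have hrel := measurePreserving_relabel (ν := ν) (toBond_injective (d := d))
  have h1 : ∀ᵐ u ∂(iidLaw (Edge d) ν),
      Tendsto (fun n : ℕ => (⨆ γ : Path d n, γ.value u) / n) atTop (𝓝 μ) := by
    rw [← hrel.map_eq, ae_map_iff hrel.measurable.aemeasurable hms]
    filter_upwards [h] with w hw
    simpa only [iSup_path_value hd _ w] using hw
  exact (measurePreserving_field hmeas hindep hlaw).quasiMeasurePreserving.ae h1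

end Transfer

/-- An exponential bound at speed `n ^ s` gives a negative rate. -/
theorem limsup_rate_neg {s : ℕ} {a : ℕ → ENNReal} {δ : ℝ} (hδ : 0 < δ)
    (h : ∀ᶠ n : ℕ in atTop, a n ≤ ENNReal.ofReal (Real.exp (-(δ * (n : ℝ) ^ s)))) :
    limsup (fun n : ℕ => ((1 / (n : ℝ) ^ s : ℝ) : EReal) * ENNReal.log (a n)) atTop < 0 := by
  refine lt_of_le_of_lt (b := ((-δ : ℝ) : EReal)) ?_ (by exact_mod_cast neg_lt_zero.2 hδ)
  refine limsup_le_of_le (by isBoundedDefault) ?_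
  filter_upwards [h, eventually_ge_atTop 1] with n hn hn1
  have hn1' : (1 : ℝ) ≤ n := by exact_mod_cast hn1
  have h1 := ENNReal.log_monotone hn
  rw [ENNReal.log_ofReal_of_pos (Real.exp_pos _), Real.log_exp] at h1
  have h2 : (0 : EReal) ≤ ((1 / (n : ℝ) ^ s : ℝ) : EReal) := by
    exact_mod_cast (by positivity : (0 : ℝ) ≤ 1 / (n : ℝ) ^ s)
  refine (mul_le_mul_of_nonneg_left h1 h2).trans (le_of_eq ?_)
  rw [← EReal.coe_mul]
  congr 1
  field_simp

/-- If the probabilities exceed every exponential rate at speed `n ^ s`, the limsup is not negative. -/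
theorem not_limsup_rate_neg {s : ℕ} {a : ℕ → ENNReal}
    (h : ∀ δ : ℝ, 0 < δ → ∀ᶠ n : ℕ in atTop,
      ENNReal.ofReal (Real.exp (-(δ * (n : ℝ) ^ s))) ≤ a n) :
    ¬ limsup (fun n : ℕ => ((1 / (n : ℝ) ^ s : ℝ) : EReal) * ENNReal.log (a n)) atTop < 0 := by
  intro hlt
  obtain ⟨r, hr1, hr2⟩ := EReal.lt_iff_exists_real_btwn.1 hlt
  have hr0 : r < 0 := by exact_mod_cast hr2
  refine absurd hr1 (not_lt.2 (le_limsup_of_frequently_le (Eventually.frequently ?_)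
    (by isBoundedDefault)))
  filter_upwards [h (-r) (by linarith), eventually_ge_atTop 1] with n hn hn1
  have hn1' : (1 : ℝ) ≤ n := by exact_mod_cast hn1
  have h1 := ENNReal.log_monotone hn
  rw [ENNReal.log_ofReal_of_pos (Real.exp_pos _), Real.log_exp] at h1
  have h2 : (0 : EReal) ≤ ((1 / (n : ℝ) ^ s : ℝ) : EReal) := by
    exact_mod_cast (by positivity : (0 : ℝ) ≤ 1 / (n : ℝ) ^ s)
  refine le_trans (le_of_eq ?_) (mul_le_mul_of_nonneg_left h1 h2)
  rw [← EReal.coe_mul]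
  congr 1
  field_simp

end LPP

theorem theorem1p1 (d : ℕ) (hd : 1 ≤ d)
    {Ω : Type*} [MeasurableSpace Ω] (P : Measure Ω) [IsProbabilityMeasure P]
    (X : LPP.Edge d → Ω → ℝ)
    -- the field is i.i.d. with mean zero
    (hmeas : ∀ e, Measurable (X e))
    (hindep : iIndepFun X P)
    (hident : ∀ e e', IdentDistrib (X e) (X e') P P)
    (hmean : ∀ e, ∫ ω, X e ω ∂P = 0)
    -- the Cramér condition
    (hcramer : ∃ c₀ : ℝ, 0 < c₀ ∧
      ∀ e, ∀ c : ℝ, |c| < c₀ → Integrable (fun ω => Real.exp (c * X e ω)) P)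
    -- the lower tail
    (M₀ : ℝ) (hM₀ : 0 < M₀) (f : ℝ → ℝ)
    (hfpos : ∀ x, 0 < x → 0 < f x)
    (hfmono : MonotoneOn f (Set.Ioi M₀))
    (htail : ∀ e, ∀ x : ℝ, x < -M₀ →
      Real.log (P.real {ω | X e ω < x}) = -((-x) ^ (d + 1) * f (-x))) :
    ∃ μ : ℝ,
      (∀ᵐ ω ∂P, Tendsto (fun n : ℕ => LPP.Z X n ω / n) atTop (𝓝 μ)) ∧
      ∃ ε₀ : ℝ, 0 < ε₀ ∧ ∀ ε : ℝ, 0 < ε → ε < ε₀ →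
        (limsup (fun n : ℕ => ((1 / (n : ℝ) ^ (d + 1) : ℝ) : EReal) *
            ENNReal.log (P {ω | LPP.Z X n ω ≤ (μ - ε) * n})) atTop < 0
          ↔ Summable (fun n : ℕ => 1 / f (2 ^ (n + 1)) ^ (1 / (d : ℝ)))) := by
  obtain ⟨γ⟩ := LPP.Path.nonempty hd 1
  set e₀ : LPP.Edge d := γ.edge 0 with he₀
  set ν : Measure ℝ := P.map (X e₀) with hν
  have : IsProbabilityMeasure ν := Measure.isProbabilityMeasure_map (hmeas e₀).aemeasurable
  have hlaw : ∀ e, P.map (X e) = ν := fun e => (hident e e₀).map_eq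
  obtain ⟨c₀, hc₀, hexp⟩ := hcramer
  have hc : 0 < c₀ / 2 := by positivity
  have hνexp : Integrable (fun x => Real.exp (c₀ / 2 * |x|)) ν := by
    rw [hν, integrable_map_measure (by fun_prop) (hmeas e₀).aemeasurable]
    have h1 := hexp e₀ (c₀ / 2) (by rw [abs_of_pos hc]; linarith)
    have h2 := hexp e₀ (-(c₀ / 2)) (by rw [abs_neg, abs_of_pos hc]; linarith)
    have hm := hmeas e₀
    refine (h1.add h2).mono' (by fun_prop) (ae_of_all _ fun ω => ?_)
    simp only [Function.comp_apply, Pi.add_apply, Real.norm_eq_abs, Real.abs_exp]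
    rcases abs_choice (X e₀ ω) with h | h
    · rw [h]
      linarith [Real.exp_pos (-(c₀ / 2) * X e₀ ω)]
    · rw [h, mul_neg, ← neg_mul]
      linarith [Real.exp_pos (c₀ / 2 * X e₀ ω)]
  have htail' : ∀ x : ℝ, x < -M₀ →
      Real.log (ν.real (Set.Iio x)) = -((-x) ^ (d + 1) * f (-x)) := by
    intro x hx
    rw [← htail e₀ x hx, hν, map_measureReal_apply (hmeas e₀) measurableSet_Iio]
    rfl
  obtain ⟨μ, hμ⟩ := LPP.exists_timeConstant (ν := ν) hd hc hνexp
  refine ⟨μ, LPP.ae_tendsto_Z_div hd hmeas hindep hlaw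
    (LPP.ae_tendsto_pathMax_div hd hc hνexp hμ), 1, one_pos, fun ε hε _ => ?_⟩
  simp only [LPP.measure_Z_le hd hmeas hindep hlaw]
  have hsum : Summable (fun n : ℕ => 1 / f (2 ^ (n + 1)) ^ (1 / (d : ℝ))) ↔
      Summable (LPP.scaleWeight d f) := summable_nat_add_iff (f := LPP.scaleWeight d f) 1
  rw [hsum]
  constructor
  · intro h
    by_contra hns
    exact LPP.not_limsup_rate_neg (fun δ hδ => LPP.exp_le_measure_low hd hc hνexp hμ hM₀ hfpos
      hfmono htail' hns hε hδ) h
  · intro h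
    obtain ⟨δ, hδ, hle⟩ := LPP.measure_low_le_exp hd hc hνexp hμ hM₀ hfpos hfmono htail' h hε
    exact LPP.limsup_rate_neg hδ hle
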